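/- **Setting.** Let $n\in\mathbb N$ and $q>2$. Write $|x|=\min_{k\in\mathbb Z}|x-k|$ for $x\in\mathbb R/\mathbb Z$. For $0<s<1$ put $$[f]_{W^{s,q}}=\Big(\iint_{\mathbb R/\mathbb Z\times\mathbb R/\mathbb Z}\frac{|f(x)-f(y)|^q}{|x-y|^{1+sq}}\,dx\,dy\Big)^{1/q},\qquad \|f\|_{W^{s,q}}=\|f\|_{L^q}+[f]_{W^{s,q}},$$ and let $W^{2-1/q,q}=W^{2-1/q,q}(\mathbb R/\mathbb Z,\mathbb R^n)$ be the space of $u\in L^q$ with weak derivative $u'\in L^q$ and $[u']_{W^{1-1/q,q}}<\infty$; its elements are identified with their continuous (in fact $C^1$) representatives. With $|a\wedge b|^2=|a|^2|b|^2-\langle a,b\rangle^2$, let $$\mathrm{TP}(u)=\frac1q\iint_{\mathbb R/\mathbb Z\times\mathbb R/\mathbb Z}\frac{|u'(y)\wedge(u(x)-u(y))|^q}{|u(x)-u(y)|^{2q}}\,dx\,dy\in[0,\infty],$$ and let $\delta\mathrm{TP}(u)[w]=\frac{d}{d\tau}\big|_{\tau=0}\mathrm{TP}(u+\tau w)$ and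 $\delta^2\mathrm{TP}(u)[v,w]=\frac{d}{d\sigma}\big|_{\sigma=0}\delta\mathrm{TP}(u+\sigma w)[v]$ denote the first and second variations of $\mathrm{TP}$. **Lemma 2.1.** For all $n\in\mathbb N$, $q>2$, $0<\lambda\le\Lambda$ and $M>0$ there are constants $c_1,c_2,R>0$, depending only on $\lambda,\Lambda,M,n,q$, such that the following holds for every curve $u\in W^{2-1/q,q}$ that is embedded (injective) and regular ($u'\neq0$ everywhere) with $$\lambda\le|u'|\le\Lambda\quad\text{on }\mathbb R/\mathbb Z\qquad\text{and}\qquad \mathrm{TP}(u)\le M .$$ 1. For every $w\in W^{2-1/q,q}$ the first variation $\delta\mathrm{TP}(u)[w]$ exists and $$|\delta\mathrm{TP}(u)[w]|\le c_1\,\|u'\|_{W^{1-1/q,q}}^{q}\,\|w'\|_{W^{1-1/q,q}} .$$ 2. For every $z\in W^{2-1/q,q}$ with $\|z'\|_{W^{1-1/q,q}}\le R$ and all $v,w\in W^{2-1/q,q}$ the second variation $\delta^2\mathrm{TP}(u+z)[v,w]$ exists and $$|\delta^2\mathrm{TP}(u+z)[v,w]|\le c_2\big(\|u'\|_{W^{1-1/q,q}}^{2q+2}+1\big)\|v'\|_{W^{1-1/q,q}}\|w'\|_{W^{1-1/q,q}}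 .$$ -/

import Mathlib

open MeasureTheory Filter Topology
open scoped ENNReal ContDiff

noncomputable section

/-- The derivative `f'(x)` of a map `f` on the circle `ℝ/ℤ`. -/
def circleDeriv {F : Type*} [NormedAddCommGroup F] [NormedSpace ℝ F]
    (f : UnitAddCircle → F) (x : UnitAddCircle) : F :=
  deriv (fun t : ℝ => f (x + (t : UnitAddCircle))) 0

/-- `g` is a weak derivative of `f` on `ℝ/ℤ`: integration by parts holds against every smooth
(1-periodic) test function. -/
def IsWeakDeriv {F : Type*} [NormedAddCommGroup F] [NormedSpace ℝ F]
    (f g : UnitAddCircle → F) : Prop :=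
  ∀ φ : UnitAddCircle → ℝ, ContDiff ℝ ∞ (fun t : ℝ => φ (t : UnitAddCircle)) →
    ∫ x, circleDeriv φ x • f x = -∫ x, φ x • g x

/-- The Sobolev--Slobodeckij seminorm
`(∬ |f(x) - f(y)|^q / |x - y|^(1 + s q) dx dy)^(1/q)` of a map on `ℝ/ℤ`, with values in `[0, ∞]`;
`‖x - y‖` is the distance `min_k |x - y - k|` on the circle. -/
def slobodeckijSeminorm {F : Type*} [NormedAddCommGroup F] (s q : ℝ)
    (f : UnitAddCircle → F) : ℝ≥0∞ :=
  (∫⁻ p : UnitAddCircle × UnitAddCircle,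
    ENNReal.ofReal (‖f p.1 - f p.2‖ ^ q / ‖p.1 - p.2‖ ^ (1 + s * q))) ^ (1 / q)

/-- The norm `‖f‖_{L^q} + [f]_{W^{s,q}}` of an element `f` of `W^{s,q}(ℝ/ℤ)`, `0 < s < 1`. -/
def slobodeckijNorm {F : Type*} [NormedAddCommGroup F] (s q : ℝ)
    (f : UnitAddCircle → F) : ℝ :=
  (eLpNorm f (ENNReal.ofReal q) volume + slobodeckijSeminorm s q f).toReal

/-- `f ∈ W^{1+s,q}(ℝ/ℤ)` for `0 < s < 1`: `f` and its weak derivative are in `L^q`, and the weak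
derivative has finite Sobolev--Slobodeckij seminorm. -/
def MemSobolevOneAdd {F : Type*} [NormedAddCommGroup F] [NormedSpace ℝ F] (s q : ℝ)
    (f : UnitAddCircle → F) : Prop :=
  MemLp f (ENNReal.ofReal q) volume ∧
    ∃ g : UnitAddCircle → F, IsWeakDeriv f g ∧ MemLp g (ENNReal.ofReal q) volume ∧
      slobodeckijSeminorm s q g ≠ ⊤

/-- `u` is (the continuous representative of) an element of `W^{2-1/q,q}(ℝ/ℤ, ℝⁿ)`. -/
def IsSobolevCurve {n : ℕ} (q : ℝ) (u : UnitAddCircle → EuclideanSpace ℝ (Fin n)) : Prop :=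
  Continuous u ∧ MemSobolevOneAdd (1 - 1 / q) q u

/-- The norm `|a ∧ b|`, given by `|a ∧ b|² = |a|² |b|² - ⟨a, b⟩²`. -/
def wedgeNorm {n : ℕ} (a b : EuclideanSpace ℝ (Fin n)) : ℝ :=
  √(‖a‖ ^ 2 * ‖b‖ ^ 2 - inner ℝ a b ^ 2)

/-- The tangent-point functional
`(1/q) ∬ |u'(y) ∧ (u(x) - u(y))|^q / |u(x) - u(y)|^(2q) dx dy`, with values in `[0, ∞]`
(here `p = (x, y)`). -/
def tangentPoint {n : ℕ} (q : ℝ) (u : UnitAddCircle → EuclideanSpace ℝ (Fin n)) : ℝ≥0∞ :=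
  ENNReal.ofReal (1 / q) * ∫⁻ p : UnitAddCircle × UnitAddCircle,
    ENNReal.ofReal (wedgeNorm (circleDeriv u p.2) (u p.1 - u p.2) ^ q
      / ‖u p.1 - u p.2‖ ^ (2 * q))

/-- The first variation `δTP(u)[w] = d/dτ TP(u + τ w) |_{τ = 0}` exists and equals `d`
(`TP` being finite along `u + τ w` for small `τ`). -/
def HasFirstVariation {n : ℕ} (q : ℝ) (u w : UnitAddCircle → EuclideanSpace ℝ (Fin n))
    (d : ℝ) : Prop :=
  (∀ᶠ τ : ℝ in 𝓝 0, tangentPoint q (u + τ • w) ≠ ⊤) ∧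
    HasDerivAt (fun τ : ℝ => (tangentPoint q (u + τ • w)).toReal) d 0

/-- The second variation `δ²TP(u)[v, w] = d/dσ δTP(u + σ w)[v] |_{σ = 0}` exists and equals `d`. -/
def HasSecondVariation {n : ℕ} (q : ℝ) (u v w : UnitAddCircle → EuclideanSpace ℝ (Fin n))
    (d : ℝ) : Prop :=
  ∃ D : ℝ → ℝ, (∀ᶠ σ : ℝ in 𝓝 0, HasFirstVariation q (u + σ • w) v (D σ)) ∧
    HasDerivAt D d 0

end

/-! Write `h` for the signed circle distance from `y` to `x`, and to a curve `w` attach the triple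
`A = w'(y)`, `B = (w(x) - w(y)) / h`, `C = (B - A) / h`. Since `B = A + hC`, one has `A ∧ B = h (A ∧
C)`, and the integrand of TP becomes `|A ∧ C|^q |B|^(-2q)`. The triple depends linearly on the
curve. Hence TP along `u + τw` is the integral of one fixed function along a line of triples, and
both variations come from differentiating under the integral sign. For `q > 2` that function is
twice differentiable along lines wherever `B ≠ 0`, including where `A ∧ C = 0`.

Three estimates make the differentiated integrands integrable. (i) `A` and `B` are bounded by the
supremum of the derivative, which Morrey's inequality controls by the `W^{1-1/q,q}` norm
(`norm_le_slobodeckijNorm`). (ii) `C` is the mean of `(w'(y + θh) - w'(y)) / h` over `θ ∈ [0,1]`, so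
a Hardy inequality bounds its `L^q` norm by the seminorm of `w'`
(`FiniteEnergyCurve.lintegral_taylorQuotient_le`). (iii) `|B| ≥ β` off the diagonal, with `β`
depending only on `q, lam, Lam, M` (`exists_biLipschitz_const`). Every term of the derivatives then
carries exactly `q` factors of type `C`, and Young's inequality closes the estimate.

For (iii), on an arc where the unit tangent turns little the integrand of TP dominates the
difference quotients of the unit tangent. The energy bound and Morrey's inequality then show that
the tangent cannot turn by `1/4` within a uniform length `κ`, so short arcs have chords comparable
to their length. Among pairs at distance at least `κ`, a shortest chord either belongs to distance
`κ` or is orthogonal to the tangent at an endpoint. In the latter case a chord of length `d` forces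
energy of order `d^(2-q)`, and `q > 2` bounds `d` from below.

The weak derivative has to be identified with a continuous classical one beforehand. This is done by
testing against primitives of concentrating trigonometric kernels and by Morrey's dyadic averages.
At the end, `lam ≤ ‖u'‖` absorbs the constant term of the first bound, and `R` is small enough that
adding `z` at most halves the chord constant. -/

noncomputable section

/-! ### Concentrating kernels, and weak derivatives as classical ones -/

/-- The kernel `(1 + cos 2πt) / 2`, whose powers concentrate at the integers. -/
def cosBump (t : ℝ) : ℝ := (1 + Real.cos (2 * Real.pi * t)) / 2

lemma cosBump_contDiff : ContDiff ℝ ∞ cosBump := by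
  unfold cosBump; fun_prop

lemma cosBump_continuous : Continuous cosBump := cosBump_contDiff.continuous

lemma cosBump_nonneg (t : ℝ) : 0 ≤ cosBump t := by
  unfold cosBump; linarith [Real.neg_one_le_cos (2 * Real.pi * t)]

lemma cosBump_zero : cosBump 0 = 1 := by simp [cosBump]

lemma cosBump_periodic : Function.Periodic cosBump 1 := by
  intro t
  unfold cosBump
  rw [mul_add, mul_one, Real.cos_add_two_pi]

lemma cosBump_lt_one {t : ℝ} (ht : |t| < 1) (h0 : t ≠ 0) : cosBump t < 1 := by
  have h1 : Real.cos (2 * Real.pi * t) ≠ 1 := by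
    intro h
    have := (Real.cos_eq_one_iff_of_lt_of_lt (x := 2 * Real.pi * t) ?_ ?_).1 h
    · simp [Real.pi_ne_zero, h0] at this
    · nlinarith [Real.pi_pos, (abs_lt.1 ht).1]
    · nlinarith [Real.pi_pos, (abs_lt.1 ht).2]
  have h2 := lt_of_le_of_ne (Real.cos_le_one _) h1
  unfold cosBump; linarith

/-- The window used to normalise the powers of `cosBump`. -/
def bumpWindow : Set ℝ := Set.Icc (-(5 / 8)) (5 / 8)

def bumpMass (k : ℕ) : ℝ := ∫ t in bumpWindow, cosBump t ^ k

/-- On the window the kernel attains its maximum only at 0, because the other integers lie outside;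
normalised powers therefore form an approximate identity there. -/
lemma tendsto_cosBump_average {F : Type*} [NormedAddCommGroup F] [NormedSpace ℝ F]
    [CompleteSpace F] {h : ℝ → F} (hi : IntegrableOn h bumpWindow) (hc : ContinuousAt h 0) :
    Tendsto (fun k : ℕ => (bumpMass k)⁻¹ • ∫ t in bumpWindow, cosBump t ^ k • h t) atTop
      (𝓝 (h 0)) := by
  refine tendsto_setIntegral_pow_smul_of_unique_maximum_of_isCompact_of_integrableOn
    (s := bumpWindow) isCompact_Icc cosBump_continuous.continuousOn ?_ (fun x _ => cosBump_nonneg x)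
    (by simp [cosBump_zero]) ?_ hi hc.continuousWithinAt
  · intro y hy h0
    rw [cosBump_zero]
    refine cosBump_lt_one ?_ h0
    rw [abs_lt]; constructor <;> linarith [hy.1, hy.2]
  · unfold bumpWindow
    rw [interior_Icc]
    apply subset_closure
    constructor <;> norm_num

lemma bumpMass_pos (k : ℕ) : 0 < bumpMass k := by
  unfold bumpMass bumpWindow
  rw [setIntegral_pos_iff_support_of_nonneg_ae]
  · refine lt_of_lt_of_le (b := volume (Set.Ioo (-(1/4) : ℝ) (1/4))) (by simp) ?_
    refine measure_mono fun t ht => ⟨?_, ?_, ?_⟩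
    · have : 0 < Real.cos (2 * Real.pi * t) := by
        apply Real.cos_pos_of_mem_Ioo
        constructor <;> nlinarith [Real.pi_pos, ht.1, ht.2]
      simp only [Function.mem_support]
      apply pow_ne_zero
      unfold cosBump; positivity
    · linarith [ht.1]
    · linarith [ht.2]
  · exact Eventually.of_forall fun t => pow_nonneg (cosBump_nonneg t) k
  · exact (cosBump_continuous.pow k).continuousOn.integrableOn_compact isCompact_Icc

def bumpPrim (k : ℕ) (t : ℝ) : ℝ := ∫ s in (0 : ℝ)..t, cosBump s ^ k

lemma bumpPrim_hasDerivAt (k : ℕ) (t : ℝ) : HasDerivAt (bumpPrim k) (cosBump t ^ k) t :=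
  (cosBump_continuous.pow k).integral_hasStrictDerivAt 0 t |>.hasDerivAt

lemma bumpPrim_contDiff (k : ℕ) : ContDiff ℝ ∞ (bumpPrim k) := by
  rw [contDiff_infty_iff_deriv]
  refine ⟨fun t => (bumpPrim_hasDerivAt k t).differentiableAt, ?_⟩
  have : deriv (bumpPrim k) = fun t => cosBump t ^ k := funext fun t => (bumpPrim_hasDerivAt k t).deriv
  rw [this]
  exact cosBump_contDiff.pow k

lemma cosBump_pow_periodic (k : ℕ) : Function.Periodic (fun t => cosBump t ^ k) 1 := by
  intro t; simp only [cosBump_periodic t]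

lemma bumpPrim_sub (k : ℕ) (a b : ℝ) : bumpPrim k b - bumpPrim k a = ∫ s in a..b, cosBump s ^ k := by
  unfold bumpPrim
  exact intervalIntegral.integral_interval_sub_left
    ((cosBump_continuous.pow k).intervalIntegrable _ _) ((cosBump_continuous.pow k).intervalIntegrable _ _)

/-- A single primitive of the kernel is not periodic, since its mean is positive. In the difference
the increments over one period cancel, so only the difference is an admissible test function. -/
lemma bumpTest_periodic (k : ℕ) (a b : ℝ) :
    Function.Periodic (fun t => bumpPrim k (b - t) - bumpPrim k (a - t)) 1 := by
  intro t
  have h := (cosBump_pow_periodic k).intervalIntegral_add_eq (b - (t + 1)) (a - (t + 1))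
  simp only [← bumpPrim_sub] at h
  ring_nf at h ⊢
  linarith

lemma circleDeriv_coe {F : Type*} [NormedAddCommGroup F] [NormedSpace ℝ F]
    {f : UnitAddCircle → F} {t : ℝ} {d : F}
    (h : HasDerivAt (fun s : ℝ => f (s : UnitAddCircle)) d t) : circleDeriv f (t : UnitAddCircle) = d := by
  unfold circleDeriv
  have h2 : (fun s : ℝ => f ((t : UnitAddCircle) + (s : UnitAddCircle))) =
      fun s : ℝ => (fun s : ℝ => f (s : UnitAddCircle)) (t + s) := by
    ext s; simp
  rw [h2]
  have h3 : HasDerivAt (fun s : ℝ => f (s : UnitAddCircle)) d (t + 0) := by simpa using h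
  simpa using (h3.comp_const_add t 0).deriv

/-- The powers of the kernel, on the circle. -/
def circleBump (k : ℕ) : UnitAddCircle → ℝ := (cosBump_pow_periodic k).lift

lemma circleBump_coe (k : ℕ) (t : ℝ) : circleBump k (t : UnitAddCircle) = cosBump t ^ k :=
  (cosBump_pow_periodic k).lift_coe t

lemma setIntegral_bumpWindow_indicator {F : Type*} [NormedAddCommGroup F] [NormedSpace ℝ F] (f : ℝ → F)
    (k : ℕ) :
    ∫ t in bumpWindow, cosBump t ^ k • (Set.Ioc (-(1/2) : ℝ) (1/2)).indicator f t =
      ∫ t in Set.Ioc (-(1/2) : ℝ) (1/2), cosBump t ^ k • f t := by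
  have : ∀ t, cosBump t ^ k • (Set.Ioc (-(1/2) : ℝ) (1/2)).indicator f t =
      (Set.Ioc (-(1/2) : ℝ) (1/2)).indicator (fun t => cosBump t ^ k • f t) t := fun t => by
    by_cases ht : t ∈ Set.Ioc (-(1/2) : ℝ) (1/2)
    · rw [Set.indicator_of_mem ht, Set.indicator_of_mem ht]
    · rw [Set.indicator_of_notMem ht, Set.indicator_of_notMem ht, smul_zero]
  simp_rw [this]
  rw [setIntegral_indicator measurableSet_Ioc]
  congr 2
  ext t
  simp only [bumpWindow, Set.mem_inter_iff, Set.mem_Icc, Set.mem_Ioc]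
  constructor
  · exact fun h => h.2
  · intro h
    refine ⟨⟨?_, ?_⟩, h⟩ <;> linarith [h.1, h.2]

lemma integral_circleBump_sub {F : Type*} [NormedAddCommGroup F] [NormedSpace ℝ F]
    (f : UnitAddCircle → F) (k : ℕ) (a : ℝ) :
    ∫ y, circleBump k ((a : UnitAddCircle) - y) • f y =
      ∫ t in Set.Ioc (-(1/2) : ℝ) (1/2), cosBump t ^ k • f ((a - t : ℝ) : UnitAddCircle) := by
  have h1 := integral_sub_left_eq_self (fun y => circleBump k ((a : UnitAddCircle) - y) • f y)
    (volume : Measure UnitAddCircle) (a : UnitAddCircle)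
  rw [← h1]
  have h2 := UnitAddCircle.integral_preimage (-(1/2)) (fun y : UnitAddCircle =>
    circleBump k ((a : UnitAddCircle) - (a - y)) • f (a - y))
  rw [← h2, show (-(1/2) + 1 : ℝ) = 1/2 by norm_num]
  refine setIntegral_congr_fun measurableSet_Ioc fun t _ => ?_
  simp only [sub_sub_cancel, circleBump_coe, AddCircle.coe_sub]

/-- The kernel is normalised by its mass over the window, which is longer than a period. The limit
is unaffected: cutting the function off to one period changes nothing near 0, where the mass
concentrates. -/
lemma tendsto_circleBump_average {F : Type*} [NormedAddCommGroup F] [NormedSpace ℝ F]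
    [CompleteSpace F] {u : UnitAddCircle → F} (hu : Continuous u) (a : ℝ) :
    Tendsto (fun k : ℕ => (bumpMass k)⁻¹ • ∫ y, circleBump k ((a : UnitAddCircle) - y) • u y) atTop
      (𝓝 (u a)) := by
  have hcont : Continuous fun t : ℝ => u ((a - t : ℝ) : UnitAddCircle) :=
    hu.comp ((AddCircle.continuous_mk' 1).comp (continuous_const.sub continuous_id))
  simp_rw [integral_circleBump_sub, ← setIntegral_bumpWindow_indicator]
  have := tendsto_cosBump_average (h := (Set.Ioc (-(1/2) : ℝ) (1/2)).indicator
    fun t => u ((a - t : ℝ) : UnitAddCircle)) ?_ ?_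
  · simpa using this
  · exact (hcont.continuousOn.integrableOn_compact isCompact_Icc).indicator measurableSet_Ioc
  · refine hcont.continuousAt.congr ?_
    filter_upwards [Ioo_mem_nhds (show (-(1/2):ℝ) < 0 by norm_num) (show (0:ℝ) < 1/2 by norm_num)] with t ht
    rw [Set.indicator_of_mem (Set.Ioo_subset_Ioc_self ht)]

/-- The test function `y ↦ ∫_a^b c^k(x - y) dx`. -/
def bumpTest (k : ℕ) (a b : ℝ) : UnitAddCircle → ℝ := (bumpTest_periodic k a b).lift

lemma bumpTest_coe (k : ℕ) (a b t : ℝ) :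
    bumpTest k a b (t : UnitAddCircle) = bumpPrim k (b - t) - bumpPrim k (a - t) :=
  (bumpTest_periodic k a b).lift_coe t

lemma bumpTest_contDiff (k : ℕ) (a b : ℝ) :
    ContDiff ℝ ∞ (fun t : ℝ => bumpTest k a b (t : UnitAddCircle)) := by
  simp_rw [bumpTest_coe]
  exact ((bumpPrim_contDiff k).comp (contDiff_const.sub contDiff_id)).sub
    ((bumpPrim_contDiff k).comp (contDiff_const.sub contDiff_id))

lemma circleDeriv_bumpTest (k : ℕ) (a b : ℝ) (x : UnitAddCircle) :
    circleDeriv (bumpTest k a b) x = circleBump k (a - x) - circleBump k (b - x) := by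
  induction x using QuotientAddGroup.induction_on with | _ t
  have h : ∀ c : ℝ, HasDerivAt (fun t => bumpPrim k (c - t)) (-(cosBump (c - t) ^ k)) t := fun c => by
    exact (bumpPrim_hasDerivAt k (c - t)).comp_const_sub c t
  change circleDeriv (bumpTest k a b) (t : UnitAddCircle) =
    circleBump k ((a : UnitAddCircle) - (t : UnitAddCircle)) - circleBump k ((b : UnitAddCircle) - (t : UnitAddCircle))
  rw [circleDeriv_coe (d := -(cosBump (b - t) ^ k) - -(cosBump (a - t) ^ k))]
  · rw [← AddCircle.coe_sub, ← AddCircle.coe_sub, circleBump_coe, circleBump_coe]; ring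
  · simp_rw [bumpTest_coe]
    exact (h b).sub (h a)

lemma circleBump_continuous (k : ℕ) : Continuous (circleBump k) := by
  refine (QuotientAddGroup.isQuotientMap_mk _).continuous_iff.2 ?_
  exact (cosBump_continuous.pow k).congr fun t => (circleBump_coe k t).symm

/-- A continuous function with an integrable weak derivative is a primitive of it (short intervals). -/
lemma IsWeakDeriv.sub_eq_integral_of_le {F : Type*} [NormedAddCommGroup F] [NormedSpace ℝ F]
    [CompleteSpace F] {u g : UnitAddCircle → F} (h : IsWeakDeriv u g) (hu : Continuous u)
    (hg : Integrable g) {a b : ℝ} (hab : a ≤ b) (hb : b ≤ a + 1/4) :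
    u b - u a = ∫ t in a..b, g (t : UnitAddCircle) := by
  -- The weak derivative is tested on `bumpTest k a b`, whose derivative is the difference of the
  -- kernels centred at `a` and `b`. In the limit the left side gives `u a - u b`, while the test
  -- function on the right tends to the indicator of `(a, b]`.
  have h1 : ∀ k, (bumpMass k)⁻¹ • (∫ y, circleBump k ((a : UnitAddCircle) - y) • u y) -
      (bumpMass k)⁻¹ • (∫ y, circleBump k ((b : UnitAddCircle) - y) • u y) =
      -∫ t in Set.Ioc (a - 3/8) (a - 3/8 + 1), ((bumpMass k)⁻¹ *
        (bumpPrim k (b - t) - bumpPrim k (a - t))) • g (t : UnitAddCircle) := by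
    intro k
    have h2 := h (bumpTest k a b) (bumpTest_contDiff k a b)
    have hint : ∀ c : ℝ, Integrable fun y => circleBump k ((c : UnitAddCircle) - y) • u y := fun c =>
      (((circleBump_continuous k).comp (continuous_const.sub continuous_id)).smul hu).integrable_of_hasCompactSupport
        (HasCompactSupport.of_compactSpace _)
    simp_rw [circleDeriv_bumpTest, sub_smul] at h2
    rw [integral_sub (hint a) (hint b)] at h2
    -- With the period starting at `a - 3/8` and `b ≤ a + 1/4`, both `a - t` and `b - t` stay in
    -- `[-5/8, 5/8]`, which explains the size of the window.
    rw [← smul_sub, h2, smul_neg, ← integral_smul, ← UnitAddCircle.integral_preimage (a - 3/8)]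
    congr 1
    refine setIntegral_congr_fun measurableSet_Ioc fun t _ => ?_
    simp only [bumpTest_coe, smul_smul]
  have h3 := (tendsto_circleBump_average hu a).sub (tendsto_circleBump_average hu b)
  simp_rw [h1] at h3
  have hgi : IntegrableOn (fun t : ℝ => g (t : UnitAddCircle)) (Set.Ioc (a - 3/8) (a - 3/8 + 1)) :=
    ((UnitAddCircle.measurePreserving_mk (a - 3/8)).integrable_comp_of_integrable hg)
  have h4 : Tendsto (fun k : ℕ => ∫ t in Set.Ioc (a - 3/8) (a - 3/8 + 1), ((bumpMass k)⁻¹ *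
        (bumpPrim k (b - t) - bumpPrim k (a - t))) • g (t : UnitAddCircle)) atTop
      (𝓝 (∫ t in Set.Ioc (a - 3/8) (a - 3/8 + 1), (Set.Ioc a b).indicator (fun t : ℝ => g (t : UnitAddCircle)) t)) := by
    have key : ∀ t ∈ Set.Ioc (a - 3/8) (a - 3/8 + 1), ∀ k, bumpPrim k (b - t) - bumpPrim k (a - t) =
        ∫ s in bumpWindow, cosBump s ^ k • (Set.Ioc (a - t) (b - t)).indicator (fun _ => (1 : ℝ)) s := by
      intro t ht k
      have : ∀ s, cosBump s ^ k • (Set.Ioc (a - t) (b - t)).indicator (fun _ => (1 : ℝ)) s =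
        (Set.Ioc (a - t) (b - t)).indicator (fun s => cosBump s ^ k) s := fun s => by
        by_cases hs : s ∈ Set.Ioc (a - t) (b - t) <;> simp [hs]
      simp_rw [this]
      rw [setIntegral_indicator measurableSet_Ioc, bumpPrim_sub, intervalIntegral.integral_of_le (by linarith)]
      congr 2
      ext s
      simp only [bumpWindow, Set.mem_inter_iff, Set.mem_Icc, Set.mem_Ioc] at ht ⊢
      constructor
      · intro hs; refine ⟨⟨?_, ?_⟩, hs⟩ <;> linarith [hs.1, hs.2, ht.1, ht.2]
      · exact fun h => h.2
    refine tendsto_integral_of_dominated_convergence (fun t => ‖g (t : UnitAddCircle)‖) ?_ hgi.norm ?_ ?_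
    · intro k
      refine AEStronglyMeasurable.smul (Continuous.aestronglyMeasurable ?_) hgi.aestronglyMeasurable
      have := (bumpPrim_contDiff k).continuous
      fun_prop
    · intro k
      refine (ae_restrict_iff' measurableSet_Ioc).2 (Eventually.of_forall fun t ht => ?_)
      rw [norm_smul]
      refine mul_le_of_le_one_left (norm_nonneg _) ?_
      have hpos := bumpMass_pos k
      have hnn : 0 ≤ bumpPrim k (b - t) - bumpPrim k (a - t) := by
        rw [bumpPrim_sub]
        exact intervalIntegral.integral_nonneg (by linarith) fun s _ => pow_nonneg (cosBump_nonneg s) k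
      rw [Real.norm_of_nonneg (by positivity), inv_mul_le_iff₀ hpos, mul_one, key t ht k]
      unfold bumpMass
      refine setIntegral_mono_on ?_ ?_ measurableSet_Icc fun s _ => ?_
      · have : ∀ s, cosBump s ^ k • (Set.Ioc (a - t) (b - t)).indicator (fun _ => (1 : ℝ)) s =
          (Set.Ioc (a - t) (b - t)).indicator (fun s => cosBump s ^ k) s := fun s => by
          by_cases hs : s ∈ Set.Ioc (a - t) (b - t) <;> simp [hs]
        simp_rw [this]
        exact ((cosBump_continuous.pow k).continuousOn.integrableOn_compact isCompact_Icc).indicator measurableSet_Ioc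
      · exact ((cosBump_continuous.pow k).continuousOn.integrableOn_compact isCompact_Icc)
      · have := pow_nonneg (cosBump_nonneg s) k
        by_cases hs : s ∈ Set.Ioc (a - t) (b - t) <;> simp [hs, this]
    -- At `t = a` or `t = b` the indicator jumps at the concentration point; these two values form a
    -- null set.
    · have hne : ∀ᵐ t : ℝ ∂volume.restrict (Set.Ioc (a - 3/8) (a - 3/8 + 1)), t ≠ a ∧ t ≠ b :=
        ae_restrict_of_ae ((Measure.ae_ne volume a).and (Measure.ae_ne volume b))
      filter_upwards [hne, (ae_restrict_iff' measurableSet_Ioc).2 (Eventually.of_forall fun t ht => ht)] with t hne ht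
      have hio : (Set.Ioc a b).indicator (fun t : ℝ => g (t : UnitAddCircle)) t =
          (Set.Ioc (a - t) (b - t)).indicator (fun _ => (1 : ℝ)) 0 • g (t : UnitAddCircle) := by
        by_cases h0 : t ∈ Set.Ioc a b
        · rw [Set.indicator_of_mem h0, Set.indicator_of_mem, one_smul]
          exact ⟨by linarith [lt_of_le_of_ne h0.1.le hne.1.symm], by linarith [h0.2]⟩
        · rw [Set.indicator_of_notMem h0, Set.indicator_of_notMem, zero_smul]
          intro h1; exact h0 ⟨by linarith [h1.1], by linarith [h1.2]⟩
      rw [hio]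
      refine Tendsto.smul_const ?_ _
      simp_rw [key t ht]
      refine tendsto_cosBump_average ?_ ?_
      · exact (integrableOn_const (by simp [bumpWindow])).indicator measurableSet_Ioc
      · rcases lt_or_gt_of_ne hne.1 with h1 | h1
        · refine continuousAt_const.congr (f := fun _ => 0) ?_
          filter_upwards [Iio_mem_nhds (show (0:ℝ) < a - t by linarith)] with s hs
          rw [Set.indicator_of_notMem]
          exact fun h2 => absurd h2.1 (not_lt.2 (le_of_lt hs))
        rcases lt_or_gt_of_ne hne.2 with h2 | h2
        · refine continuousAt_const.congr (f := fun _ => 1) ?_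
          filter_upwards [Ioo_mem_nhds (show a - t < (0:ℝ) by linarith) (show (0:ℝ) < b - t by linarith)] with s hs
          rw [Set.indicator_of_mem (Set.Ioo_subset_Ioc_self hs)]
        · refine continuousAt_const.congr (f := fun _ => 0) ?_
          filter_upwards [Ioi_mem_nhds (show b - t < (0:ℝ) by linarith)] with s hs
          rw [Set.indicator_of_notMem]
          exact fun h2 => absurd h2.2 (not_le.2 hs)
  have h5 := tendsto_nhds_unique h3 h4.neg
  rw [← neg_inj, neg_sub, h5, neg_inj, setIntegral_indicator measurableSet_Ioc,
    intervalIntegral.integral_of_le hab]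
  congr 2
  ext t
  simp only [Set.mem_inter_iff, Set.mem_Ioc]
  constructor
  · exact fun h => h.2
  · intro h; refine ⟨⟨?_, ?_⟩, h⟩ <;> linarith [h.1, h.2]

/-! ### Morrey's inequality through dyadic averages -/

section Averages

variable {F : Type*} [NormedAddCommGroup F]

/-- The double integral `∬ |f(s) - f(t)|^q / |s - t|^q` over `I × I`. -/
def intervalEnergy (q : ℝ) (f : ℝ → F) (I : Set ℝ) : ℝ≥0∞ :=
  ∫⁻ p in I ×ˢ I, ENNReal.ofReal (‖f p.1 - f p.2‖ ^ q / |p.1 - p.2| ^ q)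

lemma intervalEnergy_mono (q : ℝ) (f : ℝ → F) {I J : Set ℝ} (h : I ⊆ J) :
    intervalEnergy q f I ≤ intervalEnergy q f J :=
  lintegral_mono_set (Set.prod_mono h h)

lemma enorm_rpow_le_of_abs_le {q : ℝ} (hq : 0 < q) (f : ℝ → F) {s t r : ℝ} (hst : |s - t| ≤ r) :
    ‖f s - f t‖ₑ ^ q ≤ ENNReal.ofReal (r ^ q) * ENNReal.ofReal (‖f s - f t‖ ^ q / |s - t| ^ q) := by
  have hr : 0 ≤ r := (abs_nonneg _).trans hst
  rw [← ofReal_norm, ENNReal.ofReal_rpow_of_nonneg (norm_nonneg _) hq.le,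
    ← ENNReal.ofReal_mul (by positivity)]
  apply ENNReal.ofReal_le_ofReal
  rcases eq_or_ne s t with rfl | hne
  · simp [Real.zero_rpow hq.ne']
  · have h0 : 0 < |s - t| := abs_pos.2 (sub_ne_zero.2 hne)
    have h1 : |s - t| ^ q ≤ r ^ q := Real.rpow_le_rpow h0.le hst hq.le
    have h2 : 0 < |s - t| ^ q := Real.rpow_pos_of_pos h0 q
    rw [mul_div_assoc', le_div_iff₀ h2, mul_comm]
    exact mul_le_mul_of_nonneg_right h1 (by positivity)

variable [NormedSpace ℝ F]

/-- The average of `f` over `(x, x + r]`. -/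
def intervalAvg (f : ℝ → F) (x r : ℝ) : F := r⁻¹ • ∫ t in Set.Ioc x (x + r), f t

/-- The difference of the two averages is the mean of `f s - f t` over the product of the intervals.
Hölder passes to the `q`-th power, and `|s - t| ≤ r` inserts the weight of the energy at the cost of
a factor `r^q`. -/
lemma norm_intervalAvg_sub_le {q : ℝ} (hq : 1 < q) {f : ℝ → F} {a r x₁ r₁ x₂ r₂ K : ℝ}
    (hf : IntegrableOn f (Set.Ioc a (a + r)))
    (h₁ : 0 < r₁) (h₂ : 0 < r₂) (hK : 0 ≤ K)
    (hJ₁ : Set.Ioc x₁ (x₁ + r₁) ⊆ Set.Ioc a (a + r)) (hJ₂ : Set.Ioc x₂ (x₂ + r₂) ⊆ Set.Ioc a (a + r))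
    (hE : intervalEnergy q f (Set.Ioc a (a + r)) ≤ ENNReal.ofReal K) :
    ‖intervalAvg f x₁ r₁ - intervalAvg f x₂ r₂‖ ≤ r * (K / (r₁ * r₂)) ^ (1 / q) := by
  have hq0 : 0 < q := by linarith
  have hr : 0 < r := by
    have := (hJ₁ (Set.right_mem_Ioc.2 (show x₁ < x₁ + r₁ by linarith)))
    linarith [this.1, this.2]
  set J₁ := Set.Ioc x₁ (x₁ + r₁)
  set J₂ := Set.Ioc x₂ (x₂ + r₂)
  set I := Set.Ioc a (a + r)
  set μ₁ := volume.restrict J₁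
  set μ₂ := volume.restrict J₂
  have hi₁ : Integrable f μ₁ := hf.mono_set hJ₁
  have hi₂ : Integrable f μ₂ := hf.mono_set hJ₂
  have hm₁ : μ₁ Set.univ = ENNReal.ofReal r₁ := by simp [μ₁, J₁]
  have hm₂ : μ₂ Set.univ = ENNReal.ofReal r₂ := by simp [μ₂, J₂]
  have hd₁ : Integrable (fun p : ℝ × ℝ => f p.1) (μ₁.prod μ₂) := hi₁.comp_fst μ₂
  have hd₂ : Integrable (fun p : ℝ × ℝ => f p.2) (μ₁.prod μ₂) := hi₂.comp_snd μ₁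
  have hint : ∫ p, (f p.1 - f p.2) ∂(μ₁.prod μ₂) =
      (r₁ * r₂) • (intervalAvg f x₁ r₁ - intervalAvg f x₂ r₂) := by
    rw [integral_sub hd₁ hd₂, integral_fun_fst, integral_fun_snd]
    simp only [Measure.real, hm₁, hm₂, ENNReal.toReal_ofReal h₁.le, ENNReal.toReal_ofReal h₂.le]
    unfold intervalAvg
    rw [smul_sub, smul_smul, smul_smul]
    congr 2 <;> field_simp
  have hmeas : AEStronglyMeasurable (fun p : ℝ × ℝ => f p.1 - f p.2) (μ₁.prod μ₂) :=
    (hd₁.sub hd₂).aestronglyMeasurable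
  have hle := eLpNorm_le_eLpNorm_mul_rpow_measure_univ (p := 1) (q := ENNReal.ofReal q)
    (by rw [← ENNReal.ofReal_one]; exact ENNReal.ofReal_le_ofReal hq.le) hmeas
  rw [eLpNorm_one_eq_lintegral_enorm, eLpNorm_eq_lintegral_rpow_enorm_toReal (by simpa using hq0)
    ENNReal.ofReal_ne_top, ENNReal.toReal_ofReal hq0.le, ENNReal.toReal_one] at hle
  have huniv : (μ₁.prod μ₂) Set.univ = ENNReal.ofReal (r₁ * r₂) := by
    rw [← Set.univ_prod_univ, Measure.prod_prod, hm₁, hm₂, ENNReal.ofReal_mul h₁.le]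
  have hlint : ∫⁻ p, ‖f p.1 - f p.2‖ₑ ^ q ∂(μ₁.prod μ₂) ≤ ENNReal.ofReal (r ^ q * K) := by
    have e : μ₁.prod μ₂ = (volume.prod volume).restrict (J₁ ×ˢ J₂) := Measure.prod_restrict _ _
    rw [e]
    calc ∫⁻ p in J₁ ×ˢ J₂, ‖f p.1 - f p.2‖ₑ ^ q ∂(volume.prod volume)
        ≤ ∫⁻ p in I ×ˢ I, ‖f p.1 - f p.2‖ₑ ^ q ∂(volume.prod volume) :=
          lintegral_mono_set (Set.prod_mono hJ₁ hJ₂)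
      _ ≤ ∫⁻ p in I ×ˢ I, ENNReal.ofReal (r ^ q) *
            ENNReal.ofReal (‖f p.1 - f p.2‖ ^ q / |p.1 - p.2| ^ q) ∂(volume.prod volume) := by
          refine setLIntegral_mono' (measurableSet_Ioc.prod measurableSet_Ioc) fun p hp => ?_
          refine enorm_rpow_le_of_abs_le hq0 f ?_
          rw [abs_le]
          constructor <;> linarith [hp.1.1, hp.1.2, hp.2.1, hp.2.2]
      _ = ENNReal.ofReal (r ^ q) * intervalEnergy q f I := lintegral_const_mul' _ _ ENNReal.ofReal_ne_top
      _ ≤ ENNReal.ofReal (r ^ q) * ENNReal.ofReal K := by gcongr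
      _ = _ := (ENNReal.ofReal_mul (by positivity)).symm
  have hfin : ‖(r₁ * r₂) • (intervalAvg f x₁ r₁ - intervalAvg f x₂ r₂)‖ ≤
      (r ^ q * K) ^ (1 / q) * (r₁ * r₂) ^ (1 - 1 / q) := by
    rw [← hint]
    have hq1 : 1 / q < 1 := by rw [div_lt_one hq0]; exact hq
    have h3 : ‖∫ p, (f p.1 - f p.2) ∂(μ₁.prod μ₂)‖ₑ ≤
        ENNReal.ofReal ((r ^ q * K) ^ (1 / q) * (r₁ * r₂) ^ (1 - 1 / q)) := by
      refine (enorm_integral_le_lintegral_enorm _).trans (hle.trans ?_)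
      rw [huniv, ENNReal.ofReal_mul (p := (r ^ q * K) ^ (1 / q)) (by positivity), div_one,
        ← ENNReal.ofReal_rpow_of_nonneg (x := r ^ q * K) (by positivity) (by positivity),
        ← ENNReal.ofReal_rpow_of_nonneg (x := r₁ * r₂) (by positivity) (by linarith)]
      gcongr
    rw [← ofReal_norm] at h3
    exact (ENNReal.ofReal_le_ofReal_iff (by positivity)).1 h3
  have hpos : 0 < r₁ * r₂ := mul_pos h₁ h₂
  rw [norm_smul, Real.norm_of_nonneg hpos.le, Real.mul_rpow (by positivity) hK, ← Real.rpow_mul hr.le,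
    mul_one_div_cancel hq0.ne', Real.rpow_one, Real.rpow_sub hpos, Real.rpow_one] at hfin
  rw [Real.div_rpow hK hpos.le]
  have h5 : 0 < (r₁ * r₂) ^ (1 / q) := by positivity
  have h6 : r * K ^ (1 / q) * (r₁ * r₂ / (r₁ * r₂) ^ (1 / q)) =
      (r₁ * r₂) * (r * (K ^ (1 / q) / (r₁ * r₂) ^ (1 / q))) := by field_simp
  rw [h6] at hfin
  exact le_of_mul_le_mul_left hfin hpos

/-- The constant in Morrey's inequality. -/
def morreyConst (q : ℝ) : ℝ := 2 ^ (1 / q) / (1 - (1 / 2) ^ (1 - 2 / q))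

/-- The condition `q > 2` makes the dyadic telescoping series converge. -/
lemma morrey_ratio {q : ℝ} (hq : 2 < q) : (1 / 2 : ℝ) ^ (1 - 2 / q) < 1 := by
  have : 2 / q < 1 := by rw [div_lt_one (by linarith)]; exact hq
  exact Real.rpow_lt_one (by norm_num) (by norm_num) (by linarith)

lemma morreyConst_pos {q : ℝ} (hq : 2 < q) : 0 < morreyConst q :=
  div_pos (by positivity) (by linarith [morrey_ratio hq])

/-- Halving an interval of length `ρ` changes the average by at most a multiple of `ρ · ρ^(-2/q)`.
The left ends `c k` are left free so that the nested intervals can shrink to either endpoint of the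
first one. -/
lemma dist_intervalAvg_succ_le {q : ℝ} (hq : 2 < q) {f : ℝ → F} {r K : ℝ} {c : ℕ → ℝ}
    (hr : 0 < r) (hK : 0 ≤ K)
    (hf : IntegrableOn f (Set.Ioc (c 0) (c 0 + r)))
    (hc : ∀ k, Set.Ioc (c (k + 1)) (c (k + 1) + r * (1 / 2) ^ (k + 1)) ⊆
      Set.Ioc (c k) (c k + r * (1 / 2) ^ k))
    (hE : intervalEnergy q f (Set.Ioc (c 0) (c 0 + r)) ≤ ENNReal.ofReal K) (k : ℕ) :
    dist (intervalAvg f (c k) (r * (1 / 2) ^ k)) (intervalAvg f (c (k + 1)) (r * (1 / 2) ^ (k + 1))) ≤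
      (2 ^ (1 / q) * r ^ (1 - 2 / q) * K ^ (1 / q)) * ((1 / 2) ^ (1 - 2 / q)) ^ k := by
  have hq0 : 0 < q := by linarith
  have hsub : ∀ k, Set.Ioc (c k) (c k + r * (1 / 2) ^ k) ⊆ Set.Ioc (c 0) (c 0 + r) := by
    intro k
    induction k with
    | zero => simp
    | succ k ih => exact (hc k).trans ih
  have hρ : 0 < r * (1 / 2 : ℝ) ^ k := by positivity
  rw [dist_eq_norm]
  refine (norm_intervalAvg_sub_le (by linarith) (hf.mono_set (hsub k)) hρ (by positivity) hK subset_rfl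
    (hc k) ((intervalEnergy_mono q f (hsub k)).trans hE)).trans (le_of_eq ?_)
  have e1 : ((1 / 2 : ℝ) ^ (1 - 2 / q)) ^ k = ((1 / 2 : ℝ) ^ k) ^ (1 - 2 / q) := by
    rw [← Real.rpow_natCast, ← Real.rpow_natCast, ← Real.rpow_mul (by norm_num), ← Real.rpow_mul (by norm_num), mul_comm]
  rw [e1]
  have e2 : r ^ (1 - 2 / q) * ((1 / 2 : ℝ) ^ k) ^ (1 - 2 / q) = (r * (1 / 2) ^ k) ^ (1 - 2 / q) :=
    (Real.mul_rpow hr.le (by positivity)).symm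
  rw [show ∀ a b c d : ℝ, a * b * c * d = a * c * (b * d) by intros; ring, e2, pow_succ,
    ← mul_assoc r]
  generalize r * (1 / 2 : ℝ) ^ k = ρ at hρ ⊢
  have e3 : K / (ρ * (ρ * (1 / 2))) = 2 * K * ρ ^ (-2 : ℝ) := by
    rw [Real.rpow_neg hρ.le, Real.rpow_two]; field_simp
  rw [e3, Real.mul_rpow (by positivity) (by positivity), Real.mul_rpow (by norm_num) hK, ← Real.rpow_mul hρ.le,
    show (1 - 2 / q) = 1 + -2 * (1 / q) by ring, Real.rpow_add hρ, Real.rpow_one]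
  ring

lemma dist_intervalAvg_le_of_tendsto {q : ℝ} (hq : 2 < q) {f : ℝ → F} {r K : ℝ} {c : ℕ → ℝ}
    (hr : 0 < r) (hK : 0 ≤ K)
    (hf : IntegrableOn f (Set.Ioc (c 0) (c 0 + r)))
    (hc : ∀ k, Set.Ioc (c (k + 1)) (c (k + 1) + r * (1 / 2) ^ (k + 1)) ⊆
      Set.Ioc (c k) (c k + r * (1 / 2) ^ k))
    (hE : intervalEnergy q f (Set.Ioc (c 0) (c 0 + r)) ≤ ENNReal.ofReal K) {y : F}
    (hy : Tendsto (fun k => intervalAvg f (c k) (r * (1 / 2) ^ k)) atTop (𝓝 y)) :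
    dist (intervalAvg f (c 0) r) y ≤ morreyConst q * r ^ (1 - 2 / q) * K ^ (1 / q) := by
  have := dist_le_of_le_geometric_of_tendsto₀ _ _ (morrey_ratio hq)
    (dist_intervalAvg_succ_le hq hr hK hf hc hE) hy
  simp only [pow_zero, mul_one] at this
  refine this.trans (le_of_eq ?_)
  unfold morreyConst; ring

lemma dist_intervalAvg_le_of_continuousAt [CompleteSpace F] {f : ℝ → F} (hf : Continuous f) {p ε : ℝ} (hε : 0 < ε) :
    ∃ δ > 0, ∀ x r, 0 < r → r < δ → x ≤ p → p ≤ x + r → dist (intervalAvg f x r) (f p) ≤ ε := by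
  obtain ⟨δ, hδ, h⟩ := Metric.continuous_iff.1 hf p ε hε
  refine ⟨δ, hδ, fun x r hr hrδ h1 h2 => ?_⟩
  have hi : IntervalIntegrable f volume x (x + r) := hf.intervalIntegrable _ _
  have e : intervalAvg f x r - f p = r⁻¹ • ∫ t in x..x + r, (f t - f p) := by
    rw [intervalIntegral.integral_sub hi (by simp), smul_sub]
    unfold intervalAvg
    rw [intervalIntegral.integral_of_le (by linarith)]
    simp [smul_smul, hr.ne']
  rw [dist_eq_norm, e, norm_smul, Real.norm_of_nonneg (by positivity), inv_mul_le_iff₀ hr]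
  refine (intervalIntegral.norm_integral_le_of_norm_le_const (C := ε) fun t ht => ?_).trans
    (le_of_eq (by rw [add_sub_cancel_left, abs_of_pos hr, mul_comm]))
  rw [Set.uIoc_of_le (by linarith)] at ht
  rw [← dist_eq_norm]
  refine (h t ?_).le
  rw [Real.dist_eq, abs_lt]
  constructor <;> linarith [ht.1, ht.2]

lemma tendsto_intervalAvg [CompleteSpace F] {f : ℝ → F} (hf : Continuous f) {p r : ℝ} {c : ℕ → ℝ} (hr : 0 < r)
    (h1 : ∀ k, c k ≤ p) (h2 : ∀ k, p ≤ c k + r * (1 / 2) ^ k) :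
    Tendsto (fun k => intervalAvg f (c k) (r * (1 / 2) ^ k)) atTop (𝓝 (f p)) := by
  rw [Metric.tendsto_atTop']
  intro ε hε
  obtain ⟨δ, hδ, h⟩ := dist_intervalAvg_le_of_continuousAt hf (p := p) (half_pos hε)
  have ht : Tendsto (fun k : ℕ => r * (1 / 2 : ℝ) ^ k) atTop (𝓝 (r * 0)) :=
    (tendsto_pow_atTop_nhds_zero_of_lt_one (by norm_num) (by norm_num)).const_mul r
  rw [mul_zero] at ht
  obtain ⟨N, hN⟩ := (ht.eventually (gt_mem_nhds hδ)).exists_forall_of_atTop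
  exact ⟨N, fun k hk => (h _ _ (by positivity) (hN k hk.le) (h1 k) (h2 k)).trans_lt (half_lt_self hε)⟩

/-- Morrey's inequality on an interval. -/
lemma norm_sub_le_of_intervalEnergy_le [CompleteSpace F] {q : ℝ} (hq : 2 < q) {f : ℝ → F} (hf : Continuous f)
    {x y K : ℝ} (hxy : x < y) (hK : 0 ≤ K) (hE : intervalEnergy q f (Set.Ioc x y) ≤ ENNReal.ofReal K) :
    ‖f x - f y‖ ≤ 2 * morreyConst q * (y - x) ^ (1 - 2 / q) * K ^ (1 / q) := by
  have hr : 0 < y - x := sub_pos.2 hxy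
  have hpow : ∀ k : ℕ, (y - x) * (1 / 2 : ℝ) ^ (k + 1) ≤ (y - x) * (1 / 2 : ℝ) ^ k := fun k =>
    mul_le_mul_of_nonneg_left (pow_le_pow_of_le_one (by norm_num) (by norm_num) (Nat.le_succ k)) hr.le
  have hfi : IntegrableOn f (Set.Ioc x y) :=
    (hf.continuousOn.integrableOn_compact isCompact_Icc).mono_set Set.Ioc_subset_Icc_self
  have h1 := dist_intervalAvg_le_of_tendsto hq (c := fun _ => x) hr hK (by simpa using hfi)
    (fun k => Set.Ioc_subset_Ioc le_rfl (by linarith [hpow k])) (by simpa using hE)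
    (tendsto_intervalAvg hf (p := x) hr (fun _ => le_rfl) (fun k => by
      have : 0 < (y - x) * (1 / 2 : ℝ) ^ k := by positivity
      linarith))
  -- Both endpoints are reached from the same first interval `(x, y]`: above with the left end
  -- fixed, here with the right end fixed.
  have h2 := dist_intervalAvg_le_of_tendsto hq (c := fun k => y - (y - x) * (1 / 2) ^ k) hr hK
    (by simpa using hfi)
    (fun k => Set.Ioc_subset_Ioc (by linarith [hpow k]) (by linarith)) (by simpa using hE)
    (tendsto_intervalAvg hf (p := y) hr (fun k => by
      have : 0 < (y - x) * (1 / 2 : ℝ) ^ k := by positivity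
      linarith) (fun k => by linarith))
  simp only [pow_zero, mul_one, sub_sub_cancel] at h1 h2
  rw [← dist_eq_norm]
  linarith [dist_triangle_left (f x) (f y) (intervalAvg f x (y - x))]

end Averages

/-! ### Energies on the circle and the continuous representative of the derivative -/

section Circle

variable {F : Type*} [NormedAddCommGroup F]

/-- The `q`-th power of the seminorm of `W^{1-1/q,q}`. -/
def circleEnergy (q : ℝ) (f : UnitAddCircle → F) : ℝ≥0∞ :=
  ∫⁻ p : UnitAddCircle × UnitAddCircle, ENNReal.ofReal (‖f p.1 - f p.2‖ ^ q / ‖p.1 - p.2‖ ^ q)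

lemma slobodeckijSeminorm_eq {q : ℝ} (hq : 0 < q) (f : UnitAddCircle → F) :
    slobodeckijSeminorm (1 - 1 / q) q f = circleEnergy q f ^ (1 / q) := by
  unfold slobodeckijSeminorm circleEnergy
  rw [show 1 + (1 - 1 / q) * q = q by field_simp; ring]

lemma circleEnergy_ne_top {q : ℝ} (hq : 0 < q) {f : UnitAddCircle → F}
    (h : slobodeckijSeminorm (1 - 1 / q) q f ≠ ⊤) : circleEnergy q f ≠ ⊤ := by
  rw [slobodeckijSeminorm_eq hq] at h
  intro h2
  rw [h2, ENNReal.top_rpow_of_pos (by positivity)] at h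
  exact h rfl

lemma circleEnergy_congr_ae {q : ℝ} {f g : UnitAddCircle → F} (h : f =ᵐ[volume] g) :
    circleEnergy q f = circleEnergy q g := by
  unfold circleEnergy
  refine lintegral_congr_ae ?_
  have h1 : ∀ᵐ p : UnitAddCircle × UnitAddCircle, f p.1 = g p.1 :=
    Measure.quasiMeasurePreserving_fst.ae h
  have h2 : ∀ᵐ p : UnitAddCircle × UnitAddCircle, f p.2 = g p.2 :=
    Measure.quasiMeasurePreserving_snd.ae h
  filter_upwards [h1, h2] with p h1 h2
  rw [h1, h2]

lemma norm_coe_le_abs (t : ℝ) : ‖(t : UnitAddCircle)‖ ≤ |t| := by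
  rw [UnitAddCircle.norm_eq]
  simpa using round_le t 0

/-- The two fundamental intervals start at independent points, so that a small square around an
arbitrary pair of parameters fits inside the domain. -/
lemma lintegral_circle_prod (a b : ℝ) {f : UnitAddCircle × UnitAddCircle → ℝ≥0∞} (hf : AEMeasurable f) :
    ∫⁻ p, f p = ∫⁻ p in Set.Ioc a (a + 1) ×ˢ Set.Ioc b (b + 1), f ((p.1 : UnitAddCircle), (p.2 : UnitAddCircle)) := by
  have hmp := (UnitAddCircle.measurePreserving_mk a).prod (UnitAddCircle.measurePreserving_mk b)
  rw [Measure.prod_restrict] at hmp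
  have h := lintegral_map' (f := f) (by rw [hmp.map_eq]; exact hf) hmp.measurable.aemeasurable
  rw [hmp.map_eq] at h
  exact h

/-- The circle distance is at most `|s - t|`, so the circle kernel is the larger one. Where the
circle distance vanishes the two values of `f` agree and both quotients are 0. -/
lemma intervalEnergy_le_circleEnergy {q : ℝ} (hq : 0 < q) {f : UnitAddCircle → F}
    (hf : AEStronglyMeasurable f) (a : ℝ) :
    intervalEnergy q (fun t : ℝ => f t) (Set.Ioc a (a + 1)) ≤ circleEnergy q f := by
  unfold intervalEnergy circleEnergy
  rw [lintegral_circle_prod a a]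
  · refine setLIntegral_mono' (measurableSet_Ioc.prod measurableSet_Ioc) fun p _ => ?_
    apply ENNReal.ofReal_le_ofReal
    by_cases h0 : ((p.1 : UnitAddCircle) - (p.2 : UnitAddCircle)) = 0
    · have h1 : f p.1 = f p.2 := by rw [sub_eq_zero.1 h0]
      simp [h1, Real.zero_rpow hq.ne']
    · have : 0 < ‖((p.1 : UnitAddCircle) - (p.2 : UnitAddCircle))‖ := norm_pos_iff.2 h0
      gcongr
      rw [← AddCircle.coe_sub]
      exact norm_coe_le_abs _
  · have h1 := ((hf.comp_fst (ν := (volume : Measure UnitAddCircle))).sub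
      (hf.comp_snd (μ := (volume : Measure UnitAddCircle)))).norm.aemeasurable
    have h2 : Measurable fun p : UnitAddCircle × UnitAddCircle => ‖p.1 - p.2‖ := by
      exact (continuous_fst.sub continuous_snd).norm.measurable
    exact ((h1.pow_const q).div (h2.pow_const q).aemeasurable).ennreal_ofReal

variable [NormedSpace ℝ F] [CompleteSpace F]

lemma ae_circle_of_ae {P : UnitAddCircle → Prop} (h : ∀ᵐ t : ℝ, t ∈ Set.Ioc (0:ℝ) 1 → P t) :
    ∀ᵐ x : UnitAddCircle, P x := by
  have h1 := (ae_restrict_iff_subtype measurableSet_Ioc).1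
    ((ae_restrict_iff' (s := Set.Ioc (0:ℝ) (0 + 1)) measurableSet_Ioc).2 (by simpa using h))
  have h2 := (AddCircle.measurePreserving_equivIoc 1 (a := 0)).quasiMeasurePreserving.ae h1
  filter_upwards [h2] with x hx
  have : ((AddCircle.equivIoc 1 0 x : ℝ) : UnitAddCircle) = x := (AddCircle.equivIoc 1 0).symm_apply_apply x
  rwa [this] at hx

/-- A continuous function on the circle whose weak derivative has finite Slobodeckij energy is `C¹`. -/
lemma IsWeakDeriv.exists_continuous {q : ℝ} (hq : 2 < q) {u g : UnitAddCircle → F}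
    (h : IsWeakDeriv u g) (hu : Continuous u) (hg : Integrable g) (hE : circleEnergy q g ≠ ⊤) :
    ∃ G : UnitAddCircle → F, Continuous G ∧ G =ᵐ[volume] g ∧
      ∀ t : ℝ, HasDerivAt (fun s : ℝ => u s) (G t) t := by
  have hq0 : 0 < q := by linarith
  set f : ℝ → F := fun t => g t with hf_def
  have hfper : Function.Periodic f 1 := fun t => by simp [f]
  have hfI : ∀ a b, IntervalIntegrable f volume a b := by
    apply hfper.intervalIntegrable₀ one_ne_zero
    rw [intervalIntegrable_iff_integrableOn_Ioc_of_le zero_le_one]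
    have := (UnitAddCircle.measurePreserving_mk 0).integrable_comp_of_integrable hg
    rw [zero_add] at this
    exact this
  have hfi : ∀ x, IntegrableOn f (Set.Ioc x (x + 1)) := fun x =>
    (intervalIntegrable_iff_integrableOn_Ioc_of_le (by linarith)).1 (hfI x (x + 1))
  set K := (circleEnergy q g).toReal
  have hK : 0 ≤ K := ENNReal.toReal_nonneg
  have hEx : ∀ x, intervalEnergy q f (Set.Ioc x (x + 1)) ≤ ENNReal.ofReal K := fun x => by
    rw [ENNReal.ofReal_toReal hE]
    exact intervalEnergy_le_circleEnergy hq0 hg.aestronglyMeasurable x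
  have hstep : ∀ x k, dist (intervalAvg f x (1 * (1 / 2) ^ k)) (intervalAvg f x (1 * (1 / 2) ^ (k + 1))) ≤
      (2 ^ (1 / q) * 1 ^ (1 - 2 / q) * K ^ (1 / q)) * ((1 / 2) ^ (1 - 2 / q)) ^ k := fun x k =>
    dist_intervalAvg_succ_le hq (c := fun _ => x) one_pos hK (hfi x)
      (fun k => Set.Ioc_subset_Ioc le_rfl (by
        have : (1 / 2 : ℝ) ^ (k + 1) ≤ (1 / 2) ^ k := pow_le_pow_of_le_one (by norm_num) (by norm_num) (Nat.le_succ k)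
        linarith)) (hEx x) k
  simp only [one_mul, Real.one_rpow, mul_one] at hstep
  have hex : ∀ x, ∃ y, Tendsto (fun k : ℕ => intervalAvg f x ((1 / 2) ^ k)) atTop (𝓝 y) := fun x =>
    cauchySeq_tendsto_of_complete (cauchySeq_of_le_geometric _ _ (morrey_ratio hq) (hstep x))
  choose G0 hG0 using hex
  have hdist : ∀ x k, dist (intervalAvg f x ((1 / 2) ^ k)) (G0 x) ≤
      2 ^ (1 / q) * K ^ (1 / q) * ((1 / 2) ^ (1 - 2 / q)) ^ k / (1 - (1 / 2) ^ (1 - 2 / q)) := fun x k =>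
    dist_le_of_le_geometric_of_tendsto _ _ (morrey_ratio hq) (hstep x) (hG0 x) k
  have hcontavg : ∀ k : ℕ, Continuous fun x => intervalAvg f x ((1 / 2) ^ k) := fun k => by
    have hc : Continuous fun x => ∫ t in (0 : ℝ)..x, f t := intervalIntegral.continuous_primitive hfI 0
    have : (fun x => intervalAvg f x ((1 / 2) ^ k)) = fun x => ((1 / 2 : ℝ) ^ k)⁻¹ •
        ((∫ t in (0 : ℝ)..(x + (1 / 2) ^ k), f t) - ∫ t in (0 : ℝ)..x, f t) := by
      ext x
      rw [intervalIntegral.integral_interval_sub_left (hfI _ _) (hfI _ _)]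
      unfold intervalAvg
      rw [intervalIntegral.integral_of_le]
      have : (0 : ℝ) < (1 / 2) ^ k := by positivity
      linarith
    rw [this]
    exact ((hc.comp (continuous_id.add continuous_const)).sub hc).const_smul _
  -- The averages over `(x, x + 2^(-k)]` converge at a geometric rate independent of `x`, and each
  -- is continuous in `x`; the limit is therefore continuous.
  have hG0c : Continuous G0 := by
    have hunif : TendstoUniformly (fun (k : ℕ) x => intervalAvg f x ((1 / 2) ^ k)) G0 atTop := by
      rw [Metric.tendstoUniformly_iff]
      intro ε hε
      have ht : Tendsto (fun k : ℕ => 2 ^ (1 / q) * K ^ (1 / q) * ((1 / 2 : ℝ) ^ (1 - 2 / q)) ^ k /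
          (1 - (1 / 2) ^ (1 - 2 / q))) atTop (𝓝 (2 ^ (1 / q) * K ^ (1 / q) * 0 / (1 - (1 / 2) ^ (1 - 2 / q)))) :=
        ((tendsto_pow_atTop_nhds_zero_of_lt_one (by positivity) (morrey_ratio hq)).const_mul _).div_const _
      rw [mul_zero, zero_div] at ht
      filter_upwards [ht.eventually (gt_mem_nhds hε)] with k hk x
      rw [dist_comm]
      exact (hdist x k).trans_lt hk
    exact hunif.continuous (Frequently.of_forall hcontavg)
  have hG0per : Function.Periodic G0 1 := fun x => by
    refine tendsto_nhds_unique (hG0 (x + 1)) ?_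
    have : ∀ r : ℝ, 0 ≤ r → intervalAvg f (x + 1) r = intervalAvg f x r := fun r hr => by
      unfold intervalAvg
      rw [← intervalIntegral.integral_of_le (by linarith), ← intervalIntegral.integral_of_le (by linarith),
        show x + 1 + r = x + r + 1 by ring, ← intervalIntegral.integral_comp_add_right (fun t => f t)]
      simp only [hfper _]
    simp_rw [fun k : ℕ => this ((1 / 2) ^ k) (by positivity)]
    exact hG0 x
  -- The averages are difference quotients of the primitive of `f`, so Lebesgue differentiation
  -- identifies their limit almost everywhere. The interval contains `[0, 1)`, and translation by
  -- `⌊x⌋` reaches the rest of the line.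
  have hae : ∀ᵐ x : ℝ, x ∈ Set.Ioo (-1 : ℝ) 2 → G0 x = f x := by
    filter_upwards [IntervalIntegrable.ae_hasDerivAt_integral (hfI (-1) 2)] with x hx hx2
    have h1 := hx (by rw [Set.uIcc_of_le (by norm_num)]; exact Set.Ioo_subset_Icc_self hx2) (-1) (by simp)
    refine tendsto_nhds_unique (hG0 x) ?_
    have h2 := h1.tendsto_slope_zero
    have h3 : Tendsto (fun k : ℕ => (1 / 2 : ℝ) ^ k) atTop (𝓝[≠] 0) := by
      refine tendsto_nhdsWithin_iff.2 ⟨tendsto_pow_atTop_nhds_zero_of_lt_one (by norm_num) (by norm_num),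
        Eventually.of_forall fun k => ?_⟩
      simp
    refine (h2.comp h3).congr fun k => ?_
    simp only [Function.comp]
    rw [intervalIntegral.integral_interval_sub_left (hfI _ _) (hfI _ _)]
    unfold intervalAvg
    rw [intervalIntegral.integral_of_le]
    have : (0 : ℝ) < (1 / 2) ^ k := by positivity
    linarith
  have hGae : ∀ᵐ x : ℝ, G0 x = f x := by
    have : ∀ n : ℤ, ∀ᵐ x : ℝ, x + n ∈ Set.Ioo (-1 : ℝ) 2 → G0 (x + n) = f (x + n) := fun n =>
      (measurePreserving_add_right volume (n : ℝ)).quasiMeasurePreserving.ae hae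
    filter_upwards [ae_all_iff.2 this] with x hx
    have := hx (-⌊x⌋) ⟨by push_cast; linarith [Int.floor_le x], by push_cast; linarith [Int.lt_floor_add_one x]⟩
    have e1 : G0 (x + ((-⌊x⌋ : ℤ) : ℝ)) = G0 x := by simpa using (hG0per.int_mul (-⌊x⌋)) x
    have e2 : f (x + ((-⌊x⌋ : ℤ) : ℝ)) = f x := by simpa using (hfper.int_mul (-⌊x⌋)) x
    rwa [e1, e2] at this
  have hcoe : ∀ t : ℝ, hG0per.lift (t : UnitAddCircle) = G0 t := fun t => hG0per.lift_coe t
  refine ⟨hG0per.lift, ?_, ?_, fun t => ?_⟩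
  · refine (QuotientAddGroup.isQuotientMap_mk _).continuous_iff.2 ?_
    exact hG0c.congr fun t => (hcoe t).symm
  · refine ae_circle_of_ae ?_
    filter_upwards [hGae] with t ht _
    rw [hcoe, ht]
  · rw [hcoe]
    -- The primitive is based at `t - 1/8` so that all nearby `s` lie within `1/4` of the base
    -- point, as the identity for short intervals requires.
    have h1 := (hG0c.integral_hasStrictDerivAt (t - 1 / 8) t).hasDerivAt.const_add (u ((t - 1 / 8 : ℝ) : UnitAddCircle))
    refine h1.congr_of_eventuallyEq ?_
    filter_upwards [Ioo_mem_nhds (show t - 1 / 8 < t by linarith) (show t < t + 1 / 8 by linarith)] with s hs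
    have h2 := h.sub_eq_integral_of_le hu hg (a := t - 1 / 8) (b := s) hs.1.le (by linarith [hs.2])
    rw [← sub_eq_iff_eq_add', h2]
    refine intervalIntegral.integral_congr_ae ?_
    filter_upwards [hGae] with x hx _
    exact hx.symm

end Circle

instance isProbabilityMeasure_unitAddCircle : IsProbabilityMeasure (volume : Measure UnitAddCircle) :=
  ⟨UnitAddCircle.measure_univ⟩

/-! ### Sobolev curves are C¹, and the supremum bound -/

section SobolevCurve

variable {n : ℕ}

lemma slobodeckijNorm_nonneg {F : Type*} [NormedAddCommGroup F] (s q : ℝ) (f : UnitAddCircle → F) :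
    0 ≤ slobodeckijNorm s q f := ENNReal.toReal_nonneg

lemma IsSobolevCurve.regular {q : ℝ} (hq : 2 < q) {w : UnitAddCircle → EuclideanSpace ℝ (Fin n)}
    (hw : IsSobolevCurve q w) :
    Continuous (circleDeriv w) ∧
      (∀ t : ℝ, HasDerivAt (fun s : ℝ => w s) (circleDeriv w t) t) ∧
      circleEnergy q (circleDeriv w) ≠ ⊤ := by
  obtain ⟨hc, -, g, hg, hgq, hE⟩ := hw
  have hgi : Integrable g := hgq.integrable (by
    rw [← ENNReal.ofReal_one]; exact ENNReal.ofReal_le_ofReal (by linarith))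
  obtain ⟨G, hGc, hGae, hGd⟩ := hg.exists_continuous hq hc hgi (circleEnergy_ne_top (by linarith) hE)
  have hG : circleDeriv w = G := by
    ext1 x
    induction x using QuotientAddGroup.induction_on with | _ t
    exact circleDeriv_coe (hGd t)
  rw [hG]
  refine ⟨hGc, hGd, ?_⟩
  rw [circleEnergy_congr_ae hGae]
  exact circleEnergy_ne_top (by linarith) hE

lemma toReal_circleEnergy_le {F : Type*} [NormedAddCommGroup F] {q : ℝ} (hq : 0 < q) {f : UnitAddCircle → F}
    (hf : Continuous f) (hE : circleEnergy q f ≠ ⊤) :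
    (circleEnergy q f).toReal ^ (1 / q) ≤ slobodeckijNorm (1 - 1 / q) q f := by
  unfold slobodeckijNorm
  rw [slobodeckijSeminorm_eq hq, ENNReal.toReal_rpow]
  refine ENNReal.toReal_mono (ENNReal.add_ne_top.2 ⟨?_, ENNReal.rpow_ne_top_of_nonneg (by positivity) hE⟩) le_add_self
  exact (hf.memLp_of_hasCompactSupport (HasCompactSupport.of_compactSpace f)).2.ne

lemma toReal_eLpNorm_le {F : Type*} [NormedAddCommGroup F] {q : ℝ} (hq : 0 < q) {f : UnitAddCircle → F}
    (hf : Continuous f) (hE : circleEnergy q f ≠ ⊤) :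
    (eLpNorm f (ENNReal.ofReal q) volume).toReal ≤ slobodeckijNorm (1 - 1 / q) q f := by
  unfold slobodeckijNorm
  rw [slobodeckijSeminorm_eq hq]
  refine ENNReal.toReal_mono (ENNReal.add_ne_top.2 ⟨?_, ENNReal.rpow_ne_top_of_nonneg (by positivity) hE⟩) le_self_add
  exact (hf.memLp_of_hasCompactSupport (HasCompactSupport.of_compactSpace f)).2.ne

lemma integral_norm_le_slobodeckijNorm {F : Type*} [NormedAddCommGroup F] {q : ℝ} (hq : 1 < q)
    {f : UnitAddCircle → F} (hf : Continuous f) (hE : circleEnergy q f ≠ ⊤) :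
    ∫ x, ‖f x‖ ≤ slobodeckijNorm (1 - 1 / q) q f := by
  refine le_trans ?_ (toReal_eLpNorm_le (by linarith) hf hE)
  rw [integral_norm_eq_lintegral_enorm ((hf.memLp_of_hasCompactSupport (p := 1) (μ := volume) (HasCompactSupport.of_compactSpace f)).1),
    ← eLpNorm_one_eq_lintegral_enorm]
  refine ENNReal.toReal_mono (hf.memLp_of_hasCompactSupport (HasCompactSupport.of_compactSpace f)).2.ne ?_
  refine eLpNorm_le_eLpNorm_of_exponent_le ?_ ((hf.memLp_of_hasCompactSupport (p := 1) (μ := volume) (HasCompactSupport.of_compactSpace f)).1)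
  rw [← ENNReal.ofReal_one]; exact ENNReal.ofReal_le_ofReal hq.le

lemma exists_coe_Ioc (x : ℝ) (Y : UnitAddCircle) : ∃ y ∈ Set.Ioc x (x + 1), (y : UnitAddCircle) = Y :=
  ⟨AddCircle.equivIoc 1 x Y, (AddCircle.equivIoc 1 x Y).2, (AddCircle.equivIoc 1 x).symm_apply_apply Y⟩

/-- The constant of the embedding of `W^{1-1/q,q}` into the bounded functions. -/
def supConst (q : ℝ) : ℝ := 1 + 2 * morreyConst q

lemma supConst_pos {q : ℝ} (hq : 2 < q) : 0 < supConst q := by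
  have := morreyConst_pos hq
  unfold supConst; linarith

/-- By Morrey's inequality `f` oscillates by at most `2 * morreyConst q` times its seminorm. Hence
`‖f x‖` minus this oscillation lies below every value `‖f Y‖`, so below the mean of `‖f‖`, which the
`L^q` norm controls. -/
lemma norm_le_slobodeckijNorm {F : Type*} [NormedAddCommGroup F] [NormedSpace ℝ F] [CompleteSpace F]
    {q : ℝ} (hq : 2 < q) {f : UnitAddCircle → F} (hf : Continuous f) (hE : circleEnergy q f ≠ ⊤)
    (x : UnitAddCircle) : ‖f x‖ ≤ supConst q * slobodeckijNorm (1 - 1 / q) q f := by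
  have hq0 : 0 < q := by linarith
  have hm := morreyConst_pos hq
  induction x using QuotientAddGroup.induction_on with | _ x
  change ‖f (x : UnitAddCircle)‖ ≤ _
  set K := (circleEnergy q f).toReal
  have h1 : ∀ Y : UnitAddCircle, ‖f (x : UnitAddCircle)‖ - 2 * morreyConst q * K ^ (1 / q) ≤ ‖f Y‖ := by
    intro Y
    obtain ⟨y, hy, rfl⟩ := exists_coe_Ioc x Y
    have h2 := norm_sub_le_of_intervalEnergy_le hq (f := fun t : ℝ => f t) (K := K)
      (hf.comp (AddCircle.continuous_mk' 1)) hy.1 ENNReal.toReal_nonneg (by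
        rw [ENNReal.ofReal_toReal hE]
        exact (intervalEnergy_mono q _ (Set.Ioc_subset_Ioc le_rfl hy.2)).trans
          (intervalEnergy_le_circleEnergy hq0 ((hf.memLp_of_hasCompactSupport (p := 1) (μ := volume) (HasCompactSupport.of_compactSpace f)).1) x))
    have h3 : (y - x) ^ (1 - 2 / q) ≤ 1 := by
      apply Real.rpow_le_one (by linarith [hy.1]) (by linarith [hy.2])
      rw [sub_nonneg, div_le_one hq0]; exact hq.le
    have h4 : 2 * morreyConst q * (y - x) ^ (1 - 2 / q) * K ^ (1 / q) ≤ 2 * morreyConst q * 1 * K ^ (1 / q) := by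
      gcongr
    have h5 := norm_sub_norm_le (f (x : UnitAddCircle)) (f y)
    linarith
  have h2 : ‖f (x : UnitAddCircle)‖ - 2 * morreyConst q * K ^ (1 / q) ≤ ∫ y, ‖f y‖ := by
    have := integral_mono (μ := (volume : Measure UnitAddCircle)) (integrable_const _)
      (hf.norm.integrable_of_hasCompactSupport (HasCompactSupport.of_compactSpace _)) h1
    rwa [integral_const, probReal_univ, one_smul] at this
  have h3 := integral_norm_le_slobodeckijNorm (by linarith) hf hE
  have h4 := toReal_circleEnergy_le hq0 hf hE
  have h5 : 2 * morreyConst q * K ^ (1 / q) ≤ 2 * morreyConst q * slobodeckijNorm (1 - 1 / q) q f := by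
    gcongr
  unfold supConst
  linarith

end SobolevCurve

/-! ### Energy control of the unit tangent on short arcs -/

section BiLipschitz

variable {n : ℕ}

lemma wedgeNorm_nonneg (a b : EuclideanSpace ℝ (Fin n)) : 0 ≤ wedgeNorm a b := Real.sqrt_nonneg _

lemma wedgeNorm_sq (a b : EuclideanSpace ℝ (Fin n)) :
    wedgeNorm a b ^ 2 = ‖a‖ ^ 2 * ‖b‖ ^ 2 - inner ℝ a b ^ 2 := by
  unfold wedgeNorm
  rw [Real.sq_sqrt]
  have := abs_real_inner_le_norm a b
  rw [sub_nonneg, ← mul_pow, ← sq_abs (inner ℝ a b)]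
  gcongr

lemma wedgeNorm_neg_right (a b : EuclideanSpace ℝ (Fin n)) : wedgeNorm a (-b) = wedgeNorm a b := by
  simp [wedgeNorm]

lemma Continuous.wedgeNorm {X : Type*} [TopologicalSpace X] {f g : X → EuclideanSpace ℝ (Fin n)}
    (hf : Continuous f) (hg : Continuous g) : Continuous fun x => wedgeNorm (f x) (g x) :=
  (((hf.norm.pow 2).mul (hg.norm.pow 2)).sub ((hf.inner hg).pow 2)).sqrt

/-- Two unit vectors at an acute angle. -/
lemma norm_unit_sub_unit_le {a b : EuclideanSpace ℝ (Fin n)} (ha : a ≠ 0) (hb : b ≠ 0)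
    (hab : 0 ≤ inner ℝ a b) :
    ‖‖a‖⁻¹ • a - ‖b‖⁻¹ • b‖ ≤ 2 * (wedgeNorm a b / (‖a‖ * ‖b‖)) := by
  have ha' : 0 < ‖a‖ := norm_pos_iff.2 ha
  have hb' : 0 < ‖b‖ := norm_pos_iff.2 hb
  set c := inner ℝ a b / (‖a‖ * ‖b‖) with hc
  have hc0 : 0 ≤ c := by positivity
  have hc1 : c ≤ 1 := by
    rw [hc, div_le_one (by positivity)]; exact real_inner_le_norm a b
  have h1 : ‖‖a‖⁻¹ • a - ‖b‖⁻¹ • b‖ ^ 2 = 2 - 2 * c := by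
    rw [norm_sub_sq_real, norm_smul, norm_smul, real_inner_smul_left, real_inner_smul_right, norm_inv, norm_inv,
      norm_norm, norm_norm, hc]
    field_simp; ring
  have h2 : (wedgeNorm a b / (‖a‖ * ‖b‖)) ^ 2 = 1 - c ^ 2 := by
    rw [div_pow, wedgeNorm_sq, hc]; field_simp
  -- With `c` the cosine of the angle, the claim squared is `2 - 2c ≤ 4(1 - c²)`, which holds for `0
  -- ≤ c ≤ 1`.
  refine le_of_sq_le_sq ?_ (by have := wedgeNorm_nonneg a b; positivity)
  rw [mul_pow, h1, h2]
  nlinarith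

/-- The integrand of `TP`. -/
def tpDensity (q : ℝ) (u : UnitAddCircle → EuclideanSpace ℝ (Fin n)) (p : UnitAddCircle × UnitAddCircle) : ℝ :=
  wedgeNorm (circleDeriv u p.2) (u p.1 - u p.2) ^ q / ‖u p.1 - u p.2‖ ^ (2 * q)

lemma tpDensity_eq (q : ℝ) (u : UnitAddCircle → EuclideanSpace ℝ (Fin n)) (p : UnitAddCircle × UnitAddCircle) :
    tpDensity q u p = (wedgeNorm (circleDeriv u p.2) (u p.1 - u p.2) / ‖u p.1 - u p.2‖ ^ 2) ^ q := by
  unfold tpDensity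
  rw [Real.div_rpow (wedgeNorm_nonneg _ _) (by positivity), Real.rpow_mul (norm_nonneg _), Real.rpow_two]

lemma measurable_tpDensity (q : ℝ) {u : UnitAddCircle → EuclideanSpace ℝ (Fin n)} (hu : Continuous u)
    (hu' : Continuous (circleDeriv u)) : Measurable (tpDensity q u) := by
  unfold tpDensity
  have h1 : Continuous fun p : UnitAddCircle × UnitAddCircle => wedgeNorm (circleDeriv u p.2) (u p.1 - u p.2) :=
    (hu'.comp continuous_snd).wedgeNorm ((hu.comp continuous_fst).sub (hu.comp continuous_snd))
  have h2 : Continuous fun p : UnitAddCircle × UnitAddCircle => ‖u p.1 - u p.2‖ := by fun_prop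
  exact (h1.measurable.pow_const q).div (h2.measurable.pow_const _)

lemma lintegral_tpDensity_le {q M : ℝ} (hq : 0 < q) {u : UnitAddCircle → EuclideanSpace ℝ (Fin n)}
    (h : tangentPoint q u ≤ ENNReal.ofReal M) :
    ∫⁻ p, ENNReal.ofReal (tpDensity q u p) ≤ ENNReal.ofReal (q * M) := by
  unfold tangentPoint at h
  have := mul_le_mul_right h (ENNReal.ofReal q)
  rw [← mul_assoc, ← ENNReal.ofReal_mul hq.le, mul_one_div_cancel hq.ne', ENNReal.ofReal_one, one_mul,
    ← ENNReal.ofReal_mul hq.le] at this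
  exact this

lemma one_le_two_mul_inner_of_norm_sub_le {x y : EuclideanSpace ℝ (Fin n)} (hx : ‖x‖ = 1) (hy : ‖y‖ = 1)
    (h : ‖x - y‖ ≤ 1 / 4) : 1 / 2 ≤ inner ℝ x y := by
  have := norm_sub_sq_real x y
  rw [hx, hy] at this
  nlinarith [norm_nonneg (x - y)]

/-- The unit tangent, as a function of a real parameter. -/
def unitTangent (u : UnitAddCircle → EuclideanSpace ℝ (Fin n)) (t : ℝ) : EuclideanSpace ℝ (Fin n) :=
  ‖circleDeriv u t‖⁻¹ • circleDeriv u t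

variable {u : UnitAddCircle → EuclideanSpace ℝ (Fin n)} {lam Lam : ℝ}

lemma norm_unitTangent (hlam : 0 < lam) (hl : ∀ x, lam ≤ ‖circleDeriv u x‖) (t : ℝ) : ‖unitTangent u t‖ = 1 := by
  have := hlam.trans_le (hl t)
  unfold unitTangent
  rw [norm_smul, norm_inv, norm_norm, inv_mul_cancel₀ this.ne']

lemma circleDeriv_eq_smul_unitTangent (hlam : 0 < lam) (hl : ∀ x, lam ≤ ‖circleDeriv u x‖) (t : ℝ) :
    circleDeriv u t = ‖circleDeriv u (t : UnitAddCircle)‖ • unitTangent u t := by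
  have := hlam.trans_le (hl t)
  unfold unitTangent
  rw [smul_smul, mul_inv_cancel₀ this.ne', one_smul]

lemma continuous_unitTangent (hlam : 0 < lam) (hl : ∀ x, lam ≤ ‖circleDeriv u x‖)
    (hu' : Continuous (circleDeriv u)) : Continuous (unitTangent u) := by
  have hc : Continuous fun t : ℝ => circleDeriv u t := hu'.comp (AddCircle.continuous_mk' 1)
  exact (hc.norm.inv₀ fun t => (hlam.trans_le (hl t)).ne').smul hc

/-- Along the arc all tangents have inner product at least `1/2` with the fixed tangent at `r`, so
the component of `u` in that direction grows at speed at least `lam / 2`. -/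
lemma mul_sub_le_inner_of_unitTangent_close (hlam : 0 < lam) (hl : ∀ x, lam ≤ ‖circleDeriv u x‖)
    (hd : ∀ t : ℝ, HasDerivAt (fun s : ℝ => u s) (circleDeriv u t) t) {s t r : ℝ} (hst : s ≤ t)
    (hr : r ∈ Set.Icc s t)
    (hT : ∀ a ∈ Set.Icc s t, ∀ b ∈ Set.Icc s t, ‖unitTangent u a - unitTangent u b‖ ≤ 1 / 4) :
    lam / 2 * (t - s) ≤ inner ℝ (unitTangent u r) (u t - u s) := by
  have hd2 : ∀ τ : ℝ, HasDerivAt (fun s : ℝ => inner ℝ (unitTangent u r) (u s))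
      (inner ℝ (unitTangent u r) (circleDeriv u τ)) τ := fun τ => by
    simpa using (hasDerivAt_const τ (unitTangent u r)).inner ℝ (hd τ)
  have := (convex_Icc s t).mul_sub_le_image_sub_of_le_deriv (f := fun s : ℝ => inner ℝ (unitTangent u r) (u s))
    (C := lam / 2) (fun τ _ => (hd2 τ).continuousAt.continuousWithinAt)
    (fun τ _ => (hd2 τ).differentiableAt.differentiableWithinAt) ?_ s ⟨le_rfl, hst⟩ t ⟨hst, le_rfl⟩ hst
  · rwa [inner_sub_right]
  · intro τ hτ
    rw [interior_Icc] at hτ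
    rw [(hd2 τ).deriv, circleDeriv_eq_smul_unitTangent hlam hl, inner_smul_right]
    have h1 := one_le_two_mul_inner_of_norm_sub_le (norm_unitTangent hlam hl r) (norm_unitTangent hlam hl τ)
      (hT r hr τ (Set.Ioo_subset_Icc_self hτ))
    have h2 := hl τ
    nlinarith

lemma norm_sub_le_of_circleDeriv_le (hL : ∀ x, ‖circleDeriv u x‖ ≤ Lam)
    (hd : ∀ t : ℝ, HasDerivAt (fun s : ℝ => u s) (circleDeriv u t) t) (s t : ℝ) :
    ‖u t - u s‖ ≤ Lam * |t - s| := by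
  have := Convex.norm_image_sub_le_of_norm_hasDerivWithin_le (f := fun s : ℝ => u s) (C := Lam) (s := Set.univ)
    (fun x _ => (hd x).hasDerivWithinAt) (fun x _ => hL x) convex_univ (Set.mem_univ s) (Set.mem_univ t)
  simpa using this

/-- On an arc with small tangent oscillation the tangent-point density controls the difference quotients
of the unit tangent. -/
lemma unitTangent_quotient_le {q : ℝ} (hq : 0 < q) (hlam : 0 < lam)
    (hl : ∀ x, lam ≤ ‖circleDeriv u x‖) (hL : ∀ x, ‖circleDeriv u x‖ ≤ Lam)
    (hd : ∀ t : ℝ, HasDerivAt (fun s : ℝ => u s) (circleDeriv u t) t) {s t : ℝ} (hst : s < t)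
    (hT : ∀ a ∈ Set.Icc s t, ∀ b ∈ Set.Icc s t, ‖unitTangent u a - unitTangent u b‖ ≤ 1 / 4) :
    ‖unitTangent u s - unitTangent u t‖ ^ q / |s - t| ^ q ≤
      (4 * Lam / lam) ^ q * (tpDensity q u ((s : UnitAddCircle), (t : UnitAddCircle)) +
        tpDensity q u ((t : UnitAddCircle), (s : UnitAddCircle))) := by
  have hLam : 0 < Lam := hlam.trans_le ((hl (s : UnitAddCircle)).trans (hL _))
  have hts : 0 < t - s := sub_pos.2 hst
  set b := u t - u s with hb
  have hb0 : b ≠ 0 := by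
    intro h0
    have := mul_sub_le_inner_of_unitTangent_close hlam hl hd hst.le ⟨le_rfl, hst.le⟩ hT
    rw [← hb, h0, inner_zero_right] at this
    nlinarith
  have hb' : 0 < ‖b‖ := norm_pos_iff.2 hb0
  have hbL : ‖b‖ ≤ Lam * (t - s) := by
    have := norm_sub_le_of_circleDeriv_le hL hd s t
    rwa [abs_of_pos hts] at this
  -- The tangents at the two ends are compared through the direction of the chord. Each deviates
  -- from it by an angle that the wedge measures, and `‖b‖ ≤ Lam (t - s)` yields the factor `t - s`.
  have key : ∀ r ∈ Set.Icc s t, ‖unitTangent u r - ‖b‖⁻¹ • b‖ ≤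
      2 * Lam / lam * (t - s) * (wedgeNorm (circleDeriv u r) b / ‖b‖ ^ 2) := by
    intro r hr
    have hV := hl r
    have hV0 : 0 < ‖circleDeriv u (r : UnitAddCircle)‖ := hlam.trans_le hV
    have h1 := mul_sub_le_inner_of_unitTangent_close hlam hl hd hst.le hr hT
    have h2 : 0 ≤ inner ℝ (circleDeriv u (r : UnitAddCircle)) b := by
      rw [circleDeriv_eq_smul_unitTangent hlam hl, real_inner_smul_left]
      have : 0 ≤ lam / 2 * (t - s) := by positivity
      exact mul_nonneg hV0.le (this.trans h1)
    refine (norm_unit_sub_unit_le (norm_pos_iff.1 hV0) hb0 h2).trans ?_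
    have hw := wedgeNorm_nonneg (circleDeriv u (r : UnitAddCircle)) b
    set w := wedgeNorm (circleDeriv u (r : UnitAddCircle)) b
    calc 2 * (w / (‖circleDeriv u (r : UnitAddCircle)‖ * ‖b‖)) ≤ 2 * (w / (lam * ‖b‖)) := by gcongr
      _ = 2 / lam * ‖b‖ * (w / ‖b‖ ^ 2) := by field_simp
      _ ≤ 2 / lam * (Lam * (t - s)) * (w / ‖b‖ ^ 2) := by gcongr
      _ = _ := by ring
  have k1 := key s ⟨le_rfl, hst.le⟩
  have k2 := key t ⟨hst.le, le_rfl⟩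
  set Ds := wedgeNorm (circleDeriv u s) b / ‖b‖ ^ 2 with hDs
  set Dt := wedgeNorm (circleDeriv u t) b / ‖b‖ ^ 2 with hDt
  have hDs0 : 0 ≤ Ds := by have := wedgeNorm_nonneg (circleDeriv u s) b; positivity
  have hDt0 : 0 ≤ Dt := by have := wedgeNorm_nonneg (circleDeriv u t) b; positivity
  have e1 : tpDensity q u ((t : UnitAddCircle), (s : UnitAddCircle)) = Ds ^ q := tpDensity_eq q u _
  have e2 : tpDensity q u ((s : UnitAddCircle), (t : UnitAddCircle)) = Dt ^ q := by
    rw [tpDensity_eq]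
    simp only
    rw [← neg_sub (u t) (u s), wedgeNorm_neg_right, norm_neg]
  rw [e1, e2, abs_sub_comm, abs_of_pos hts, ← Real.div_rpow (norm_nonneg _) hts.le]
  have h3 : ‖unitTangent u s - unitTangent u t‖ / (t - s) ≤ (4 * Lam / lam) * max Dt Ds := by
    rw [div_le_iff₀ hts]
    have := norm_sub_le_norm_sub_add_norm_sub (unitTangent u s) (‖b‖⁻¹ • b) (unitTangent u t)
    rw [norm_sub_rev (‖b‖⁻¹ • b)] at this
    have m1 := le_max_left Dt Ds
    have m2 := le_max_right Dt Ds
    have m3 : 2 * Lam / lam * (t - s) * Ds ≤ 2 * Lam / lam * (t - s) * max Dt Ds := by gcongr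
    have m4 : 2 * Lam / lam * (t - s) * Dt ≤ 2 * Lam / lam * (t - s) * max Dt Ds := by gcongr
    calc _ ≤ _ := this
      _ ≤ 2 * (2 * Lam / lam * (t - s) * max Dt Ds) := by linarith
      _ = _ := by ring
  calc _ ≤ ((4 * Lam / lam) * max Dt Ds) ^ q := Real.rpow_le_rpow (by positivity) h3 hq.le
    _ = (4 * Lam / lam) ^ q * (max Dt Ds) ^ q := Real.mul_rpow (by positivity) (by positivity)
    _ ≤ _ := by
      gcongr
      rcases max_cases Dt Ds with h | h <;> rw [h.1]
      · linarith [Real.rpow_nonneg hDs0 q]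
      · linarith [Real.rpow_nonneg hDt0 q]

/-- The integrand of TP uses the tangent at one end only, so the pointwise bound needs both
orderings of the parameters. Each ordering contributes at most `q M`, whence the factor 2. -/
lemma intervalEnergy_unitTangent_le {q M : ℝ} (hq : 0 < q) (hlam : 0 < lam)
    (hl : ∀ x, lam ≤ ‖circleDeriv u x‖) (hL : ∀ x, ‖circleDeriv u x‖ ≤ Lam) (hu : Continuous u)
    (hu' : Continuous (circleDeriv u))
    (hd : ∀ t : ℝ, HasDerivAt (fun s : ℝ => u s) (circleDeriv u t) t)
    (hM : tangentPoint q u ≤ ENNReal.ofReal M) {s t : ℝ} (hst : t ≤ s + 1)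
    (hT : ∀ a ∈ Set.Icc s t, ∀ b ∈ Set.Icc s t, ‖unitTangent u a - unitTangent u b‖ ≤ 1 / 4) :
    intervalEnergy q (unitTangent u) (Set.Ioc s t) ≤ ENNReal.ofReal ((4 * Lam / lam) ^ q * (2 * (q * M))) := by
  have hLam : 0 < Lam := hlam.trans_le ((hl (s : UnitAddCircle)).trans (hL _))
  have hDm := (measurable_tpDensity q hu hu').ennreal_ofReal
  have h0 : ∀ p, 0 ≤ tpDensity q u p := fun p => by
    rw [tpDensity_eq]; have := wedgeNorm_nonneg (circleDeriv u p.2) (u p.1 - u p.2); positivity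
  set D : ℝ × ℝ → ℝ≥0∞ := fun p => ENNReal.ofReal (tpDensity q u ((p.1 : UnitAddCircle), (p.2 : UnitAddCircle))) with hD
  set D' : ℝ × ℝ → ℝ≥0∞ := fun p => ENNReal.ofReal (tpDensity q u ((p.2 : UnitAddCircle), (p.1 : UnitAddCircle))) with hD'
  have hmk : Measurable fun t : ℝ => (t : UnitAddCircle) := (AddCircle.continuous_mk' 1).measurable
  have hDm1 : Measurable D := hDm.comp ((hmk.comp measurable_fst).prodMk (hmk.comp measurable_snd))
  have b1 : ∫⁻ p in Set.Ioc s t ×ˢ Set.Ioc s t, D p ≤ ENNReal.ofReal (q * M) := by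
    refine le_trans ?_ (lintegral_tpDensity_le hq hM)
    rw [lintegral_circle_prod s s hDm.aemeasurable]
    exact lintegral_mono_set (Set.prod_mono (Set.Ioc_subset_Ioc le_rfl hst) (Set.Ioc_subset_Ioc le_rfl hst))
  have b2 : ∫⁻ p in Set.Ioc s t ×ˢ Set.Ioc s t, D' p ≤ ENNReal.ofReal (q * M) := by
    refine le_trans ?_ (lintegral_tpDensity_le hq hM)
    rw [Measure.volume_eq_prod UnitAddCircle, ← lintegral_prod_swap, ← Measure.volume_eq_prod,
      lintegral_circle_prod s s (f := fun p => ENNReal.ofReal (tpDensity q u p.swap))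
        (hDm.comp measurable_swap).aemeasurable]
    exact lintegral_mono_set (Set.prod_mono (Set.Ioc_subset_Ioc le_rfl hst) (Set.Ioc_subset_Ioc le_rfl hst))
  unfold intervalEnergy
  calc _ ≤ ∫⁻ p in Set.Ioc s t ×ˢ Set.Ioc s t, ENNReal.ofReal ((4 * Lam / lam) ^ q) * (D p + D' p) := by
        refine setLIntegral_mono' (measurableSet_Ioc.prod measurableSet_Ioc) fun p hp => ?_
        simp only [hD, hD']
        rw [← ENNReal.ofReal_add (h0 _) (h0 _), ← ENNReal.ofReal_mul (by positivity)]
        apply ENNReal.ofReal_le_ofReal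
        have hsub : ∀ a ∈ Set.Ioc s t, ∀ b ∈ Set.Ioc s t, Set.Icc a b ⊆ Set.Icc s t := fun a ha b hb =>
          Set.Icc_subset_Icc ha.1.le hb.2
        rcases lt_trichotomy p.1 p.2 with h | h | h
        · exact unitTangent_quotient_le hq hlam hl hL hd h fun a ha b hb =>
            hT a (hsub _ hp.1 _ hp.2 ha) b (hsub _ hp.1 _ hp.2 hb)
        · rw [h, sub_self, norm_zero, Real.zero_rpow hq.ne', zero_div]
          have := h0 ((p.2 : UnitAddCircle), (p.2 : UnitAddCircle))
          positivity
        · have := unitTangent_quotient_le hq hlam hl hL hd h fun a ha b hb =>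
            hT a (hsub _ hp.2 _ hp.1 ha) b (hsub _ hp.2 _ hp.1 hb)
          rw [norm_sub_rev, abs_sub_comm, add_comm]
          exact this
    _ = ENNReal.ofReal ((4 * Lam / lam) ^ q) * ((∫⁻ p in Set.Ioc s t ×ˢ Set.Ioc s t, D p) +
          ∫⁻ p in Set.Ioc s t ×ˢ Set.Ioc s t, D' p) := by
        rw [lintegral_const_mul' _ _ ENNReal.ofReal_ne_top, lintegral_add_left hDm1]
    _ ≤ ENNReal.ofReal ((4 * Lam / lam) ^ q) * (ENNReal.ofReal (q * M) + ENNReal.ofReal (q * M)) := by gcongr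
    _ = _ := by
      rw [← two_mul, ENNReal.ofReal_mul (p := (4 * Lam / lam) ^ q) (by positivity), ENNReal.ofReal_mul (p := 2) (by norm_num)]
      simp

/-- A scale on which the tangents of curves of energy at most `M` oscillate little. -/
lemma exists_unitTangent_scale (q lam Lam M : ℝ) (hq : 2 < q) (hlam : 0 < lam) (hLam : lam ≤ Lam) (hM : 0 < M) :
    ∃ κ : ℝ, 0 < κ ∧ κ ≤ 1 / 2 ∧ ∀ (n : ℕ) (u : UnitAddCircle → EuclideanSpace ℝ (Fin n)),
      (∀ x, lam ≤ ‖circleDeriv u x‖) → (∀ x, ‖circleDeriv u x‖ ≤ Lam) → Continuous u →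
      Continuous (circleDeriv u) → (∀ t : ℝ, HasDerivAt (fun s : ℝ => u s) (circleDeriv u t) t) →
      tangentPoint q u ≤ ENNReal.ofReal M →
      ∀ s t : ℝ, s ≤ t → t ≤ s + κ → ‖unitTangent u s - unitTangent u t‖ ≤ 1 / 4 := by
  have hq0 : 0 < q := by linarith
  set K := (4 * Lam / lam) ^ q * (2 * (q * M))
  have hLam0 : 0 < Lam := hlam.trans_le hLam
  have hK : 0 ≤ K := by positivity
  have hα : 0 < 1 - 2 / q := by
    rw [sub_pos, div_lt_one hq0]; exact hq
  have hlim : Tendsto (fun κ : ℝ => 2 * morreyConst q * κ ^ (1 - 2 / q) * K ^ (1 / q)) (𝓝[>] 0) (𝓝 0) := by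
    have h1 : Tendsto (fun κ : ℝ => κ ^ (1 - 2 / q)) (𝓝 0) (𝓝 0) := by
      simpa [Real.zero_rpow hα.ne'] using (Real.continuousAt_rpow_const 0 (1 - 2 / q) (Or.inr hα.le)).tendsto
    have h2 := ((h1.const_mul (2 * morreyConst q)).mul_const (K ^ (1 / q))).mono_left (nhdsWithin_le_nhds (s := Set.Ioi 0))
    simpa using h2
  obtain ⟨κ, hκ1, hκ2, hκ3⟩ := ((hlim.eventually (gt_mem_nhds (show (0 : ℝ) < 1 / 4 by norm_num))).and
    ((eventually_mem_nhdsWithin (a := (0:ℝ)) (s := Set.Ioi 0)).and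
      (mem_nhdsWithin_of_mem_nhds (Iic_mem_nhds (show (0 : ℝ) < 1 / 2 by norm_num))))).exists
  refine ⟨κ, hκ2, hκ3, fun n u hl hL hu hu' hd hTP s₀ t₀ hst hκ => ?_⟩
  by_contra! hbad
  have hTc := continuous_unitTangent hlam hl hu'
  -- Continuity argument: a shortest subarc whose end tangents differ by at least `1/4` has
  -- oscillation at most `1/4` throughout, so the energy bound applies to it. Morrey's inequality on
  -- length at most `κ` then contradicts the choice of `κ`.
  let S : Set (ℝ × ℝ) := {p | p ∈ Set.Icc s₀ t₀ ×ˢ Set.Icc s₀ t₀ ∧ p.1 ≤ p.2 ∧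
    1 / 4 ≤ ‖unitTangent u p.1 - unitTangent u p.2‖}
  have hScl : IsCompact S := by
    refine (isCompact_Icc.prod isCompact_Icc).of_isClosed_subset ?_ (fun p hp => hp.1)
    refine (isClosed_Icc.prod isClosed_Icc).inter ((isClosed_le continuous_fst continuous_snd).inter ?_)
    exact isClosed_le continuous_const (((hTc.comp continuous_fst).sub (hTc.comp continuous_snd)).norm)
  have hSne : S.Nonempty := ⟨(s₀, t₀), ⟨⟨⟨le_rfl, hst⟩, ⟨hst, le_rfl⟩⟩, hst, hbad.le⟩⟩
  obtain ⟨⟨s, t⟩, ⟨⟨hs, ht⟩, hle, h14⟩, hmin⟩ := hScl.exists_isMinOn hSne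
    (f := fun p : ℝ × ℝ => p.2 - p.1) (by fun_prop)
  simp only at hs ht hle h14
  have hlt : s < t := by
    refine lt_of_le_of_ne hle ?_
    rintro rfl
    simp at h14
    linarith
  have hT' : ∀ a ∈ Set.Ioo s t, ∀ b ∈ Set.Ioo s t, a ≤ b → ‖unitTangent u a - unitTangent u b‖ ≤ 1 / 4 := by
    intro a ha b hb hab
    by_contra! hc
    have hmem : (a, b) ∈ S := ⟨⟨⟨hs.1.trans ha.1.le, ha.2.le.trans ht.2⟩, ⟨hs.1.trans hb.1.le, hb.2.le.trans ht.2⟩⟩,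
      hab, hc.le⟩
    have h1 := isMinOn_iff.1 hmin (a, b) hmem
    simp only at h1
    linarith [ha.1, hb.2]
  have hTcl : Set.Icc s t ×ˢ Set.Icc s t ⊆
      {p : ℝ × ℝ | ‖unitTangent u p.1 - unitTangent u p.2‖ ≤ 1 / 4} := by
    rw [← closure_Ioo hlt.ne, ← closure_prod_eq]
    refine closure_minimal (fun p hp => ?_)
      (isClosed_le (((hTc.comp continuous_fst).sub (hTc.comp continuous_snd)).norm) continuous_const)
    rcases le_total p.1 p.2 with h | h
    · exact hT' _ hp.1 _ hp.2 h
    · rw [Set.mem_ofPred_eq, norm_sub_rev]; exact hT' _ hp.2 _ hp.1 h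
  have hT : ∀ a ∈ Set.Icc s t, ∀ b ∈ Set.Icc s t, ‖unitTangent u a - unitTangent u b‖ ≤ 1 / 4 :=
    fun a ha b hb => @hTcl (a, b) ⟨ha, hb⟩
  have hE := intervalEnergy_unitTangent_le hq0 hlam hl hL hu hu' hd hTP
    (by linarith [hs.1, ht.2] : t ≤ s + 1) hT
  have h2 := norm_sub_le_of_intervalEnergy_le hq hTc hlt hK hE
  have h3 : (t - s) ^ (1 - 2 / q) ≤ κ ^ (1 - 2 / q) :=
    Real.rpow_le_rpow (by linarith) (by linarith [hs.1, ht.2]) hα.le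
  have h4 : 2 * morreyConst q * (t - s) ^ (1 - 2 / q) * K ^ (1 / q) ≤
      2 * morreyConst q * κ ^ (1 - 2 / q) * K ^ (1 / q) := by
    have := morreyConst_pos hq
    gcongr
  linarith

end BiLipschitz

/-! ### The uniform bi-Lipschitz bound -/

section Global

variable {n : ℕ} {u : UnitAddCircle → EuclideanSpace ℝ (Fin n)} {lam Lam : ℝ}

lemma exists_coe_sub_eq (X Y : UnitAddCircle) :
    ∃ x y : ℝ, (x : UnitAddCircle) = X ∧ (y : UnitAddCircle) = Y ∧ ‖X - Y‖ = |x - y| := by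
  obtain ⟨y, -, rfl⟩ := exists_coe_Ioc 0 Y
  obtain ⟨h, hh, hX⟩ := exists_coe_Ioc (-(1 / 2)) (X - y)
  refine ⟨y + h, y, ?_, rfl, ?_⟩
  · rw [AddCircle.coe_add, hX]; abel
  · rw [← hX, add_sub_cancel_left, (AddCircle.norm_coe_eq_abs_iff (p := 1) one_ne_zero).2]
    rw [abs_one, abs_le]
    constructor <;> linarith [hh.1, hh.2]

/-- If a chord is orthogonal to the tangent at one end, the energy near it is bounded below. -/
lemma tpDensity_ge_of_orthogonal {q : ℝ} (hq : 0 < q) (hlam : 0 < lam)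
    (hl : ∀ x, lam ≤ ‖circleDeriv u x‖) (hL : ∀ x, ‖circleDeriv u x‖ ≤ Lam)
    (hd : ∀ t : ℝ, HasDerivAt (fun s : ℝ => u s) (circleDeriv u t) t) {a b s t d : ℝ} (hd0 : 0 < d)
    (hab : ‖u a - u b‖ = d) (horth : inner ℝ (u a - u b) (circleDeriv u b) = 0)
    (ht : |t - a| ≤ d / (8 * Lam)) (hs : |s - b| ≤ d / (8 * Lam))
    (hT : ‖unitTangent u s - unitTangent u b‖ ≤ 1 / 4) :
    (lam / (4 * d)) ^ q ≤ tpDensity q u ((t : UnitAddCircle), (s : UnitAddCircle)) := by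
  have hLam : 0 < Lam := hlam.trans_le ((hl (s : UnitAddCircle)).trans (hL _))
  rw [tpDensity_eq]
  refine Real.rpow_le_rpow (by positivity) ?_ hq.le
  simp only
  set v := u t - u s with hv
  set b0 := u a - u b with hb0
  have h1 : ‖u t - u a‖ ≤ d / 8 := (norm_sub_le_of_circleDeriv_le hL hd a t).trans (by
    rw [le_div_iff₀ (by positivity)] at ht; nlinarith)
  have h2 : ‖u s - u b‖ ≤ d / 8 := (norm_sub_le_of_circleDeriv_le hL hd b s).trans (by
    rw [le_div_iff₀ (by positivity)] at hs; nlinarith)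
  have h3 : ‖v - b0‖ ≤ d / 4 := by
    have : v - b0 = (u t - u a) - (u s - u b) := by rw [hv, hb0]; abel
    rw [this]
    linarith [norm_sub_le (u t - u a) (u s - u b)]
  have h4 : 3 * d / 4 ≤ ‖v‖ := by linarith [norm_sub_norm_le b0 v, norm_sub_rev b0 v]
  have h5 : ‖v‖ ≤ 5 * d / 4 := by linarith [norm_sub_norm_le v b0]
  have horth' : inner ℝ (unitTangent u b) b0 = 0 := by
    unfold unitTangent
    rw [real_inner_smul_left, real_inner_comm, horth, mul_zero]
  have hTs := norm_unitTangent hlam hl s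
  -- Turning the tangent costs `d/4` and moving the chord costs another `d/4`. As `‖v‖ ≥ 3d/4`, the
  -- part of `v` normal to the tangent has square at least `9d²/16 - d²/4 ≥ d²/4`.
  have h6 : |inner ℝ (unitTangent u s) v| ≤ d / 2 := by
    have e : inner ℝ (unitTangent u s) v = inner ℝ (unitTangent u s - unitTangent u b) b0 +
        inner ℝ (unitTangent u s) (v - b0) := by
      rw [inner_sub_left (unitTangent u s) (unitTangent u b) b0, inner_sub_right (unitTangent u s) v b0, horth']; ring
    have b1 := abs_real_inner_le_norm (unitTangent u s - unitTangent u b) b0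
    have b2 := abs_real_inner_le_norm (unitTangent u s) (v - b0)
    rw [hTs, one_mul] at b2
    rw [hab] at b1
    have b3 : ‖unitTangent u s - unitTangent u b‖ * d ≤ 1 / 4 * d := by gcongr
    rw [e]
    linarith [abs_add_le (inner ℝ (unitTangent u s - unitTangent u b) b0) (inner ℝ (unitTangent u s) (v - b0))]
  have h7 : lam * d / 2 ≤ wedgeNorm (circleDeriv u s) v := by
    refine le_of_sq_le_sq ?_ (wedgeNorm_nonneg _ _)
    rw [wedgeNorm_sq, circleDeriv_eq_smul_unitTangent hlam hl, real_inner_smul_left, norm_smul, hTs, norm_norm, mul_one]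
    have hV := hl s
    set c := ‖circleDeriv u (s : UnitAddCircle)‖
    have h8 : d ^ 2 / 4 ≤ ‖v‖ ^ 2 - inner ℝ (unitTangent u s) v ^ 2 := by
      have e1 : inner ℝ (unitTangent u s) v ^ 2 ≤ (d / 2) ^ 2 := by
        rw [← sq_abs]; gcongr
      have e2 : (3 * d / 4) ^ 2 ≤ ‖v‖ ^ 2 := by gcongr
      nlinarith
    have h9 : lam ^ 2 ≤ c ^ 2 := by gcongr
    calc (lam * d / 2) ^ 2 = lam ^ 2 * (d ^ 2 / 4) := by ring
      _ ≤ c ^ 2 * (‖v‖ ^ 2 - inner ℝ (unitTangent u s) v ^ 2) := by gcongr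
      _ = _ := by ring
  have hvpos : 0 < ‖v‖ := by linarith
  rw [div_le_div_iff₀ (by positivity) (by positivity)]
  calc lam * ‖v‖ ^ 2 ≤ lam * (5 * d / 4) ^ 2 := by gcongr
    _ ≤ lam * d / 2 * (4 * d) := by nlinarith [mul_pos hlam (mul_pos hd0 hd0)]
    _ ≤ _ := by gcongr

/-- The energy bound forces chords between distant parameters to be long. -/
lemma chord_lower_bound {q M : ℝ} (hq : 2 < q) (hM : 0 < M) (hlam : 0 < lam)
    (hl : ∀ x, lam ≤ ‖circleDeriv u x‖) (hL : ∀ x, ‖circleDeriv u x‖ ≤ Lam) (hu : Continuous u)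
    (hu' : Continuous (circleDeriv u))
    (hd : ∀ t : ℝ, HasDerivAt (fun s : ℝ => u s) (circleDeriv u t) t)
    (hTP : tangentPoint q u ≤ ENNReal.ofReal M) {κ d : ℝ} (hκ : κ ≤ 1 / 2)
    (hT : ∀ s t : ℝ, s ≤ t → t ≤ s + κ → ‖unitTangent u s - unitTangent u t‖ ≤ 1 / 4) (hd0 : 0 < d)
    (hdκ : d / (8 * Lam) ≤ κ) {a b : ℝ}
    (hab : ‖u a - u b‖ = d) (horth : inner ℝ (u a - u b) (circleDeriv u b) = 0) :
    ((lam / 4) ^ q / (64 * Lam ^ 2 * (q * M))) ^ (1 / (q - 2)) ≤ d := by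
  have hLam : 0 < Lam := hlam.trans_le ((hl (b : UnitAddCircle)).trans (hL _))
  have hq0 : 0 < q := by linarith
  set r := d / (8 * Lam) with hr
  have hr0 : 0 < r := by positivity
  have hDm := (measurable_tpDensity q hu hu').ennreal_ofReal
  -- The density is at least `(lam / (4d))^q` on a square of side `r = d / (8 Lam)`. The energy is
  -- therefore at least a multiple of `d^(2-q)`, which bounds `d` from below because `q > 2`.
  have h1 : ENNReal.ofReal (r ^ 2 * (lam / (4 * d)) ^ q) ≤ ENNReal.ofReal (q * M) := by
    refine le_trans ?_ (lintegral_tpDensity_le hq0 hTP)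
    rw [lintegral_circle_prod a b hDm.aemeasurable]
    calc ENNReal.ofReal (r ^ 2 * (lam / (4 * d)) ^ q) =
        ∫⁻ _ in Set.Ioc a (a + r) ×ˢ Set.Ioc b (b + r), ENNReal.ofReal ((lam / (4 * d)) ^ q) := by
          rw [setLIntegral_const, Measure.volume_eq_prod, Measure.prod_prod, Real.volume_Ioc, Real.volume_Ioc,
            add_sub_cancel_left, add_sub_cancel_left, ← ENNReal.ofReal_mul hr0.le,
            ← ENNReal.ofReal_mul (by positivity)]
          congr 1; ring
      _ ≤ ∫⁻ p in Set.Ioc a (a + r) ×ˢ Set.Ioc b (b + r),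
          ENNReal.ofReal (tpDensity q u ((p.1 : UnitAddCircle), (p.2 : UnitAddCircle))) := by
        refine setLIntegral_mono' (measurableSet_Ioc.prod measurableSet_Ioc) fun p hp => ?_
        apply ENNReal.ofReal_le_ofReal
        refine tpDensity_ge_of_orthogonal hq0 hlam hl hL hd hd0 hab horth ?_ ?_ ?_
        · rw [abs_le]; constructor <;> linarith [hp.1.1, hp.1.2]
        · rw [abs_le]; constructor <;> linarith [hp.2.1, hp.2.2]
        · rw [norm_sub_rev]; exact hT b p.2 hp.2.1.le (by linarith [hp.2.2])
      _ ≤ _ := lintegral_mono_set (Set.prod_mono (Set.Ioc_subset_Ioc le_rfl (by linarith))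
        (Set.Ioc_subset_Ioc le_rfl (by linarith)))
  have h2 := (ENNReal.ofReal_le_ofReal_iff (by positivity)).1 h1
  have hq2 : 0 < q - 2 := by linarith
  have h3 : (lam / 4) ^ q / (64 * Lam ^ 2 * (q * M)) ≤ d ^ (q - 2) := by
    rw [div_le_iff₀ (by positivity)]
    have e1 : (lam / (4 * d)) ^ q = (lam / 4) ^ q / (d ^ (q - 2) * d ^ 2) := by
      rw [show lam / (4 * d) = lam / 4 / d by field_simp, Real.div_rpow (by positivity) hd0.le,
        ← Real.rpow_two, ← Real.rpow_add hd0, sub_add_cancel]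
    rw [e1, hr] at h2
    have hD : 0 < d ^ (q - 2) := by positivity
    have e2 : (d / (8 * Lam)) ^ 2 * ((lam / 4) ^ q / (d ^ (q - 2) * d ^ 2)) =
        (lam / 4) ^ q / (d ^ (q - 2) * (64 * Lam ^ 2)) := by field_simp; norm_num
    rw [e2, div_le_iff₀ (by positivity)] at h2
    linarith
  calc _ ≤ (d ^ (q - 2)) ^ (1 / (q - 2)) := Real.rpow_le_rpow (by positivity) h3 (by positivity)
    _ = d := by rw [← Real.rpow_mul hd0.le, mul_one_div_cancel hq2.ne', Real.rpow_one]

/-- Curves of bounded tangent-point energy are uniformly bi-Lipschitz. -/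
lemma exists_biLipschitz_const (q lam Lam M : ℝ) (hq : 2 < q) (hlam : 0 < lam) (hLam : lam ≤ Lam) (hM : 0 < M) :
    ∃ β : ℝ, 0 < β ∧ ∀ (n : ℕ) (u : UnitAddCircle → EuclideanSpace ℝ (Fin n)),
      (∀ x, lam ≤ ‖circleDeriv u x‖) → (∀ x, ‖circleDeriv u x‖ ≤ Lam) → Continuous u →
      Continuous (circleDeriv u) → (∀ t : ℝ, HasDerivAt (fun s : ℝ => u s) (circleDeriv u t) t) →
      Function.Injective u → tangentPoint q u ≤ ENNReal.ofReal M →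
      ∀ x y, β * ‖x - y‖ ≤ ‖u x - u y‖ := by
  obtain ⟨κ, hκ0, hκ, hscale⟩ := exists_unitTangent_scale q lam Lam M hq hlam hLam hM
  have hLam0 : 0 < Lam := hlam.trans_le hLam
  set d₁ := ((lam / 4) ^ q / (64 * Lam ^ 2 * (q * M))) ^ (1 / (q - 2)) with hd₁
  have hd₁0 : 0 < d₁ := by positivity
  -- The entries serve in turn a minimising pair at distance exactly `κ`, the requirement that the
  -- square of side `d / (8 Lam)` has side at most `κ`, and the contradiction with
  -- `chord_lower_bound`.
  set d₀ := min (lam / 2 * κ) (min (8 * Lam * κ) d₁) with hd₀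
  have hd₀0 : 0 < d₀ := by positivity
  refine ⟨min (lam / 2) d₀, by positivity, fun n u hl hL hu hu' hd hinj hTP x y => ?_⟩
  have hT := hscale n u hl hL hu hu' hd hTP
  have hlocal : ∀ x y : UnitAddCircle, ‖x - y‖ ≤ κ → lam / 2 * ‖x - y‖ ≤ ‖u x - u y‖ := by
    have aux : ∀ s t : ℝ, s ≤ t → t - s ≤ κ → lam / 2 * (t - s) ≤ ‖u t - u s‖ := by
      intro s t hst hts
      have h1 := mul_sub_le_inner_of_unitTangent_close hlam hl hd hst ⟨le_rfl, hst⟩ (by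
        intro a ha b hb
        rcases le_total a b with h | h
        · exact hT a b h (by linarith [ha.1, hb.2])
        · rw [norm_sub_rev]; exact hT b a h (by linarith [ha.2, hb.1]))
      have h2 := real_inner_le_norm (unitTangent u s) (u t - u s)
      rw [norm_unitTangent hlam hl, one_mul] at h2
      exact h1.trans h2
    intro X Y hXY
    obtain ⟨s, t, rfl, rfl, h⟩ := exists_coe_sub_eq X Y
    rw [h] at hXY ⊢
    rcases le_total s t with hst | hst
    · rw [abs_sub_comm, abs_of_nonneg (by linarith), norm_sub_rev]
      rw [abs_sub_comm, abs_of_nonneg (by linarith)] at hXY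
      exact aux s t hst hXY
    · rw [abs_of_nonneg (by linarith)] at hXY ⊢
      exact aux t s hst hXY
  have hglobal : ∀ x y : UnitAddCircle, κ ≤ ‖x - y‖ → d₀ ≤ ‖u x - u y‖ := by
    set S : Set (UnitAddCircle × UnitAddCircle) := {p | κ ≤ ‖p.1 - p.2‖}
    have hS : IsCompact S := (isClosed_le continuous_const (by fun_prop)).isCompact
    intro x₁ y₁ h₁
    obtain ⟨⟨x₀, y₀⟩, hmem, hmin⟩ := hS.exists_isMinOn ⟨(x₁, y₁), h₁⟩
      (f := fun p : UnitAddCircle × UnitAddCircle => ‖u p.1 - u p.2‖) (by fun_prop)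
    rw [isMinOn_iff] at hmin
    refine le_trans ?_ (hmin (x₁, y₁) h₁)
    simp only
    rcases eq_or_lt_of_le (show κ ≤ ‖x₀ - y₀‖ from hmem) with heq | hlt
    · have := hlocal x₀ y₀ heq.symm.le
      rw [← heq] at this
      exact (min_le_left _ _).trans this
    · by_contra! hsmall
      have hpos : 0 < ‖u x₀ - u y₀‖ := by
        rw [norm_pos_iff, sub_ne_zero]
        intro h
        rw [hinj h, sub_self, norm_zero] at hlt
        linarith
      obtain ⟨a, -, rfl⟩ := exists_coe_Ioc 0 x₀
      obtain ⟨b, -, rfl⟩ := exists_coe_Ioc 0 y₀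
      have hsm2 := hsmall.trans_le (min_le_right _ _)
      -- The constraint `‖x - y‖ ≥ κ` is inactive at this minimum, so the squared chord length is
      -- stationary in its second endpoint.
      have horth : inner ℝ (u a - u b) (circleDeriv u b) = 0 := by
        have hder : HasDerivAt (fun s : ℝ => ‖u a - u s‖ ^ 2) (2 * inner ℝ (u a - u b) (-circleDeriv u b)) b :=
          ((hd b).const_sub (u a)).norm_sq
        have hloc : IsLocalMin (fun s : ℝ => ‖u a - u s‖ ^ 2) b := by
          have hev : ∀ᶠ s : ℝ in 𝓝 b, κ < ‖(a : UnitAddCircle) - s‖ := by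
            have hc : Continuous fun s : ℝ => ‖(a : UnitAddCircle) - s‖ :=
              (continuous_const.sub (AddCircle.continuous_mk' (1 : ℝ))).norm
            exact hc.continuousAt.eventually (lt_mem_nhds hlt)
          filter_upwards [hev] with s hs
          have := hmin ((a : UnitAddCircle), (s : UnitAddCircle)) hs.le
          simp only at this
          gcongr
        have := hloc.hasDerivAt_eq_zero hder
        rw [inner_neg_right] at this
        linarith
      have := chord_lower_bound hq hM hlam hl hL hu hu' hd hTP hκ hT hpos (by
        rw [div_le_iff₀ (by positivity)]
        linarith [hsm2.trans_le (min_le_left _ _)]) rfl horth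
      linarith [hsm2.trans_le (min_le_right _ _)]
  rcases le_total ‖x - y‖ κ with h | h
  · refine le_trans ?_ (hlocal x y h)
    gcongr
    exact min_le_left _ _
  · refine le_trans ?_ (hglobal x y h)
    have h1 : ‖x - y‖ ≤ 1 / 2 := by simpa using AddCircle.norm_le_half_period (p := (1:ℝ)) (x := x - y) one_ne_zero
    calc min (lam / 2) d₀ * ‖x - y‖ ≤ d₀ * 1 := by
          gcongr
          · exact min_le_right _ _
          · linarith
      _ = d₀ := mul_one _

end Global

/-! ### A Hardy inequality for averages over segments -/

section Hardy

variable {F : Type*} [NormedAddCommGroup F] [NormedSpace ℝ F]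

lemma lintegral_comp_mul_left_eq {f : ℝ → ℝ≥0∞} (hf : Measurable f) {θ : ℝ} (hθ : 0 < θ) :
    ∫⁻ h, f (θ * h) = ENNReal.ofReal θ⁻¹ * ∫⁻ h, f h := by
  rw [← lintegral_map hf (measurable_const_mul θ), Real.map_volume_mul_left hθ.ne', lintegral_smul_measure,
    abs_of_pos (inv_pos.2 hθ)]
  rfl

/-- A Hardy type inequality: averaging over segments from the origin does not increase a weighted norm. -/
lemma lintegral_segment_average_le {q : ℝ} (hq : 1 ≤ q) {φ : ℝ → F} (hφ : Continuous φ) {a : ℝ} :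
    ∫⁻ h in Set.Ioc (-a) a, ‖h⁻¹ • ∫ θ in (0 : ℝ)..1, φ (θ * h)‖ₑ ^ q ≤
      ∫⁻ h in Set.Ioc (-a) a, ENNReal.ofReal (‖φ h‖ ^ q / |h| ^ q) := by
  have hq0 : 0 < q := by linarith
  set f : ℝ → ℝ≥0∞ := fun h => ENNReal.ofReal (‖φ h‖ ^ q / |h| ^ q) with hf
  have hfm : Measurable f := by
    have h1 := hφ.norm.measurable
    exact ((h1.pow_const q).div (measurable_norm.pow_const q)).ennreal_ofReal
  set μ : Measure ℝ := volume.restrict (Set.Ioc 0 1) with hμ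
  have : IsProbabilityMeasure μ := ⟨by simp [μ]⟩
  -- Hölder on the unit interval moves the `q`-th power inside the average. The factor `θ^q` appears
  -- because the weight `|h|^(-q)` is rewritten at the point `θh`.
  have key : ∀ h ≠ 0, ‖h⁻¹ • ∫ θ in (0 : ℝ)..1, φ (θ * h)‖ₑ ^ q ≤ ∫⁻ θ, ENNReal.ofReal (θ ^ q) * f (θ * h) ∂μ := by
    intro h h0
    have hc : Continuous fun θ : ℝ => φ (θ * h) := by fun_prop
    have h1 : ‖∫ θ, φ (θ * h) ∂μ‖ₑ ≤ (∫⁻ θ, ‖φ (θ * h)‖ₑ ^ q ∂μ) ^ (1 / q) := by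
      refine (enorm_integral_le_lintegral_enorm _).trans ?_
      rw [← eLpNorm_one_eq_lintegral_enorm]
      have := eLpNorm_le_eLpNorm_of_exponent_le (μ := μ) (p := 1) (q := ENNReal.ofReal q)
        (by rw [← ENNReal.ofReal_one]; exact ENNReal.ofReal_le_ofReal hq) hc.aestronglyMeasurable
      refine this.trans (le_of_eq ?_)
      rw [eLpNorm_eq_lintegral_rpow_enorm_toReal (by simpa using hq0) ENNReal.ofReal_ne_top, ENNReal.toReal_ofReal hq0.le]
    rw [intervalIntegral.integral_of_le zero_le_one, enorm_smul, ENNReal.mul_rpow_of_nonneg _ _ hq0.le]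
    calc ‖h⁻¹‖ₑ ^ q * ‖∫ θ, φ (θ * h) ∂μ‖ₑ ^ q
        ≤ ‖h⁻¹‖ₑ ^ q * ((∫⁻ θ, ‖φ (θ * h)‖ₑ ^ q ∂μ) ^ (1 / q)) ^ q := by gcongr
      _ = ‖h⁻¹‖ₑ ^ q * ∫⁻ θ, ‖φ (θ * h)‖ₑ ^ q ∂μ := by
        rw [← ENNReal.rpow_mul, one_div_mul_cancel hq0.ne', ENNReal.rpow_one]
      _ = ∫⁻ θ, ‖h⁻¹‖ₑ ^ q * ‖φ (θ * h)‖ₑ ^ q ∂μ :=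
        (lintegral_const_mul' _ _ (by simp [hq0.le, enorm_ne_top])).symm
      _ = _ := by
        refine setLIntegral_congr_fun measurableSet_Ioc fun θ hθ => ?_
        have hθ0 : 0 < θ := hθ.1
        simp only [hf]
        rw [← ofReal_norm, ← ofReal_norm, ENNReal.ofReal_rpow_of_nonneg (norm_nonneg _) hq0.le,
          ENNReal.ofReal_rpow_of_nonneg (norm_nonneg _) hq0.le, ← ENNReal.ofReal_mul (by positivity),
          ← ENNReal.ofReal_mul (by positivity), abs_mul, abs_of_pos hθ0, Real.mul_rpow hθ0.le (abs_nonneg h),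
          norm_inv, Real.norm_eq_abs, Real.inv_rpow (abs_nonneg h)]
        have : 0 < |h| := abs_pos.2 h0
        congr 1
        field_simp
  -- Substituting `θh` for `h` costs `θ⁻¹`, which `θ^q` compensates as `q ≥ 1`; the scaled interval
  -- stays inside the original one.
  have hscale : ∀ θ ∈ Set.Ioc (0 : ℝ) 1,
      ∫⁻ h in Set.Ioc (-a) a, ENNReal.ofReal (θ ^ q) * f (θ * h) ≤ ∫⁻ h in Set.Ioc (-a) a, f h := by
    intro θ hθ
    have hθ0 : 0 < θ := hθ.1
    rw [lintegral_const_mul' _ _ ENNReal.ofReal_ne_top, ← lintegral_indicator measurableSet_Ioc,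
      ← lintegral_indicator measurableSet_Ioc]
    have h1 : ∀ h, (Set.Ioc (-a) a).indicator (fun h => f (θ * h)) h ≤ (Set.Ioc (-a) a).indicator f (θ * h) := by
      intro h
      by_cases hh : h ∈ Set.Ioc (-a) a
      · rw [Set.indicator_of_mem hh, Set.indicator_of_mem]
        have ha : 0 < a := by linarith [hh.1, hh.2]
        constructor
        · nlinarith [hh.1, hθ.2]
        · nlinarith [hh.2, hθ.2]
      · rw [Set.indicator_of_notMem hh]; exact zero_le
    calc ENNReal.ofReal (θ ^ q) * ∫⁻ h, (Set.Ioc (-a) a).indicator (fun h => f (θ * h)) h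
        ≤ ENNReal.ofReal (θ ^ q) * ∫⁻ h, (Set.Ioc (-a) a).indicator f (θ * h) := by
          gcongr with h; exact h1 h
      _ = ENNReal.ofReal (θ ^ q * θ⁻¹) * ∫⁻ h, (Set.Ioc (-a) a).indicator f h := by
          rw [lintegral_comp_mul_left_eq (hfm.indicator measurableSet_Ioc) hθ0, ← mul_assoc,
            ENNReal.ofReal_mul (by positivity)]
      _ ≤ 1 * ∫⁻ h, (Set.Ioc (-a) a).indicator f h := by
          gcongr
          rw [← ENNReal.ofReal_one]
          apply ENNReal.ofReal_le_ofReal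
          rw [← div_eq_mul_inv, div_le_one hθ0]
          calc θ ^ q ≤ θ ^ (1 : ℝ) := Real.rpow_le_rpow_of_exponent_ge hθ0 hθ.2 hq
            _ = θ := Real.rpow_one θ
      _ = _ := one_mul _
  calc ∫⁻ h in Set.Ioc (-a) a, ‖h⁻¹ • ∫ θ in (0 : ℝ)..1, φ (θ * h)‖ₑ ^ q
      ≤ ∫⁻ h in Set.Ioc (-a) a, ∫⁻ θ, ENNReal.ofReal (θ ^ q) * f (θ * h) ∂μ := by
        refine lintegral_mono_ae (ae_restrict_of_ae ?_)
        filter_upwards [Measure.ae_ne volume (0 : ℝ)] with h hh using key h hh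
    _ = ∫⁻ θ, ∫⁻ h in Set.Ioc (-a) a, ENNReal.ofReal (θ ^ q) * f (θ * h) ∂volume ∂μ := by
        refine lintegral_lintegral_swap (Measurable.aemeasurable ?_)
        have m1 : Measurable fun p : ℝ × ℝ => ENNReal.ofReal (p.2 ^ q) :=
          (measurable_snd.pow_const q).ennreal_ofReal
        have m2 : Measurable fun p : ℝ × ℝ => f (p.2 * p.1) :=
          hfm.comp (measurable_snd.mul measurable_fst)
        exact m1.mul m2
    _ ≤ ∫⁻ _, (∫⁻ h in Set.Ioc (-a) a, f h) ∂μ :=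
        lintegral_mono_ae ((ae_restrict_iff' measurableSet_Ioc).2 (Eventually.of_forall hscale))
    _ = _ := by simp

end Hardy

/-! ### Chord quotients and Taylor quotients -/

section Chord

/-- The representative of a point of the circle in `(-1/2, 1/2]`. -/
def signedRep (x : UnitAddCircle) : ℝ := AddCircle.equivIoc 1 (-(1 / 2)) x

lemma coe_signedRep (x : UnitAddCircle) : (signedRep x : UnitAddCircle) = x :=
  (AddCircle.equivIoc 1 (-(1 / 2))).symm_apply_apply x

lemma signedRep_mem (x : UnitAddCircle) : signedRep x ∈ Set.Ioc (-(1 / 2) : ℝ) (1 / 2) := by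
  have := (AddCircle.equivIoc 1 (-(1 / 2)) x).2
  unfold signedRep
  norm_num at this ⊢
  exact this

lemma abs_signedRep (x : UnitAddCircle) : |signedRep x| = ‖x‖ := by
  conv_rhs => rw [← coe_signedRep x]
  rw [(AddCircle.norm_coe_eq_abs_iff (p := 1) one_ne_zero).2]
  have := signedRep_mem x
  rw [abs_one, abs_le]
  constructor <;> linarith [this.1, this.2]

lemma signedRep_coe {h : ℝ} (hh : h ∈ Set.Ioc (-(1 / 2) : ℝ) (1 / 2)) : signedRep (h : UnitAddCircle) = h := by
  have h1 : h ∈ Set.Ioc (-(1 / 2) : ℝ) (-(1 / 2) + 1) := by norm_num at hh ⊢; exact hh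
  exact congrArg Subtype.val ((AddCircle.equivIoc 1 (-(1 / 2))).apply_symm_apply ⟨h, h1⟩)

lemma measurable_signedRep : Measurable signedRep :=
  measurable_subtype_coe.comp (AddCircle.measurePreserving_equivIoc 1 (a := -(1 / 2))).measurable

variable {n : ℕ}

/-- The tangent at `y`, for `p = (x, y)`. -/
def tangentAt (w : UnitAddCircle → EuclideanSpace ℝ (Fin n)) (p : UnitAddCircle × UnitAddCircle) :
    EuclideanSpace ℝ (Fin n) := circleDeriv w p.2

/-- The difference quotient `(w(x) - w(y)) / (x - y)`. -/
def chordQuotient (w : UnitAddCircle → EuclideanSpace ℝ (Fin n)) (p : UnitAddCircle × UnitAddCircle) :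
    EuclideanSpace ℝ (Fin n) := (signedRep (p.1 - p.2))⁻¹ • (w p.1 - w p.2)

/-- The first-order Taylor remainder at `y`, divided by `(x - y)²`. -/
def taylorQuotient (w : UnitAddCircle → EuclideanSpace ℝ (Fin n)) (p : UnitAddCircle × UnitAddCircle) :
    EuclideanSpace ℝ (Fin n) := (signedRep (p.1 - p.2))⁻¹ • (chordQuotient w p - tangentAt w p)

/-- `C¹` curves on the circle whose derivative has finite Slobodeckij energy. -/
structure FiniteEnergyCurve (q : ℝ) (w : UnitAddCircle → EuclideanSpace ℝ (Fin n)) : Prop where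
  continuous_deriv : Continuous (circleDeriv w)
  hasDerivAt : ∀ t : ℝ, HasDerivAt (fun s : ℝ => w s) (circleDeriv w t) t
  energy_ne_top : circleEnergy q (circleDeriv w) ≠ ⊤

lemma IsSobolevCurve.finiteEnergyCurve {q : ℝ} (hq : 2 < q) {w : UnitAddCircle → EuclideanSpace ℝ (Fin n)}
    (hw : IsSobolevCurve q w) : FiniteEnergyCurve q w :=
  ⟨(hw.regular hq).1, (hw.regular hq).2.1, (hw.regular hq).2.2⟩

variable {q : ℝ} {w : UnitAddCircle → EuclideanSpace ℝ (Fin n)}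

lemma FiniteEnergyCurve.continuous (hw : FiniteEnergyCurve q w) : Continuous w :=
  (QuotientAddGroup.isQuotientMap_mk _).continuous_iff.2
    (continuous_iff_continuousAt.2 fun t => (hw.hasDerivAt t).continuousAt)

lemma FiniteEnergyCurve.measurable_tangentAt (hw : FiniteEnergyCurve q w) : Measurable (tangentAt w) :=
  (hw.continuous_deriv.comp continuous_snd).measurable

lemma measurable_signedRep_sub : Measurable fun p : UnitAddCircle × UnitAddCircle => signedRep (p.1 - p.2) :=
  measurable_signedRep.comp (continuous_fst.sub continuous_snd).measurable

lemma FiniteEnergyCurve.measurable_chordQuotient (hw : FiniteEnergyCurve q w) : Measurable (chordQuotient w) :=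
  measurable_signedRep_sub.inv.smul
    ((hw.continuous.comp continuous_fst).sub (hw.continuous.comp continuous_snd)).measurable

lemma FiniteEnergyCurve.measurable_taylorQuotient (hw : FiniteEnergyCurve q w) : Measurable (taylorQuotient w) :=
  measurable_signedRep_sub.inv.smul (hw.measurable_chordQuotient.sub hw.measurable_tangentAt)

lemma FiniteEnergyCurve.taylorQuotient_add_coe (hw : FiniteEnergyCurve q w) (y : UnitAddCircle) {h : ℝ}
    (hh : h ∈ Set.Ioc (-(1 / 2) : ℝ) (1 / 2)) (h0 : h ≠ 0) :
    taylorQuotient w (y + h, y) =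
      h⁻¹ • ∫ θ in (0 : ℝ)..1, (circleDeriv w (y + ((θ * h : ℝ) : UnitAddCircle)) - circleDeriv w y) := by
  obtain ⟨t, -, rfl⟩ := exists_coe_Ioc 0 y
  unfold taylorQuotient chordQuotient tangentAt
  simp only [add_sub_cancel_left, signedRep_coe hh]
  congr 1
  have hcV : Continuous fun s : ℝ => circleDeriv w s := hw.continuous_deriv.comp (AddCircle.continuous_mk' 1)
  have hc : Continuous fun θ : ℝ => circleDeriv w ((t + θ * h : ℝ) : UnitAddCircle) :=
    hcV.comp (by fun_prop)
  simp_rw [← AddCircle.coe_add]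
  rw [intervalIntegral.integral_sub (hc.intervalIntegrable _ _) (by simp)]
  congr 1
  · have hder : ∀ θ ∈ Set.uIcc (0 : ℝ) 1, HasDerivAt (fun θ : ℝ => h⁻¹ • w ((t + θ * h : ℝ) : UnitAddCircle))
        (circleDeriv w ((t + θ * h : ℝ) : UnitAddCircle)) θ := by
      intro θ _
      have h1 : HasDerivAt (fun θ : ℝ => t + θ * h) h θ := by
        simpa using ((hasDerivAt_id θ).mul_const h).const_add t
      have h2 := ((hw.hasDerivAt (t + θ * h)).scomp θ h1).const_smul h⁻¹
      rw [smul_smul, inv_mul_cancel₀ h0, one_smul] at h2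
      exact h2
    rw [intervalIntegral.integral_eq_sub_of_hasDerivAt hder (hc.intervalIntegrable _ _)]
    simp [smul_sub]
  · simp

/-- For fixed `y`, after translating `x` to `y + h`, this is the Hardy inequality for `φ(h) = w'(y +
h) - w'(y)`; integration over `y` gives the energy of `w'`. -/
lemma FiniteEnergyCurve.lintegral_taylorQuotient_le (hq : 1 ≤ q) (hw : FiniteEnergyCurve q w) :
    ∫⁻ p, ‖taylorQuotient w p‖ₑ ^ q ≤ circleEnergy q (circleDeriv w) := by
  have hq0 : 0 < q := by linarith
  unfold circleEnergy
  have hm1 : Measurable fun p => ‖taylorQuotient w p‖ₑ ^ q := hw.measurable_taylorQuotient.enorm.pow_const q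
  have hm2 : Measurable fun p : UnitAddCircle × UnitAddCircle =>
      ENNReal.ofReal (‖circleDeriv w p.1 - circleDeriv w p.2‖ ^ q / ‖p.1 - p.2‖ ^ q) := by
    have hc := hw.continuous_deriv
    have h1 : Continuous fun p : UnitAddCircle × UnitAddCircle => ‖circleDeriv w p.1 - circleDeriv w p.2‖ := by
      fun_prop
    have h2 : Continuous fun p : UnitAddCircle × UnitAddCircle => ‖p.1 - p.2‖ := by fun_prop
    exact ((h1.measurable.pow_const q).div (h2.measurable.pow_const q)).ennreal_ofReal
  rw [Measure.volume_eq_prod, lintegral_prod_symm _ hm1.aemeasurable, lintegral_prod_symm _ hm2.aemeasurable]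
  refine lintegral_mono fun y => ?_
  rw [← lintegral_add_left_eq_self _ y, ← UnitAddCircle.lintegral_preimage (-(1 / 2)),
    ← lintegral_add_left_eq_self (fun x => ENNReal.ofReal (‖circleDeriv w (x, y).1 - circleDeriv w (x, y).2‖ ^ q / ‖(x, y).1 - (x, y).2‖ ^ q)) y,
    ← UnitAddCircle.lintegral_preimage (-(1 / 2)), show (-(1 / 2) + 1 : ℝ) = 1 / 2 by norm_num]
  simp only [add_sub_cancel_left]
  have hc : Continuous fun h : ℝ => circleDeriv w (y + (h : UnitAddCircle)) - circleDeriv w y :=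
    (hw.continuous_deriv.comp (continuous_const.add (AddCircle.continuous_mk' (1 : ℝ)))).sub continuous_const
  refine le_trans (le_of_eq ?_) ((lintegral_segment_average_le hq hc (a := 1 / 2)).trans (le_of_eq ?_))
  · refine lintegral_congr_ae ?_
    filter_upwards [ae_restrict_of_ae (Measure.ae_ne volume (0 : ℝ)), ae_restrict_mem measurableSet_Ioc] with h h0 hh
    rw [hw.taylorQuotient_add_coe y hh h0]
  · refine setLIntegral_congr_fun measurableSet_Ioc fun h hh => ?_
    rw [← signedRep_coe hh, abs_signedRep, coe_signedRep]

/-- The measure-preserving shear `(x, y) ↦ (x - y, y)` carries the diagonal to `{0}` times the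
circle, and a point of the circle is null. -/
lemma ae_ne_diagonal : ∀ᵐ p : UnitAddCircle × UnitAddCircle, p.1 ≠ p.2 := by
  have h : ∀ᵐ k : UnitAddCircle, k ≠ 0 := by
    refine ae_circle_of_ae ?_
    filter_upwards [Measure.ae_ne volume (1 : ℝ)] with t ht hmem h0
    have h1 : (⟨t, by rw [zero_add]; exact hmem⟩ : Set.Ioc (0:ℝ) (0 + 1)) = ⟨1, by simp⟩ := by
      apply (AddCircle.equivIoc (1:ℝ) 0).symm.injective
      change (t : UnitAddCircle) = ((1 : ℝ) : UnitAddCircle)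
      rw [h0]; exact (AddCircle.coe_period (1 : ℝ)).symm
    exact ht (congrArg Subtype.val h1)
  have hmp := measurePreserving_sub_prod (volume : Measure UnitAddCircle) (volume : Measure UnitAddCircle)
  filter_upwards [(Measure.quasiMeasurePreserving_fst.comp hmp.quasiMeasurePreserving).ae h] with p hp
  exact sub_ne_zero.1 hp

lemma signedRep_ne_zero {x y : UnitAddCircle} (h : x ≠ y) : signedRep (x - y) ≠ 0 := by
  rw [← abs_ne_zero, abs_signedRep]
  exact norm_ne_zero_iff.2 (sub_ne_zero.2 h)

lemma wedgeNorm_smul_right (c : ℝ) (a b : EuclideanSpace ℝ (Fin n)) : wedgeNorm a (c • b) = |c| * wedgeNorm a b := by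
  refine (sq_eq_sq₀ (wedgeNorm_nonneg _ _) (by have := wedgeNorm_nonneg a b; positivity)).1 ?_
  rw [mul_pow, wedgeNorm_sq, wedgeNorm_sq, norm_smul, inner_smul_right, sq_abs, Real.norm_eq_abs, mul_pow, sq_abs]
  ring

lemma wedgeNorm_add_smul_left (c : ℝ) (a b : EuclideanSpace ℝ (Fin n)) : wedgeNorm a (b + c • a) = wedgeNorm a b := by
  unfold wedgeNorm
  congr 1
  rw [norm_add_sq_real, inner_add_right, inner_smul_right, inner_smul_right, norm_smul, real_inner_self_eq_norm_sq,
    real_inner_comm, Real.norm_eq_abs, mul_pow, sq_abs]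
  ring

/-- The integrand of `TP` in terms of difference quotients. -/
lemma tpDensity_eq_quotient (q : ℝ) (w : UnitAddCircle → EuclideanSpace ℝ (Fin n)) {p : UnitAddCircle × UnitAddCircle}
    (hp : p.1 ≠ p.2) :
    tpDensity q w p = (wedgeNorm (tangentAt w p) (taylorQuotient w p) / ‖chordQuotient w p‖ ^ 2) ^ q := by
  rw [tpDensity_eq]
  congr 1
  have h0 := signedRep_ne_zero hp
  have e1 : w p.1 - w p.2 = signedRep (p.1 - p.2) • chordQuotient w p := by
    unfold chordQuotient; rw [smul_smul, mul_inv_cancel₀ h0, one_smul]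
  -- The tangential part of the chord drops out of the wedge with the tangent, which gains one power
  -- of the distance.
  have e2 : chordQuotient w p = signedRep (p.1 - p.2) • taylorQuotient w p + (1 : ℝ) • tangentAt w p := by
    unfold taylorQuotient; rw [smul_smul, mul_inv_cancel₀ h0, one_smul]; simp
  change wedgeNorm (tangentAt w p) _ / _ = _
  have e3 : wedgeNorm (tangentAt w p) (chordQuotient w p) =
      |signedRep (p.1 - p.2)| * wedgeNorm (tangentAt w p) (taylorQuotient w p) := by
    rw [e2, wedgeNorm_add_smul_left, wedgeNorm_smul_right]
  have h1 : 0 < |signedRep (p.1 - p.2)| := abs_pos.2 h0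
  rw [e1, wedgeNorm_smul_right, norm_smul, Real.norm_eq_abs, mul_pow, e3, ← mul_assoc, ← sq,
    mul_div_mul_left _ _ (by positivity)]

lemma norm_sub_le_of_circleDeriv_le' {S : ℝ} (hS : ∀ x, ‖circleDeriv w x‖ ≤ S)
    (hd : ∀ t : ℝ, HasDerivAt (fun s : ℝ => w s) (circleDeriv w t) t) (x y : UnitAddCircle) :
    ‖w x - w y‖ ≤ S * ‖x - y‖ := by
  obtain ⟨s, t, rfl, rfl, h⟩ := exists_coe_sub_eq x y
  rw [h]
  exact norm_sub_le_of_circleDeriv_le hS hd t s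

lemma norm_chordQuotient_le {S : ℝ} (hS : ∀ x, ‖circleDeriv w x‖ ≤ S)
    (hd : ∀ t : ℝ, HasDerivAt (fun s : ℝ => w s) (circleDeriv w t) t) (p : UnitAddCircle × UnitAddCircle) :
    ‖chordQuotient w p‖ ≤ S := by
  have hS0 : 0 ≤ S := (norm_nonneg _).trans (hS 0)
  unfold chordQuotient
  rw [norm_smul, norm_inv, Real.norm_eq_abs, abs_signedRep]
  rcases eq_or_ne p.1 p.2 with h | h
  · simp [h, hS0]
  · have : 0 < ‖p.1 - p.2‖ := norm_pos_iff.2 (sub_ne_zero.2 h)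
    rw [inv_mul_le_iff₀ this, mul_comm]
    exact norm_sub_le_of_circleDeriv_le' hS hd _ _

lemma le_norm_chordQuotient {β : ℝ} (hβ : ∀ x y, β * ‖x - y‖ ≤ ‖w x - w y‖)
    {p : UnitAddCircle × UnitAddCircle} (hp : p.1 ≠ p.2) : β ≤ ‖chordQuotient w p‖ := by
  have : 0 < ‖p.1 - p.2‖ := norm_pos_iff.2 (sub_ne_zero.2 hp)
  unfold chordQuotient
  rw [norm_smul, norm_inv, Real.norm_eq_abs, abs_signedRep, inv_mul_eq_div, le_div_iff₀ this]
  exact hβ _ _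

end Chord

/-! ### Differentiating powers of the norm -/

section NormPower

variable {H : Type*} [NormedAddCommGroup H] [InnerProductSpace ℝ H]

lemma hasDerivAt_norm_rpow_comp {q : ℝ} (hq : 2 < q) {x : ℝ → H} {x' : H} {t : ℝ} (hx : HasDerivAt x x' t) :
    HasDerivAt (fun s => ‖x s‖ ^ q) (q * (‖x t‖ ^ (q - 2) * inner ℝ (x t) x')) t := by
  have h := (hasFDerivAt_norm_rpow (x t) (show 1 < q by linarith)).comp_hasDerivAt t hx
  refine h.congr_deriv ?_
  simp [mul_assoc]

/-- The map `x ↦ |x|^{q-2} x` is differentiable for `q > 2`. -/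
lemma hasDerivAt_norm_rpow_smul {q : ℝ} (hq : 2 < q) {x : ℝ → H} {x' : H} {t : ℝ} (hx : HasDerivAt x x' t) :
    HasDerivAt (fun s => ‖x s‖ ^ (q - 2) • x s)
      (‖x t‖ ^ (q - 2) • x' + ((q - 2) * ‖x t‖ ^ (q - 4) * inner ℝ (x t) x') • x t) t := by
  -- At a zero the slope of the product is `‖x s‖^(q-2)` times the slope of `x`, so its limit needs
  -- only continuity of `‖x‖^(q-2)`. The term with exponent `q - 4`, possibly negative, is
  -- multiplied by `x t = 0`.
  by_cases h0 : x t = 0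
  · rw [hasDerivAt_iff_tendsto_slope] at hx ⊢
    have hc : Tendsto (fun s => ‖x s‖ ^ (q - 2)) (𝓝[≠] t) (𝓝 (‖x t‖ ^ (q - 2))) := by
      have hxc : ContinuousAt x t := (hasDerivAt_iff_tendsto_slope.2 hx).continuousAt
      exact (hxc.norm.rpow_const (Or.inr (by linarith))).tendsto.mono_left nhdsWithin_le_nhds
    have := hc.smul hx
    rw [h0, smul_zero, add_zero, ← h0]
    refine this.congr fun s => ?_
    simp only [slope, vsub_eq_sub, h0, sub_zero, smul_zero]
    rw [smul_comm]
  · have hpos : 0 < ‖x t‖ := norm_pos_iff.2 h0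
    have h1 : HasDerivAt (fun s => ‖x s‖ ^ 2) (2 * inner ℝ (x t) x') t := hx.norm_sq
    have h2 : HasDerivAt (fun s => (‖x s‖ ^ 2) ^ ((q - 2) / 2)) _ t :=
      h1.rpow_const (Or.inl (by positivity))
    have e : ∀ (s : ℝ) (r : ℝ), (‖x s‖ ^ 2) ^ (r / 2) = ‖x s‖ ^ r := fun s r => by
      rw [← Real.rpow_two, ← Real.rpow_mul (norm_nonneg _)]; congr 1; ring
    have e4 : (‖x t‖ ^ 2) ^ ((q - 2) / 2 - 1) = ‖x t‖ ^ (q - 4) := by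
      rw [← e t]; congr 1; ring
    simp only [e, e4] at h2
    refine (h2.smul hx).congr_deriv ?_
    congr 2
    ring

end NormPower

/-! ### The integrand as a function of triples and its derivatives -/

section Calculus

variable {n : ℕ}

/-- The exterior product `a ∧ b`, as an antisymmetric matrix whose norm is `|a ∧ b|`. -/
def wedgeFun (a b : EuclideanSpace ℝ (Fin n)) : EuclideanSpace ℝ (Fin n × Fin n) :=
  WithLp.toLp 2 fun k => (√2)⁻¹ * (a k.1 * b k.2 - a k.2 * b k.1)

/-- Lagrange's identity; the matrix counts each pair of indices twice, which the factor `(√2)⁻¹`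
corrects. -/
lemma norm_wedgeFun (a b : EuclideanSpace ℝ (Fin n)) : ‖wedgeFun a b‖ = wedgeNorm a b := by
  refine (sq_eq_sq₀ (norm_nonneg _) (wedgeNorm_nonneg _ _)).1 ?_
  rw [wedgeNorm_sq, EuclideanSpace.real_norm_sq_eq, EuclideanSpace.real_norm_sq_eq, EuclideanSpace.real_norm_sq_eq,
    Fintype.sum_prod_type]
  simp only [wedgeFun, PiLp.inner_apply, RCLike.inner_apply, conj_trivial]
  have h2 : ((√2)⁻¹ : ℝ) ^ 2 = 1 / 2 := by rw [inv_pow, Real.sq_sqrt (by norm_num)]; norm_num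
  have e : ∀ i j, ((√2)⁻¹ * (a i * b j - a j * b i)) ^ 2 =
      1 / 2 * (a i ^ 2 * b j ^ 2) + 1 / 2 * (b i ^ 2 * a j ^ 2) - (b i * a i) * (b j * a j) := fun i j => by
    rw [mul_pow, h2]; ring
  simp_rw [e, Finset.sum_sub_distrib, Finset.sum_add_distrib, ← Finset.mul_sum, ← Finset.sum_mul]
  ring

lemma wedgeNorm_le (a b : EuclideanSpace ℝ (Fin n)) : wedgeNorm a b ≤ ‖a‖ * ‖b‖ := by
  refine le_of_sq_le_sq ?_ (by positivity)
  rw [wedgeNorm_sq]; nlinarith [sq_nonneg (inner ℝ a b)]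

/-- The exterior product as a continuous bilinear map. -/
def wedgeMap (n : ℕ) :
    EuclideanSpace ℝ (Fin n) →L[ℝ] EuclideanSpace ℝ (Fin n) →L[ℝ] EuclideanSpace ℝ (Fin n × Fin n) :=
  LinearMap.mkContinuous₂
    (LinearMap.mk₂ ℝ wedgeFun
      (fun a a' b => by ext k; simp [wedgeFun]; ring)
      (fun c a b => by ext k; simp [wedgeFun]; ring)
      (fun a b b' => by ext k; simp [wedgeFun]; ring)
      (fun c a b => by ext k; simp [wedgeFun]; ring)) 1
    (fun a b => by
      rw [LinearMap.mk₂_apply, norm_wedgeFun, one_mul]; exact wedgeNorm_le a b)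

lemma norm_wedgeMap (a b : EuclideanSpace ℝ (Fin n)) : ‖wedgeMap n a b‖ = wedgeNorm a b := norm_wedgeFun a b

lemma norm_wedgeMap_le (a b : EuclideanSpace ℝ (Fin n)) : ‖wedgeMap n a b‖ ≤ ‖a‖ * ‖b‖ :=
  (norm_wedgeMap a b).trans_le (wedgeNorm_le a b)

/-- Triples (tangent, chord quotient, Taylor quotient). -/
abbrev CurveTriple (n : ℕ) : Type :=
  EuclideanSpace ℝ (Fin n) × EuclideanSpace ℝ (Fin n) × EuclideanSpace ℝ (Fin n)

/-- The wedge of tangent and Taylor quotient. -/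
def tripleWedge (Y : CurveTriple n) : EuclideanSpace ℝ (Fin n × Fin n) := wedgeMap n Y.1 Y.2.2

/-- The polarisation of `tripleWedge`. -/
def tripleWedge₂ (Y Z : CurveTriple n) : EuclideanSpace ℝ (Fin n × Fin n) :=
  wedgeMap n Z.1 Y.2.2 + wedgeMap n Y.1 Z.2.2

/-- The integrand of `TP` as a function of a triple. -/
def tripleDensity (q : ℝ) (Y : CurveTriple n) : ℝ := ‖tripleWedge Y‖ ^ q * (‖Y.2.1‖ ^ 2) ^ (-q)

/-- The first derivative of `tripleDensity`. -/
def tripleDensity₁ (q : ℝ) (Y Z : CurveTriple n) : ℝ :=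
  q * (‖tripleWedge Y‖ ^ (q - 2) * inner ℝ (tripleWedge Y) (tripleWedge₂ Y Z)) * (‖Y.2.1‖ ^ 2) ^ (-q)
    - 2 * q * ‖tripleWedge Y‖ ^ q * inner ℝ Y.2.1 Z.2.1 * (‖Y.2.1‖ ^ 2) ^ (-q - 1)

/-- The second derivative of `tripleDensity`. -/
def tripleDensity₂ (q : ℝ) (Y Z W : CurveTriple n) : ℝ :=
  q * (‖tripleWedge Y‖ ^ (q - 2) * inner ℝ (tripleWedge₂ Y W) (tripleWedge₂ Y Z)
      + (q - 2) * ‖tripleWedge Y‖ ^ (q - 4) * inner ℝ (tripleWedge Y) (tripleWedge₂ Y W) *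
        inner ℝ (tripleWedge Y) (tripleWedge₂ Y Z)
      + ‖tripleWedge Y‖ ^ (q - 2) * inner ℝ (tripleWedge Y) (tripleWedge₂ W Z)) * (‖Y.2.1‖ ^ 2) ^ (-q)
    - 2 * q ^ 2 * (‖tripleWedge Y‖ ^ (q - 2) * inner ℝ (tripleWedge Y) (tripleWedge₂ Y Z)) * inner ℝ Y.2.1 W.2.1 *
      (‖Y.2.1‖ ^ 2) ^ (-q - 1)
    - 2 * q ^ 2 * (‖tripleWedge Y‖ ^ (q - 2) * inner ℝ (tripleWedge Y) (tripleWedge₂ Y W)) * inner ℝ Y.2.1 Z.2.1 *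
      (‖Y.2.1‖ ^ 2) ^ (-q - 1)
    - 2 * q * ‖tripleWedge Y‖ ^ q * inner ℝ W.2.1 Z.2.1 * (‖Y.2.1‖ ^ 2) ^ (-q - 1)
    + 4 * q * (q + 1) * ‖tripleWedge Y‖ ^ q * inner ℝ Y.2.1 Z.2.1 * inner ℝ Y.2.1 W.2.1 * (‖Y.2.1‖ ^ 2) ^ (-q - 2)

lemma hasDerivAt_tripleWedge (Y Z : CurveTriple n) (t : ℝ) :
    HasDerivAt (fun s : ℝ => tripleWedge (Y + s • Z)) (tripleWedge₂ (Y + t • Z) Z) t := by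
  have e : (fun s : ℝ => tripleWedge (Y + s • Z)) = fun s : ℝ => wedgeMap n Y.1 Y.2.2 +
      s • (wedgeMap n Z.1 Y.2.2 + wedgeMap n Y.1 Z.2.2) + s ^ 2 • wedgeMap n Z.1 Z.2.2 := by
    ext1 s
    simp only [tripleWedge, Prod.fst_add, Prod.smul_fst, Prod.snd_add, Prod.smul_snd, map_add, map_smul,
      add_apply, smul_apply]
    module
  rw [e]
  have h1 := (((hasDerivAt_id t).smul_const (wedgeMap n Z.1 Y.2.2 + wedgeMap n Y.1 Z.2.2)).const_add
    (wedgeMap n Y.1 Y.2.2)).add ((hasDerivAt_pow 2 t).smul_const (wedgeMap n Z.1 Z.2.2))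
  refine h1.congr_deriv ?_
  simp only [tripleWedge₂, Prod.fst_add, Prod.smul_fst, Prod.snd_add, Prod.smul_snd, map_add, map_smul,
      add_apply, smul_apply]
  simp only [Nat.cast_ofNat, Nat.add_one_sub_one, pow_one]
  module

lemma hasDerivAt_tripleWedge₂ (Y Z W : CurveTriple n) (t : ℝ) :
    HasDerivAt (fun s : ℝ => tripleWedge₂ (Y + s • W) Z) (tripleWedge₂ W Z) t := by
  have e : (fun s : ℝ => tripleWedge₂ (Y + s • W) Z) = fun s : ℝ => tripleWedge₂ Y Z + s • tripleWedge₂ W Z := by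
    ext1 s
    simp only [tripleWedge₂, Prod.fst_add, Prod.smul_fst, Prod.snd_add, Prod.smul_snd, map_add, map_smul,
      add_apply, smul_apply]
    module
  rw [e]
  simpa using ((hasDerivAt_id t).smul_const (tripleWedge₂ W Z)).const_add (tripleWedge₂ Y Z)

lemma hasDerivAt_snd_fst (Y Z : CurveTriple n) (t : ℝ) :
    HasDerivAt (fun s : ℝ => (Y + s • Z).2.1) Z.2.1 t := by
  simpa using ((hasDerivAt_id t).smul_const Z.2.1).const_add Y.2.1

lemma hasDerivAt_normSq_rpow (Y Z : CurveTriple n) {t : ℝ} (h : (Y + t • Z).2.1 ≠ 0) (r : ℝ) :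
    HasDerivAt (fun s : ℝ => (‖(Y + s • Z).2.1‖ ^ 2) ^ r)
      (2 * inner ℝ (Y + t • Z).2.1 Z.2.1 * r * (‖(Y + t • Z).2.1‖ ^ 2) ^ (r - 1)) t := by
  have hpos : 0 < ‖(Y + t • Z).2.1‖ := norm_pos_iff.2 h
  exact (hasDerivAt_snd_fst Y Z t).norm_sq.rpow_const (Or.inl (by positivity))

lemma hasDerivAt_tripleDensity {q : ℝ} (hq : 2 < q) (Y Z : CurveTriple n) {t : ℝ} (h : (Y + t • Z).2.1 ≠ 0) :
    HasDerivAt (fun s : ℝ => tripleDensity q (Y + s • Z)) (tripleDensity₁ q (Y + t • Z) Z) t := by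
  have h1 := hasDerivAt_norm_rpow_comp hq (hasDerivAt_tripleWedge Y Z t)
  have h2 := hasDerivAt_normSq_rpow Y Z h (-q)
  refine (h1.mul h2).congr_deriv ?_
  unfold tripleDensity₁
  ring

/-- The scalar `‖x‖^(q-2)` alone need not be differentiable at 0 when `q ≤ 3`. It is therefore
grouped with the wedge into the field `‖x‖^(q-2) • x`, which is then paired with `tripleWedge₂`,
affine along the line. -/
lemma hasDerivAt_tripleDensity₁ {q : ℝ} (hq : 2 < q) (Y Z W : CurveTriple n) {t : ℝ} (h : (Y + t • W).2.1 ≠ 0) :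
    HasDerivAt (fun s : ℝ => tripleDensity₁ q (Y + s • W) Z) (tripleDensity₂ q (Y + t • W) Z W) t := by
  have h1 := (hasDerivAt_norm_rpow_smul hq (hasDerivAt_tripleWedge Y W t)).inner ℝ (hasDerivAt_tripleWedge₂ Y Z W t)
  have h2 := hasDerivAt_normSq_rpow Y W h (-q)
  have h3 := hasDerivAt_norm_rpow_comp hq (hasDerivAt_tripleWedge Y W t)
  have h4 := (hasDerivAt_snd_fst Y W t).inner ℝ (hasDerivAt_const t Z.2.1)
  have h5 := hasDerivAt_normSq_rpow Y W h (-q - 1)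
  have h6 := ((h1.const_mul q).mul h2).sub (((h3.const_mul (2 * q)).mul h4).mul h5)
  have e : (fun s : ℝ => tripleDensity₁ q (Y + s • W) Z) = fun s : ℝ =>
      q * inner ℝ (‖tripleWedge (Y + s • W)‖ ^ (q - 2) • tripleWedge (Y + s • W)) (tripleWedge₂ (Y + s • W) Z) *
        (‖(Y + s • W).2.1‖ ^ 2) ^ (-q) - 2 * q * ‖tripleWedge (Y + s • W)‖ ^ q * inner ℝ (Y + s • W).2.1 Z.2.1 *
        (‖(Y + s • W).2.1‖ ^ 2) ^ (-q - 1) := by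
    ext1 s
    unfold tripleDensity₁
    rw [real_inner_smul_left]
  rw [e]
  refine h6.congr_deriv ?_
  unfold tripleDensity₂
  simp only [real_inner_smul_left, inner_add_left, inner_zero_right, zero_add, Pi.mul_apply]
  rw [show -q - 1 - 1 = -q - 2 by ring]
  ring

end Calculus

/-! ### Pointwise bounds for the integrand and its derivatives -/

section Bounds

variable {n : ℕ}

lemma rpow_eq_rpow_sub_two_mul_sq {x q : ℝ} (hx : 0 ≤ x) (hq : 2 < q) : x ^ q = x ^ (q - 2) * x ^ 2 := by
  rw [← Real.rpow_two, ← Real.rpow_add_of_nonneg hx (by linarith) (by norm_num), sub_add_cancel]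

/-- The two inner products each supply a factor `x`, which offsets the exponent `q - 4`. At `x = 0`
they vanish, so the value assigned to `0^(q-4)` is harmless. -/
lemma rpow_sub_four_mul_le {x a b y z q : ℝ} (hx : 0 ≤ x) (hq : 2 < q) (ha : |a| ≤ x * y) (hb : |b| ≤ x * z)
    (hy : 0 ≤ y) :
    |x ^ (q - 4) * a * b| ≤ x ^ (q - 2) * (y * z) := by
  rcases hx.eq_or_lt with rfl | hx
  · have h1 : a = 0 := by simpa using ha
    simp [h1, Real.zero_rpow (show q - 2 ≠ 0 by linarith)]
  · have e : x ^ (q - 2) = x ^ (q - 4) * x ^ 2 := by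
      rw [← Real.rpow_two, ← Real.rpow_add hx]; congr 1; ring
    rw [abs_mul, abs_mul, abs_of_nonneg (by positivity : 0 ≤ x ^ (q - 4)), e]
    have h3 : |a| * |b| ≤ (x * y) * (x * z) := mul_le_mul ha hb (abs_nonneg _) (by positivity)
    calc x ^ (q - 4) * |a| * |b| = x ^ (q - 4) * (|a| * |b|) := by ring
      _ ≤ x ^ (q - 4) * ((x * y) * (x * z)) := by gcongr
      _ = _ := by ring

lemma norm_tripleWedge_le {Y : CurveTriple n} {S : ℝ} (hA : ‖Y.1‖ ≤ S) : ‖tripleWedge Y‖ ≤ S * ‖Y.2.2‖ :=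
  (norm_wedgeMap_le _ _).trans (by gcongr)

lemma norm_tripleWedge₂_le {Y Z : CurveTriple n} {S s : ℝ} (hA : ‖Y.1‖ ≤ S) (hZ : ‖Z.1‖ ≤ s) :
    ‖tripleWedge₂ Y Z‖ ≤ s * ‖Y.2.2‖ + S * ‖Z.2.2‖ :=
  (norm_add_le _ _).trans (add_le_add ((norm_wedgeMap_le _ _).trans (by gcongr))
    ((norm_wedgeMap_le _ _).trans (by gcongr)))

variable {q S β : ℝ}

/-- The common factor in the bounds for the integrand and its derivatives. -/
def tripleConst (q S β : ℝ) : ℝ := S ^ (q - 2) * (β ^ 2) ^ (-q) * S ^ 2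

lemma tripleConst_nonneg (hS : 0 ≤ S) : 0 ≤ tripleConst q S β := by unfold tripleConst; positivity

lemma normSq_rpow_neg_le {B : EuclideanSpace ℝ (Fin n)} (hq : 2 < q) (hβ : 0 < β) (hB : β ≤ ‖B‖) :
    (‖B‖ ^ 2) ^ (-q) ≤ (β ^ 2) ^ (-q) :=
  Real.rpow_le_rpow_of_nonpos (by positivity) (by gcongr) (by linarith)

lemma rpow_norm_tripleWedge_le {Y : CurveTriple n} (hq : 2 < q) (hS : 0 ≤ S) (hA : ‖Y.1‖ ≤ S) :
    ‖tripleWedge Y‖ ^ (q - 2) ≤ S ^ (q - 2) * ‖Y.2.2‖ ^ (q - 2) := by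
  rw [← Real.mul_rpow hS (norm_nonneg _)]
  exact Real.rpow_le_rpow (norm_nonneg _) (norm_tripleWedge_le hA) (by linarith)

lemma abs_tripleDensity_le {Y : CurveTriple n} (hq : 2 < q) (hS : 0 ≤ S) (hβ : 0 < β) (hA : ‖Y.1‖ ≤ S)
    (hB : β ≤ ‖Y.2.1‖) : |tripleDensity q Y| ≤ tripleConst q S β * ‖Y.2.2‖ ^ q := by
  unfold tripleDensity tripleConst
  rw [abs_of_nonneg (by positivity), rpow_eq_rpow_sub_two_mul_sq (norm_nonneg _) hq,
    rpow_eq_rpow_sub_two_mul_sq (norm_nonneg Y.2.2) hq]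
  have h1 := rpow_norm_tripleWedge_le hq hS hA
  have h2 := normSq_rpow_neg_le hq hβ hB
  have h3 := norm_tripleWedge_le hA
  calc ‖tripleWedge Y‖ ^ (q - 2) * ‖tripleWedge Y‖ ^ 2 * (‖Y.2.1‖ ^ 2) ^ (-q)
      ≤ (S ^ (q - 2) * ‖Y.2.2‖ ^ (q - 2)) * (S * ‖Y.2.2‖) ^ 2 * (β ^ 2) ^ (-q) := by gcongr
    _ = _ := by ring

/-- After factoring out `‖A ∧ C‖^(q-2) ‖B‖^(-2q)`, two factors remain, at least one of size `S‖C‖`.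
The other involves the direction through `s‖C‖ + ‖Z.2.2‖`, and differentiating `B` costs `s / β`.
The assumption `S ≥ 1` merges the different powers of `S`. -/
lemma abs_tripleDensity₁_le {Y Z : CurveTriple n} {s : ℝ} (hq : 2 < q) (hS : 1 ≤ S) (hβ : 0 < β) (hA : ‖Y.1‖ ≤ S)
    (hB : β ≤ ‖Y.2.1‖) (hZA : ‖Z.1‖ ≤ s) (hZB : ‖Z.2.1‖ ≤ s) :
    |tripleDensity₁ q Y Z| ≤ tripleConst q S β * (q + 2 * q / β) *
      (‖Y.2.2‖ ^ (q - 2) * ‖Y.2.2‖ * (s * ‖Y.2.2‖ + ‖Z.2.2‖)) := by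
  have hS0 : 0 ≤ S := by linarith
  have hs : 0 ≤ s := (norm_nonneg _).trans hZA
  have hBpos : 0 < ‖Y.2.1‖ := hβ.trans_le hB
  unfold tripleDensity₁
  rw [rpow_eq_rpow_sub_two_mul_sq (norm_nonneg (tripleWedge Y)) hq, Real.rpow_sub_one (by positivity)]
  have h1 := rpow_norm_tripleWedge_le hq hS0 hA
  have h2 := normSq_rpow_neg_le hq hβ hB
  have hx := norm_tripleWedge_le hA
  have hx1 : ‖tripleWedge₂ Y Z‖ ≤ S * (s * ‖Y.2.2‖ + ‖Z.2.2‖) := (norm_tripleWedge₂_le hA hZA).trans (by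
    have : s * ‖Y.2.2‖ ≤ S * (s * ‖Y.2.2‖) := le_mul_of_one_le_left (by positivity) hS
    linarith)
  have ht : |inner ℝ Y.2.1 Z.2.1 / ‖Y.2.1‖ ^ 2| ≤ s / β := by
    rw [abs_div, abs_of_pos (by positivity : 0 < ‖Y.2.1‖ ^ 2), div_le_div_iff₀ (by positivity) hβ]
    calc |inner ℝ Y.2.1 Z.2.1| * β ≤ (‖Y.2.1‖ * ‖Z.2.1‖) * ‖Y.2.1‖ := by
          gcongr; exact abs_real_inner_le_norm _ _
      _ ≤ (‖Y.2.1‖ * s) * ‖Y.2.1‖ := by gcongr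
      _ = _ := by ring
  have hi := abs_real_inner_le_norm (tripleWedge Y) (tripleWedge₂ Y Z)
  set x := ‖tripleWedge Y‖
  set g := ‖Y.2.2‖
  set m := s * g + ‖Z.2.2‖
  set t := inner ℝ Y.2.1 Z.2.1 / ‖Y.2.1‖ ^ 2 with ht_def
  set i := inner ℝ (tripleWedge Y) (tripleWedge₂ Y Z)
  have hg : 0 ≤ g := norm_nonneg _
  have hm : 0 ≤ m := by positivity
  have hgm : s * g ≤ m := by have := norm_nonneg Z.2.2; simp only [m]; linarith
  have hi' : |i| ≤ S ^ 2 * (g * m) := hi.trans (by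
    calc x * ‖tripleWedge₂ Y Z‖ ≤ (S * g) * (S * m) := by gcongr
      _ = _ := by ring)
  have ht' : |x ^ 2 * t| ≤ S ^ 2 * (g * m) / β := by
    rw [abs_mul, abs_of_nonneg (by positivity : 0 ≤ x ^ 2)]
    calc x ^ 2 * |t| ≤ (S * g) ^ 2 * (s / β) := by gcongr
      _ = S ^ 2 * (g * (s * g)) / β := by ring
      _ ≤ _ := by gcongr
  have e : q * (x ^ (q - 2) * i) * (‖Y.2.1‖ ^ 2) ^ (-q) - 2 * q * (x ^ (q - 2) * x ^ 2) * inner ℝ Y.2.1 Z.2.1 *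
      ((‖Y.2.1‖ ^ 2) ^ (-q) / ‖Y.2.1‖ ^ 2) =
      (x ^ (q - 2) * (‖Y.2.1‖ ^ 2) ^ (-q)) * (q * i - 2 * q * (x ^ 2 * t)) := by
    rw [ht_def]; ring
  rw [e, abs_mul, abs_of_nonneg (by positivity : 0 ≤ x ^ (q - 2) * (‖Y.2.1‖ ^ 2) ^ (-q))]
  have hbr : |q * i - 2 * q * (x ^ 2 * t)| ≤ S ^ 2 * (g * m) * (q + 2 * q / β) := by
    refine (abs_sub _ _).trans ?_
    rw [abs_mul q, abs_mul (2 * q), abs_of_pos (by linarith : 0 < q), abs_of_pos (by linarith : 0 < 2 * q)]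
    calc q * |i| + 2 * q * |x ^ 2 * t| ≤ q * (S ^ 2 * (g * m)) + 2 * q * (S ^ 2 * (g * m) / β) := by gcongr
      _ = _ := by ring
  calc x ^ (q - 2) * (‖Y.2.1‖ ^ 2) ^ (-q) * |q * i - 2 * q * (x ^ 2 * t)|
      ≤ (S ^ (q - 2) * g ^ (q - 2)) * (β ^ 2) ^ (-q) * (S ^ 2 * (g * m) * (q + 2 * q / β)) := by
        gcongr
    _ = _ := by unfold tripleConst; ring

/-- The polynomial factor in the bound for the second derivative. -/
def tripleConst₂ (q β : ℝ) : ℝ :=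
  q * (q + 1) + 4 * q ^ 2 / β + 2 * q / β ^ 2 + 4 * q * (q + 1) / β ^ 2

lemma abs_combination_le {q β P Q j k a b c d f : ℝ} (hq : 2 < q) (hP : 0 ≤ P)
    (hj : |j| ≤ Q) (hk : |k| ≤ 2 * Q) (ha : |a| ≤ Q / β) (hb : |b| ≤ Q / β) (hc : |c| ≤ Q / β ^ 2)
    (hd : |d| ≤ Q / β ^ 2) (hf : |f| ≤ P * Q) :
    |P * (q * j + q * k - 2 * q ^ 2 * a - 2 * q ^ 2 * b - 2 * q * c + 4 * q * (q + 1) * d) + q * (q - 2) * f| ≤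
      P * (Q * tripleConst₂ q β) := by
  have hq0 : 0 < q := by linarith
  have scale : ∀ {r y Y : ℝ}, 0 ≤ r → |y| ≤ Y → |r * y| ≤ r * Y := fun hr hy => by
    rw [abs_mul, abs_of_nonneg hr]; exact mul_le_mul_of_nonneg_left hy hr
  have a1 := abs_le.1 (scale hq0.le hj)
  have a2 := abs_le.1 (scale hq0.le hk)
  have a3 := abs_le.1 (scale (by positivity : 0 ≤ 2 * q ^ 2) ha)
  have a4 := abs_le.1 (scale (by positivity : 0 ≤ 2 * q ^ 2) hb)
  have a5 := abs_le.1 (scale (by positivity : 0 ≤ 2 * q) hc)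
  have a6 := abs_le.1 (scale (by positivity : 0 ≤ 4 * q * (q + 1)) hd)
  have a7 := scale (mul_nonneg hq0.le (by linarith) : 0 ≤ q * (q - 2)) hf
  have hbr : |q * j + q * k - 2 * q ^ 2 * a - 2 * q ^ 2 * b - 2 * q * c + 4 * q * (q + 1) * d| ≤
      q * Q + q * (2 * Q) + 2 * q ^ 2 * (Q / β) + 2 * q ^ 2 * (Q / β) + 2 * q * (Q / β ^ 2)
        + 4 * q * (q + 1) * (Q / β ^ 2) := by
    rw [abs_le]
    constructor <;> linarith [a1.1, a2.1, a3.1, a4.1, a5.1, a6.1, a1.2, a2.2, a3.2, a4.2, a5.2, a6.2]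
  refine (abs_add_le _ _).trans ((add_le_add (scale hP hbr) a7).trans (le_of_eq ?_))
  unfold tripleConst₂; ring

/-- The scalar core of the second-derivative bound. The letters `x, X₁, X₂, X₁₂` stand for norms of
wedges, `t₁, t₂, t₁₂` for normalised inner products of chords, and `f` for the term with exponent `q
- 4`. Every product is dominated by a multiple of `Q = S² (sg + z)(rg + w)`, with a power of `1/β`
for derivatives falling on the chord. -/
lemma abs_secondVariation_le {q S β g z w s r x X₁ X₂ X₁₂ i₁ i₂ i₁₂ j₁₂ t₁ t₂ t₁₂ P f : ℝ} (hq : 2 < q)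
    (hS : 1 ≤ S) (hβ : 0 < β) (hs : 0 ≤ s) (hr : 0 ≤ r) (hg : 0 ≤ g) (hz : 0 ≤ z) (hw : 0 ≤ w)
    (hx0 : 0 ≤ x) (hP0 : 0 ≤ P) (hX₁ : 0 ≤ X₁) (hX₂ : 0 ≤ X₂)
    (hx : x ≤ S * g) (hx1 : X₁ ≤ S * (s * g + z)) (hx2 : X₂ ≤ S * (r * g + w))
    (hx12 : X₁₂ ≤ s * w + r * z) (ht1 : |t₁| ≤ s / β) (ht2 : |t₂| ≤ r / β) (ht12 : |t₁₂| ≤ s * r / β ^ 2)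
    (hi1 : |i₁| ≤ x * X₁) (hi2 : |i₂| ≤ x * X₂) (hi12 : |i₁₂| ≤ x * X₁₂) (hj12 : |j₁₂| ≤ X₂ * X₁)
    (hfour : |f| ≤ P * (X₂ * X₁)) :
    |P * (q * j₁₂ + q * i₁₂ - 2 * q ^ 2 * (i₁ * t₂) - 2 * q ^ 2 * (i₂ * t₁) - 2 * q * (x ^ 2 * t₁₂)
          + 4 * q * (q + 1) * (x ^ 2 * (t₁ * t₂))) + q * (q - 2) * f| ≤
      P * (S ^ 2 * ((s * g + z) * (r * g + w)) * tripleConst₂ q β) := by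
  have hS0 : 0 ≤ S := by linarith
  set m₁ := s * g + z with hm₁
  set m₂ := r * g + w with hm₂
  have hm₁0 : 0 ≤ m₁ := by positivity
  have hm₂0 : 0 ≤ m₂ := by positivity
  have hgm₁ : s * g ≤ m₁ := by linarith
  have hgm₂ : r * g ≤ m₂ := by linarith
  have hzm₁ : z ≤ m₁ := le_add_of_nonneg_left (by positivity)
  have hwm₂ : w ≤ m₂ := le_add_of_nonneg_left (by positivity)
  set Q := S ^ 2 * (m₁ * m₂) with hQ
  have hQ0 : 0 ≤ Q := by positivity
  have k1 : |j₁₂| ≤ Q := hj12.trans (by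
    calc _ ≤ (S * m₂) * (S * m₁) := by gcongr
      _ = _ := by ring)
  have k2 : X₂ * X₁ ≤ Q := by
    calc _ ≤ (S * m₂) * (S * m₁) := by gcongr
      _ = _ := by ring
  have k3 : |i₁₂| ≤ 2 * Q := hi12.trans (by
    calc x * X₁₂ ≤ x * (s * w + r * z) := by gcongr
      _ ≤ (S * g) * (s * w + r * z) := by gcongr
      _ = S * ((s * g) * w + z * (r * g)) := by ring
      _ ≤ S * (m₁ * m₂ + m₁ * m₂) := by gcongr
      _ ≤ S ^ 2 * (m₁ * m₂ + m₁ * m₂) := by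
        have : S ≤ S ^ 2 := by nlinarith
        gcongr
      _ = _ := by ring)
  have k4 : |i₁ * t₂| ≤ Q / β := by
    rw [abs_mul]
    calc |i₁| * |t₂| ≤ ((S * g) * (S * m₁)) * (r / β) := by
          gcongr; exact hi1.trans (by gcongr)
      _ = S ^ 2 * (m₁ * (r * g)) / β := by ring
      _ ≤ _ := by rw [hQ]; gcongr
  have k5 : |i₂ * t₁| ≤ Q / β := by
    rw [abs_mul]
    calc |i₂| * |t₁| ≤ ((S * g) * (S * m₂)) * (s / β) := by
          gcongr; exact hi2.trans (by gcongr)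
      _ = S ^ 2 * ((s * g) * m₂) / β := by ring
      _ ≤ _ := by rw [hQ]; gcongr
  have k67 : x ^ 2 * (s * r / β ^ 2) ≤ Q / β ^ 2 := by
    calc x ^ 2 * (s * r / β ^ 2) ≤ (S * g) ^ 2 * (s * r / β ^ 2) := by gcongr
      _ = S ^ 2 * ((s * g) * (r * g)) / β ^ 2 := by ring
      _ ≤ _ := by rw [hQ]; gcongr
  have k6 : |x ^ 2 * t₁₂| ≤ Q / β ^ 2 := by
    rw [abs_mul, abs_of_nonneg (by positivity : 0 ≤ x ^ 2)]
    exact le_trans (by gcongr) k67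
  have k7 : |x ^ 2 * (t₁ * t₂)| ≤ Q / β ^ 2 := by
    rw [abs_mul, abs_mul, abs_of_nonneg (by positivity : 0 ≤ x ^ 2)]
    refine le_trans ?_ k67
    gcongr
    calc |t₁| * |t₂| ≤ (s / β) * (r / β) := by gcongr
      _ = _ := by field_simp
  exact abs_combination_le hq hP0 k1 k3 k4 k5 k6 k7 (hfour.trans (by gcongr))

lemma abs_tripleDensity₂_le {Y Z W : CurveTriple n} {s r : ℝ} (hq : 2 < q) (hS : 1 ≤ S) (hβ : 0 < β)
    (hA : ‖Y.1‖ ≤ S) (hB : β ≤ ‖Y.2.1‖) (hZA : ‖Z.1‖ ≤ s) (hZB : ‖Z.2.1‖ ≤ s) (hWA : ‖W.1‖ ≤ r)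
    (hWB : ‖W.2.1‖ ≤ r) :
    |tripleDensity₂ q Y Z W| ≤ tripleConst q S β * tripleConst₂ q β *
      (‖Y.2.2‖ ^ (q - 2) * (s * ‖Y.2.2‖ + ‖Z.2.2‖) * (r * ‖Y.2.2‖ + ‖W.2.2‖)) := by
  have hS0 : 0 ≤ S := by linarith
  have hs : 0 ≤ s := (norm_nonneg _).trans hZA
  have hr : 0 ≤ r := (norm_nonneg _).trans hWA
  have hBpos : 0 < ‖Y.2.1‖ := hβ.trans_le hB
  unfold tripleDensity₂
  have hb0 : ‖Y.2.1‖ ^ 2 ≠ 0 := by positivity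
  rw [rpow_eq_rpow_sub_two_mul_sq (norm_nonneg (tripleWedge Y)) hq, show -q - 2 = -q - 1 - 1 by ring,
    Real.rpow_sub_one hb0, Real.rpow_sub_one hb0, Real.rpow_sub_one hb0]
  have h1 := rpow_norm_tripleWedge_le hq hS0 hA
  have h2 := normSq_rpow_neg_le hq hβ hB
  have hx := norm_tripleWedge_le hA
  have aux : ∀ {V : CurveTriple n} {s : ℝ}, 0 ≤ s → ‖V.1‖ ≤ s →
      ‖tripleWedge₂ Y V‖ ≤ S * (s * ‖Y.2.2‖ + ‖V.2.2‖) := fun {V s} hs hV =>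
    (norm_tripleWedge₂_le hA hV).trans (by
      have : s * ‖Y.2.2‖ ≤ S * (s * ‖Y.2.2‖) := le_mul_of_one_le_left (by positivity) hS
      linarith)
  have hx1 := aux hs hZA
  have hx2 := aux hr hWA
  have hx12 : ‖tripleWedge₂ W Z‖ ≤ s * ‖W.2.2‖ + r * ‖Z.2.2‖ := norm_tripleWedge₂_le hWA hZA
  have haux2 : ∀ {V : CurveTriple n} {s : ℝ}, 0 ≤ s → ‖V.2.1‖ ≤ s → |inner ℝ Y.2.1 V.2.1 / ‖Y.2.1‖ ^ 2| ≤ s / β := by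
    intro V s hs hV
    rw [abs_div, abs_of_pos (by positivity : 0 < ‖Y.2.1‖ ^ 2), div_le_div_iff₀ (by positivity) hβ]
    calc |inner ℝ Y.2.1 V.2.1| * β ≤ (‖Y.2.1‖ * ‖V.2.1‖) * ‖Y.2.1‖ := by
          gcongr; exact abs_real_inner_le_norm _ _
      _ ≤ (‖Y.2.1‖ * s) * ‖Y.2.1‖ := by gcongr
      _ = _ := by ring
  have ht1 := haux2 hs hZB
  have ht2 := haux2 hr hWB
  have ht12 : |inner ℝ W.2.1 Z.2.1 / ‖Y.2.1‖ ^ 2| ≤ s * r / β ^ 2 := by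
    rw [abs_div, abs_of_pos (by positivity : 0 < ‖Y.2.1‖ ^ 2)]
    gcongr
    refine (abs_real_inner_le_norm _ _).trans ?_
    rw [mul_comm s r]; gcongr
  have hi1 := abs_real_inner_le_norm (tripleWedge Y) (tripleWedge₂ Y Z)
  have hi2 := abs_real_inner_le_norm (tripleWedge Y) (tripleWedge₂ Y W)
  have hi12 := abs_real_inner_le_norm (tripleWedge Y) (tripleWedge₂ W Z)
  have hj12 := abs_real_inner_le_norm (tripleWedge₂ Y W) (tripleWedge₂ Y Z)
  have hfour := rpow_sub_four_mul_le (norm_nonneg _) hq hi2 hi1 (norm_nonneg _)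
  have hg : 0 ≤ ‖Y.2.2‖ := norm_nonneg _
  have htot := abs_secondVariation_le (t₁₂ := inner ℝ W.2.1 Z.2.1 / ‖Y.2.1‖ ^ 2) hq hS hβ hs hr hg (norm_nonneg _)
    (norm_nonneg _) (norm_nonneg _) (by positivity) (norm_nonneg _) (norm_nonneg _) hx hx1 hx2 hx12 ht1 ht2 ht12
    hi1 hi2 hi12 hj12 hfour
  have hD0 : 0 ≤ (‖Y.2.1‖ ^ 2) ^ (-q) := by positivity
  have hC2 : 0 ≤ tripleConst₂ q β := by
    have : 0 < q := by linarith
    unfold tripleConst₂; positivity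
  calc _ ≤ (‖Y.2.1‖ ^ 2) ^ (-q) * (‖tripleWedge Y‖ ^ (q - 2) *
        (S ^ 2 * ((s * ‖Y.2.2‖ + ‖Z.2.2‖) * (r * ‖Y.2.2‖ + ‖W.2.2‖)) * tripleConst₂ q β)) := by
        refine le_trans (le_of_eq ?_) (mul_le_mul_of_nonneg_left htot hD0)
        rw [← abs_of_nonneg hD0, ← abs_mul, abs_of_nonneg hD0]
        congr 1
        ring
    _ ≤ (β ^ 2) ^ (-q) * ((S ^ (q - 2) * ‖Y.2.2‖ ^ (q - 2)) *
        (S ^ 2 * ((s * ‖Y.2.2‖ + ‖Z.2.2‖) * (r * ‖Y.2.2‖ + ‖W.2.2‖)) * tripleConst₂ q β)) := by gcongr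
    _ = _ := by unfold tripleConst; ring

end Bounds

/-! ### Young-type inequalities -/

section Young

variable {q a b c : ℝ}

lemma add_rpow_le_two_rpow_mul (hq : 0 ≤ q) (ha : 0 ≤ a) (hb : 0 ≤ b) : (a + b) ^ q ≤ 2 ^ q * (a ^ q + b ^ q) := by
  have h : a + b ≤ 2 * max a b := by linarith [le_max_left a b, le_max_right a b]
  calc (a + b) ^ q ≤ (2 * max a b) ^ q := Real.rpow_le_rpow (by positivity) h hq
    _ = 2 ^ q * max a b ^ q := Real.mul_rpow (by norm_num) (by positivity)
    _ ≤ _ := by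
      gcongr
      have := Real.rpow_nonneg ha q
      have := Real.rpow_nonneg hb q
      rcases max_cases a b with h | h <;> rw [h.1] <;> linarith

/-- The exponents add up to `q`, so the product is at most the `q`-th power of the largest of the
three numbers. -/
lemma rpow_sub_two_mul_mul_le (hq : 2 < q) (ha : 0 ≤ a) (hb : 0 ≤ b) (hc : 0 ≤ c) :
    a ^ (q - 2) * b * c ≤ a ^ q + b ^ q + c ^ q := by
  have hA := Real.rpow_nonneg ha q
  have hB := Real.rpow_nonneg hb q
  have hC := Real.rpow_nonneg hc q
  obtain ⟨m, hm, ham, hbm, hcm⟩ : ∃ m, (m = a ∨ m = b ∨ m = c) ∧ a ≤ m ∧ b ≤ m ∧ c ≤ m := by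
    rcases le_total a b with h1 | h1 <;> rcases le_total b c with h2 | h2 <;> rcases le_total a c with h3 | h3
    · exact ⟨c, by simp, h3, h2, le_rfl⟩
    · exact ⟨c, by simp, h1.trans h2, h2, le_rfl⟩
    · exact ⟨b, by simp, h1, le_rfl, h2⟩
    · exact ⟨b, by simp, h1, le_rfl, h2⟩
    · exact ⟨c, by simp, h3, h2, le_rfl⟩
    · exact ⟨a, by simp, le_rfl, h1, h3⟩
    · exact ⟨a, by simp, le_rfl, h1, h2.trans h1⟩
    · exact ⟨a, by simp, le_rfl, h1, h3⟩
  have hm0 : 0 ≤ m := ha.trans ham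
  calc a ^ (q - 2) * b * c ≤ m ^ (q - 2) * m * m := by
        gcongr
    _ = m ^ q := by rw [rpow_eq_rpow_sub_two_mul_sq hm0 hq]; ring
    _ ≤ _ := by rcases hm with rfl | rfl | rfl <;> linarith

end Young

/-! ### Differentiation under the integral for fields of triples -/

section Abstract

variable {n : ℕ} {Ω : Type*} [MeasurableSpace Ω] {μ : Measure Ω} {q S s r β : ℝ} {Y Z W : Ω → CurveTriple n}

/-- A measurable field of triples with bounded first components and last component in `L^q`. -/
structure LqTriple (μ : Measure Ω) (q S : ℝ) (Y : Ω → CurveTriple n) : Prop where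
  measurable : Measurable Y
  norm_fst_le : ∀ x, ‖(Y x).1‖ ≤ S
  norm_mid_le : ∀ x, ‖(Y x).2.1‖ ≤ S
  integrable : Integrable (fun x => ‖(Y x).2.2‖ ^ q) μ

lemma measurable_wedgeMap {f g : Ω → EuclideanSpace ℝ (Fin n)} (hf : Measurable f) (hg : Measurable g) :
    Measurable fun x => wedgeMap n (f x) (g x) := by
  have h : Continuous fun p : EuclideanSpace ℝ (Fin n) × EuclideanSpace ℝ (Fin n) => wedgeMap n p.1 p.2 := by fun_prop
  exact h.measurable.comp (hf.prodMk hg)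

lemma measurable_tripleWedge_comp (hY : Measurable Y) : Measurable fun x => tripleWedge (Y x) :=
  measurable_wedgeMap hY.fst hY.snd.snd

lemma measurable_tripleWedge₂_comp (hY : Measurable Y) (hZ : Measurable Z) :
    Measurable fun x => tripleWedge₂ (Y x) (Z x) :=
  (measurable_wedgeMap hZ.fst hY.snd.snd).add (measurable_wedgeMap hY.fst hZ.snd.snd)

lemma integral_add_three {f g h : Ω → ℝ} (hf : Integrable f μ) (hg : Integrable g μ) (hh : Integrable h μ) :
    ∫ x, (f x + g x + h x) ∂μ = ∫ x, f x ∂μ + ∫ x, g x ∂μ + ∫ x, h x ∂μ := by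
  rw [integral_add (f := fun x => f x + g x) (hf.add hg) hh, integral_add hf hg]

lemma measurable_tripleDensity (hY : Measurable Y) : Measurable fun x => tripleDensity q (Y x) := by
  have h1 := measurable_tripleWedge_comp hY
  unfold tripleDensity
  fun_prop

lemma measurable_tripleDensity₁ (hY : Measurable Y) (hZ : Measurable Z) :
    Measurable fun x => tripleDensity₁ q (Y x) (Z x) := by
  have h1 := measurable_tripleWedge_comp hY
  have h2 := measurable_tripleWedge₂_comp hY hZ
  have h3 := h1.inner (𝕜 := ℝ) h2
  have h4 := hY.snd.fst.inner (𝕜 := ℝ) hZ.snd.fst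
  unfold tripleDensity₁
  fun_prop

lemma measurable_tripleDensity₂ (hY : Measurable Y) (hZ : Measurable Z) (hW : Measurable W) :
    Measurable fun x => tripleDensity₂ q (Y x) (Z x) (W x) := by
  have h1 := measurable_tripleWedge_comp hY
  have h2 := measurable_tripleWedge₂_comp hY hZ
  have h3 := measurable_tripleWedge₂_comp hY hW
  have h4 := measurable_tripleWedge₂_comp hW hZ
  have i1 := h1.inner (𝕜 := ℝ) h2
  have i2 := h1.inner (𝕜 := ℝ) h3
  have i3 := h1.inner (𝕜 := ℝ) h4
  have i4 := h3.inner (𝕜 := ℝ) h2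
  have i5 := hY.snd.fst.inner (𝕜 := ℝ) hZ.snd.fst
  have i6 := hY.snd.fst.inner (𝕜 := ℝ) hW.snd.fst
  have i7 := hW.snd.fst.inner (𝕜 := ℝ) hZ.snd.fst
  unfold tripleDensity₂
  fun_prop

lemma LqTriple.measurable_norm (hY : LqTriple μ q S Y) : Measurable fun x => ‖(Y x).2.2‖ :=
  hY.measurable.snd.snd.norm

lemma LqTriple.nonneg [Nonempty Ω] (hY : LqTriple μ q S Y) : 0 ≤ S :=
  (norm_nonneg _).trans (hY.norm_fst_le (Classical.arbitrary Ω))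

lemma integrable_add_rpow (hq : 0 ≤ q) {f g : Ω → ℝ} (hf : Measurable f) (hg : Measurable g) (hf0 : ∀ x, 0 ≤ f x)
    (hg0 : ∀ x, 0 ≤ g x) (hfi : Integrable (fun x => f x ^ q) μ) (hgi : Integrable (fun x => g x ^ q) μ) :
    Integrable (fun x => (f x + g x) ^ q) μ := by
  refine Integrable.mono' ((hfi.add hgi).const_mul (2 ^ q)) ((hf.add hg).pow_const q).aestronglyMeasurable
    (Eventually.of_forall fun x => ?_)
  rw [Real.norm_of_nonneg (Real.rpow_nonneg (add_nonneg (hf0 x) (hg0 x)) q)]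
  exact add_rpow_le_two_rpow_mul hq (hf0 x) (hg0 x)

lemma integrable_mul_rpow {c : ℝ} (hc : 0 ≤ c) {f : Ω → ℝ} (hf0 : ∀ x, 0 ≤ f x)
    (hfi : Integrable (fun x => f x ^ q) μ) : Integrable (fun x => (c * f x) ^ q) μ := by
  refine (hfi.const_mul (c ^ q)).congr (Eventually.of_forall fun x => ?_)
  exact (Real.mul_rpow hc (hf0 x)).symm

lemma LqTriple.integrable_tripleDensity [Nonempty Ω] (hq : 2 < q) (hβ : 0 < β) (hY : LqTriple μ q S Y)
    (hB : ∀ᵐ x ∂μ, β ≤ ‖(Y x).2.1‖) : Integrable (fun x => tripleDensity q (Y x)) μ := by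
  refine Integrable.mono' (hY.integrable.const_mul (tripleConst q S β))
    (measurable_tripleDensity hY.measurable).aestronglyMeasurable ?_
  filter_upwards [hB] with x hx
  exact abs_tripleDensity_le hq hY.nonneg hβ (hY.norm_fst_le x) hx

/-- Differentiation data along a segment of triples. -/
lemma triple_segment_bounds {Y Z : CurveTriple n} {τ : ℝ} (hs : 0 ≤ s)
    (hτ : |τ| ≤ min 1 (β / (2 * (s + 1)))) (hA : ‖Y.1‖ ≤ S) (hB : β ≤ ‖Y.2.1‖) (hZA : ‖Z.1‖ ≤ s)
    (hZB : ‖Z.2.1‖ ≤ s) :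
    ‖(Y + τ • Z).1‖ ≤ S + s ∧ β / 2 ≤ ‖(Y + τ • Z).2.1‖ ∧ ‖(Y + τ • Z).2.2‖ ≤ ‖Y.2.2‖ + ‖Z.2.2‖ := by
  have h1 : |τ| ≤ 1 := hτ.trans (min_le_left _ _)
  have h2 : |τ| * (2 * (s + 1)) ≤ β := by
    have := hτ.trans (min_le_right _ _)
    rwa [le_div_iff₀ (by positivity)] at this
  have hτ0 := abs_nonneg τ
  simp only [Prod.fst_add, Prod.snd_add, Prod.smul_fst, Prod.smul_snd]
  refine ⟨?_, ?_, ?_⟩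
  · refine (norm_add_le _ _).trans ?_
    rw [norm_smul, Real.norm_eq_abs]
    nlinarith [norm_nonneg Z.1]
  · have h3 : ‖τ • Z.2.1‖ ≤ β / 2 := by
      rw [norm_smul, Real.norm_eq_abs]
      nlinarith [norm_nonneg Z.2.1]
    have h4 := norm_sub_norm_le Y.2.1 (-(τ • Z.2.1))
    rw [norm_neg, sub_neg_eq_add] at h4
    linarith
  · refine (norm_add_le _ _).trans ?_
    rw [norm_smul, Real.norm_eq_abs]
    nlinarith [norm_nonneg Z.2.2]

lemma step_mem_nhds (hs : 0 ≤ s) (hβ : 0 < β) : {τ : ℝ | |τ| ≤ min 1 (β / (2 * (s + 1)))} ∈ 𝓝 (0 : ℝ) := by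
  have h : 0 < min 1 (β / (2 * (s + 1))) := by positivity
  filter_upwards [Metric.ball_mem_nhds (0 : ℝ) h] with τ hτ
  rw [Metric.mem_ball, dist_zero_right] at hτ
  exact hτ.le

/-- For small steps the bounds hold along the whole segment with `S + s` and `β / 2`. The pointwise
estimate and Young's inequality then give an integrable majorant independent of `τ`. -/
lemma hasDerivAt_integral_tripleDensity [Nonempty Ω] (hq : 2 < q) (hβ : 0 < β) (hS : 1 ≤ S)
    (hY : LqTriple μ q S Y) (hZ : LqTriple μ q s Z) (hB : ∀ᵐ x ∂μ, β ≤ ‖(Y x).2.1‖) :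
    Integrable (fun x => tripleDensity₁ q (Y x) (Z x)) μ ∧
    HasDerivAt (fun τ : ℝ => ∫ x, tripleDensity q (Y x + τ • Z x) ∂μ) (∫ x, tripleDensity₁ q (Y x) (Z x) ∂μ) 0 := by
  have hs := hZ.nonneg
  have hq0 : 0 < q := by linarith
  set C := tripleConst q (S + s) (β / 2) * (q + 2 * q / (β / 2)) with hC
  have hC0 : 0 ≤ C := mul_nonneg (tripleConst_nonneg (by linarith)) (by positivity)
  have hĝ : Integrable (fun x => (‖(Y x).2.2‖ + ‖(Z x).2.2‖) ^ q) μ :=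
    integrable_add_rpow hq0.le hY.measurable_norm hZ.measurable_norm (fun _ => norm_nonneg _)
      (fun _ => norm_nonneg _) hY.integrable hZ.integrable
  have hm : Integrable (fun x => (s * (‖(Y x).2.2‖ + ‖(Z x).2.2‖) + ‖(Z x).2.2‖) ^ q) μ :=
    integrable_add_rpow hq0.le ((hY.measurable_norm.add hZ.measurable_norm).const_mul s) hZ.measurable_norm
      (fun _ => by positivity) (fun _ => norm_nonneg _)
      (integrable_mul_rpow hs (fun _ => by positivity) hĝ) hZ.integrable
  have hmeas : ∀ τ : ℝ, Measurable fun x => Y x + τ • Z x := fun τ =>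
    hY.measurable.add (hZ.measurable.const_smul τ)
  have h := hasDerivAt_integral_of_dominated_loc_of_deriv_le (μ := μ)
    (F := fun (τ : ℝ) x => tripleDensity q (Y x + τ • Z x))
    (F' := fun (τ : ℝ) x => tripleDensity₁ q (Y x + τ • Z x) (Z x)) (x₀ := 0)
    (bound := fun x => C * ((‖(Y x).2.2‖ + ‖(Z x).2.2‖) ^ q + (‖(Y x).2.2‖ + ‖(Z x).2.2‖) ^ q +
      (s * (‖(Y x).2.2‖ + ‖(Z x).2.2‖) + ‖(Z x).2.2‖) ^ q))
    (step_mem_nhds hs hβ)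
    (Eventually.of_forall fun τ => (measurable_tripleDensity (hmeas τ)).aestronglyMeasurable)
    (by simpa using hY.integrable_tripleDensity hq hβ hB)
    (measurable_tripleDensity₁ (hmeas 0) hZ.measurable).aestronglyMeasurable
    ?_ (((hĝ.add hĝ).add hm).const_mul C) ?_
  · simpa using h
  · filter_upwards [hB] with x hx τ hτ
    obtain ⟨h1, h2, h3⟩ := triple_segment_bounds hs hτ (hY.norm_fst_le x) hx (hZ.norm_fst_le x) (hZ.norm_mid_le x)
    refine (abs_tripleDensity₁_le hq (by linarith) (half_pos hβ) h1 h2 (hZ.norm_fst_le x) (hZ.norm_mid_le x)).trans ?_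
    rw [← hC]
    refine mul_le_mul_of_nonneg_left ?_ hC0
    refine le_trans ?_ (rpow_sub_two_mul_mul_le hq (by positivity) (by positivity) (by positivity))
    gcongr
  · filter_upwards [hB] with x hx τ hτ
    obtain ⟨-, h2, -⟩ := triple_segment_bounds hs hτ (hY.norm_fst_le x) hx (hZ.norm_fst_le x) (hZ.norm_mid_le x)
    exact hasDerivAt_tripleDensity hq _ _ (norm_pos_iff.1 (by linarith))

lemma hasDerivAt_integral_tripleDensity₁ [Nonempty Ω] (hq : 2 < q) (hβ : 0 < β) (hS : 1 ≤ S)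
    (hY : LqTriple μ q S Y) (hZ : LqTriple μ q s Z) (hW : LqTriple μ q r W) (hB : ∀ᵐ x ∂μ, β ≤ ‖(Y x).2.1‖) :
    Integrable (fun x => tripleDensity₂ q (Y x) (Z x) (W x)) μ ∧
    HasDerivAt (fun σ : ℝ => ∫ x, tripleDensity₁ q (Y x + σ • W x) (Z x) ∂μ)
      (∫ x, tripleDensity₂ q (Y x) (Z x) (W x) ∂μ) 0 := by
  have hs := hZ.nonneg
  have hr := hW.nonneg
  have hq0 : 0 < q := by linarith
  set C := tripleConst q (S + r) (β / 2) * tripleConst₂ q (β / 2) with hC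
  have hC0 : 0 ≤ C := mul_nonneg (tripleConst_nonneg (by linarith)) (by unfold tripleConst₂; positivity)
  have hĝ : Integrable (fun x => (‖(Y x).2.2‖ + ‖(W x).2.2‖) ^ q) μ :=
    integrable_add_rpow hq0.le hY.measurable_norm hW.measurable_norm (fun _ => norm_nonneg _)
      (fun _ => norm_nonneg _) hY.integrable hW.integrable
  have hm : ∀ {V : Ω → CurveTriple n} {s : ℝ}, 0 ≤ s → LqTriple μ q s V →
      Integrable (fun x => (s * (‖(Y x).2.2‖ + ‖(W x).2.2‖) + ‖(V x).2.2‖) ^ q) μ := fun {V s} hs hV =>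
    integrable_add_rpow hq0.le ((hY.measurable_norm.add hW.measurable_norm).const_mul s) hV.measurable_norm
      (fun _ => by positivity) (fun _ => norm_nonneg _)
      (integrable_mul_rpow hs (fun _ => by positivity) hĝ) hV.integrable
  have hmeas : ∀ τ : ℝ, Measurable fun x => Y x + τ • W x := fun τ =>
    hY.measurable.add (hW.measurable.const_smul τ)
  have h := hasDerivAt_integral_of_dominated_loc_of_deriv_le (μ := μ)
    (F := fun (τ : ℝ) x => tripleDensity₁ q (Y x + τ • W x) (Z x))
    (F' := fun (τ : ℝ) x => tripleDensity₂ q (Y x + τ • W x) (Z x) (W x)) (x₀ := 0)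
    (bound := fun x => C * ((‖(Y x).2.2‖ + ‖(W x).2.2‖) ^ q +
      (s * (‖(Y x).2.2‖ + ‖(W x).2.2‖) + ‖(Z x).2.2‖) ^ q +
      (r * (‖(Y x).2.2‖ + ‖(W x).2.2‖) + ‖(W x).2.2‖) ^ q))
    (step_mem_nhds hr hβ)
    (Eventually.of_forall fun τ => (measurable_tripleDensity₁ (hmeas τ) hZ.measurable).aestronglyMeasurable)
    (by simpa using (hasDerivAt_integral_tripleDensity hq hβ hS hY hZ hB).1)
    (measurable_tripleDensity₂ (hmeas 0) hZ.measurable hW.measurable).aestronglyMeasurable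
    ?_ (((hĝ.add (hm hs hZ)).add (hm hr hW)).const_mul C) ?_
  · simpa using h
  · filter_upwards [hB] with x hx τ hτ
    obtain ⟨h1, h2, h3⟩ := triple_segment_bounds hr hτ (hY.norm_fst_le x) hx (hW.norm_fst_le x) (hW.norm_mid_le x)
    refine (abs_tripleDensity₂_le hq (by linarith) (half_pos hβ) h1 h2 (hZ.norm_fst_le x) (hZ.norm_mid_le x)
      (hW.norm_fst_le x) (hW.norm_mid_le x)).trans ?_
    rw [← hC]
    refine mul_le_mul_of_nonneg_left ?_ hC0
    refine le_trans ?_ (rpow_sub_two_mul_mul_le hq (by positivity) (by positivity) (by positivity))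
    gcongr
  · filter_upwards [hB] with x hx τ hτ
    obtain ⟨-, h2, -⟩ := triple_segment_bounds hr hτ (hY.norm_fst_le x) hx (hW.norm_fst_le x) (hW.norm_mid_le x)
    exact hasDerivAt_tripleDensity₁ hq _ _ _ (norm_pos_iff.1 (by linarith))

/-- The scale-free majorant of `(s g + g₁)^q / N^q`, integrated. -/
lemma integral_scaled_rpow_le (hq : 0 < q) {f g : Ω → ℝ} (hf0 : ∀ x, 0 ≤ f x) (hg0 : ∀ x, 0 ≤ g x)
    (hfi : Integrable (fun x => f x ^ q) μ) (hgi : Integrable (fun x => g x ^ q) μ)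
    (hf : Measurable f) (hg : Measurable g) {c N : ℝ} (hc : 0 ≤ c) (hN : 0 < N) (hgN : ∫ x, g x ^ q ∂μ ≤ N ^ q) :
    Integrable (fun x => (c * f x + N⁻¹ * g x) ^ q) μ ∧
    ∫ x, (c * f x + N⁻¹ * g x) ^ q ∂μ ≤ 2 ^ q * (c ^ q * (∫ x, f x ^ q ∂μ) + 1) := by
  have hN' : 0 ≤ N⁻¹ := inv_nonneg.2 hN.le
  have hint : Integrable (fun x => (c * f x + N⁻¹ * g x) ^ q) μ :=
    integrable_add_rpow hq.le (hf.const_mul c) (hg.const_mul _) (fun x => mul_nonneg hc (hf0 x))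
      (fun x => mul_nonneg hN' (hg0 x)) (integrable_mul_rpow hc hf0 hfi) (integrable_mul_rpow hN' hg0 hgi)
  refine ⟨hint, ?_⟩
  have hle : ∫ x, (c * f x + N⁻¹ * g x) ^ q ∂μ ≤ ∫ x, 2 ^ q * (c ^ q * f x ^ q + (N ^ q)⁻¹ * g x ^ q) ∂μ := by
    refine integral_mono hint (((hfi.const_mul _).add (hgi.const_mul _)).const_mul _) fun x => ?_
    refine (add_rpow_le_two_rpow_mul hq.le (mul_nonneg hc (hf0 x)) (mul_nonneg hN' (hg0 x))).trans (le_of_eq ?_)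
    rw [Real.mul_rpow hc (hf0 x), Real.mul_rpow hN' (hg0 x), Real.inv_rpow hN.le]
  refine hle.trans ?_
  rw [integral_const_mul, integral_add (hfi.const_mul _) (hgi.const_mul _), integral_const_mul, integral_const_mul]
  have hNq : 0 < N ^ q := Real.rpow_pos_of_pos hN q
  gcongr
  rw [inv_mul_le_iff₀ hNq, mul_one]
  exact hgN

/-- Young's inequality alone would destroy linearity in `Z`. The factor `N` is therefore taken out
first and Young is applied to `c g + N⁻¹ g_Z`, where `g` and `g_Z` are the norms of the last
components; its `q`-norm is bounded independently of the size of `Z`. -/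
lemma abs_integral_tripleDensity₁_le (hq : 2 < q) (hβ : 0 < β) (hS : 1 ≤ S)
    (hY : LqTriple μ q S Y) (hZ : LqTriple μ q s Z) (hB : ∀ᵐ x ∂μ, β ≤ ‖(Y x).2.1‖) {c N Γ : ℝ} (hc : 0 ≤ c)
    (hN : 0 < N) (hs : s ≤ c * N) (hZN : ∫ x, ‖(Z x).2.2‖ ^ q ∂μ ≤ N ^ q) (hΓ : ∫ x, ‖(Y x).2.2‖ ^ q ∂μ ≤ Γ) :
    |∫ x, tripleDensity₁ q (Y x) (Z x) ∂μ| ≤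
      tripleConst q S β * (q + 2 * q / β) * (2 * Γ + 2 ^ q * (c ^ q * Γ + 1)) * N := by
  have hq0 : 0 < q := by linarith
  set C := tripleConst q S β * (q + 2 * q / β) with hC
  have hC0 : 0 ≤ C := mul_nonneg (tripleConst_nonneg (by linarith)) (by positivity)
  obtain ⟨i1, i2⟩ := integral_scaled_rpow_le hq0 (fun x => norm_nonneg (Y x).2.2) (fun x => norm_nonneg (Z x).2.2)
    hY.integrable hZ.integrable hY.measurable_norm hZ.measurable_norm hc hN hZN
  have hbd : |∫ x, tripleDensity₁ q (Y x) (Z x) ∂μ| ≤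
      ∫ x, C * N * (‖(Y x).2.2‖ ^ q + ‖(Y x).2.2‖ ^ q + (c * ‖(Y x).2.2‖ + N⁻¹ * ‖(Z x).2.2‖) ^ q) ∂μ := by
    rw [← Real.norm_eq_abs]
    refine norm_integral_le_of_norm_le (((hY.integrable.add hY.integrable).add i1).const_mul _) ?_
    filter_upwards [hB] with x hx
    have hZA := (hZ.norm_fst_le x).trans hs
    have hZB := (hZ.norm_mid_le x).trans hs
    refine (abs_tripleDensity₁_le hq hS hβ (hY.norm_fst_le x) hx hZA hZB).trans ?_
    rw [← hC, mul_assoc C]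
    refine mul_le_mul_of_nonneg_left ?_ hC0
    have h1 := rpow_sub_two_mul_mul_le hq (norm_nonneg (Y x).2.2) (norm_nonneg (Y x).2.2)
      (by positivity : 0 ≤ c * ‖(Y x).2.2‖ + N⁻¹ * ‖(Z x).2.2‖)
    refine le_trans (le_of_eq ?_) (mul_le_mul_of_nonneg_left h1 hN.le)
    field_simp
  refine hbd.trans ?_
  rw [integral_const_mul, integral_add_three hY.integrable hY.integrable i1]
  have : ∫ x, ‖(Y x).2.2‖ ^ q ∂μ + ∫ x, ‖(Y x).2.2‖ ^ q ∂μ + ∫ x, (c * ‖(Y x).2.2‖ + N⁻¹ * ‖(Z x).2.2‖) ^ q ∂μ ≤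
      2 * Γ + 2 ^ q * (c ^ q * Γ + 1) := by
    have : 2 ^ q * (c ^ q * (∫ x, ‖(Y x).2.2‖ ^ q ∂μ) + 1) ≤ 2 ^ q * (c ^ q * Γ + 1) := by gcongr
    linarith
  calc _ ≤ C * N * (2 * Γ + 2 ^ q * (c ^ q * Γ + 1)) := by gcongr
    _ = _ := by ring

lemma abs_integral_tripleDensity₂_le (hq : 2 < q) (hβ : 0 < β) (hS : 1 ≤ S)
    (hY : LqTriple μ q S Y) (hZ : LqTriple μ q s Z) (hW : LqTriple μ q r W) (hB : ∀ᵐ x ∂μ, β ≤ ‖(Y x).2.1‖)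
    {c N N' Γ : ℝ} (hc : 0 ≤ c) (hN : 0 < N) (hN' : 0 < N') (hs : s ≤ c * N) (hr : r ≤ c * N')
    (hZN : ∫ x, ‖(Z x).2.2‖ ^ q ∂μ ≤ N ^ q) (hWN : ∫ x, ‖(W x).2.2‖ ^ q ∂μ ≤ N' ^ q)
    (hΓ : ∫ x, ‖(Y x).2.2‖ ^ q ∂μ ≤ Γ) :
    |∫ x, tripleDensity₂ q (Y x) (Z x) (W x) ∂μ| ≤
      tripleConst q S β * tripleConst₂ q β * (Γ + 2 * (2 ^ q * (c ^ q * Γ + 1))) * N * N' := by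
  have hq0 : 0 < q := by linarith
  set C := tripleConst q S β * tripleConst₂ q β with hC
  have hC0 : 0 ≤ C := mul_nonneg (tripleConst_nonneg (by linarith)) (by unfold tripleConst₂; positivity)
  obtain ⟨i1, i2⟩ := integral_scaled_rpow_le hq0 (fun x => norm_nonneg (Y x).2.2) (fun x => norm_nonneg (Z x).2.2)
    hY.integrable hZ.integrable hY.measurable_norm hZ.measurable_norm hc hN hZN
  obtain ⟨j1, j2⟩ := integral_scaled_rpow_le hq0 (fun x => norm_nonneg (Y x).2.2) (fun x => norm_nonneg (W x).2.2)
    hY.integrable hW.integrable hY.measurable_norm hW.measurable_norm hc hN' hWN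
  have hbd : |∫ x, tripleDensity₂ q (Y x) (Z x) (W x) ∂μ| ≤
      ∫ x, C * (N * N') * (‖(Y x).2.2‖ ^ q + (c * ‖(Y x).2.2‖ + N⁻¹ * ‖(Z x).2.2‖) ^ q +
        (c * ‖(Y x).2.2‖ + N'⁻¹ * ‖(W x).2.2‖) ^ q) ∂μ := by
    rw [← Real.norm_eq_abs]
    refine norm_integral_le_of_norm_le (((hY.integrable.add i1).add j1).const_mul _) ?_
    filter_upwards [hB] with x hx
    refine (abs_tripleDensity₂_le hq hS hβ (hY.norm_fst_le x) hx ((hZ.norm_fst_le x).trans hs)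
      ((hZ.norm_mid_le x).trans hs) ((hW.norm_fst_le x).trans hr) ((hW.norm_mid_le x).trans hr)).trans ?_
    rw [← hC, mul_assoc C]
    refine mul_le_mul_of_nonneg_left ?_ hC0
    have h1 := rpow_sub_two_mul_mul_le hq (norm_nonneg (Y x).2.2)
      (by positivity : 0 ≤ c * ‖(Y x).2.2‖ + N⁻¹ * ‖(Z x).2.2‖)
      (by positivity : 0 ≤ c * ‖(Y x).2.2‖ + N'⁻¹ * ‖(W x).2.2‖)
    refine le_trans (le_of_eq ?_) (mul_le_mul_of_nonneg_left h1 (by positivity : 0 ≤ N * N'))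
    field_simp
  refine hbd.trans ?_
  rw [integral_const_mul, integral_add_three hY.integrable i1 j1]
  have : ∫ x, ‖(Y x).2.2‖ ^ q ∂μ + ∫ x, (c * ‖(Y x).2.2‖ + N⁻¹ * ‖(Z x).2.2‖) ^ q ∂μ +
      ∫ x, (c * ‖(Y x).2.2‖ + N'⁻¹ * ‖(W x).2.2‖) ^ q ∂μ ≤ Γ + 2 * (2 ^ q * (c ^ q * Γ + 1)) := by
    have : 2 ^ q * (c ^ q * (∫ x, ‖(Y x).2.2‖ ^ q ∂μ) + 1) ≤ 2 ^ q * (c ^ q * Γ + 1) := by gcongr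
    linarith
  calc _ ≤ C * (N * N') * (Γ + 2 * (2 ^ q * (c ^ q * Γ + 1))) := by gcongr
    _ = _ := by ring

end Abstract

/-! ### Existence of the variations of TP -/

section Variations

variable {n : ℕ} {q β S : ℝ} {u v w : UnitAddCircle → EuclideanSpace ℝ (Fin n)}

lemma FiniteEnergyCurve.hasDerivAt_add_smul (hu : FiniteEnergyCurve q u) (hw : FiniteEnergyCurve q w) (τ t : ℝ) :
    HasDerivAt (fun s : ℝ => (u + τ • w) s) (circleDeriv u t + τ • circleDeriv w t) t :=
  (hu.hasDerivAt t).add ((hw.hasDerivAt t).const_smul τ)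

lemma FiniteEnergyCurve.circleDeriv_add_smul (hu : FiniteEnergyCurve q u) (hw : FiniteEnergyCurve q w) (τ : ℝ)
    (x : UnitAddCircle) : circleDeriv (u + τ • w) x = circleDeriv u x + τ • circleDeriv w x := by
  obtain ⟨t, -, rfl⟩ := exists_coe_Ioc 0 x
  exact circleDeriv_coe (hu.hasDerivAt_add_smul hw τ t)

lemma circleEnergy_add_smul_le (hq : 0 < q) {f g : UnitAddCircle → EuclideanSpace ℝ (Fin n)} (hf : Continuous f)
    (τ : ℝ) : circleEnergy q (fun x => f x + τ • g x) ≤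
      ENNReal.ofReal (2 ^ q) * (circleEnergy q f + ENNReal.ofReal (|τ| ^ q) * circleEnergy q g) := by
  unfold circleEnergy
  have hm : Measurable fun p : UnitAddCircle × UnitAddCircle =>
      ENNReal.ofReal (‖f p.1 - f p.2‖ ^ q / ‖p.1 - p.2‖ ^ q) := by
    have h1 : Continuous fun p : UnitAddCircle × UnitAddCircle => ‖f p.1 - f p.2‖ := by fun_prop
    have h2 : Continuous fun p : UnitAddCircle × UnitAddCircle => ‖p.1 - p.2‖ := by fun_prop
    exact ((h1.measurable.pow_const q).div (h2.measurable.pow_const q)).ennreal_ofReal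
  rw [← lintegral_const_mul' _ _ ENNReal.ofReal_ne_top, ← lintegral_add_left hm,
    ← lintegral_const_mul' _ _ ENNReal.ofReal_ne_top]
  refine lintegral_mono fun p => ?_
  rw [← ENNReal.ofReal_mul (by positivity), ← ENNReal.ofReal_add (by positivity) (by positivity),
    ← ENNReal.ofReal_mul (by positivity)]
  apply ENNReal.ofReal_le_ofReal
  rw [← mul_div_assoc, ← add_div, ← mul_div_assoc, ← Real.mul_rpow (abs_nonneg _) (norm_nonneg _)]
  gcongr
  refine le_trans (Real.rpow_le_rpow (norm_nonneg _) ?_ hq.le)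
    (add_rpow_le_two_rpow_mul hq.le (norm_nonneg _) (by positivity))
  rw [← Real.norm_eq_abs, ← norm_smul, smul_sub, add_sub_add_comm]
  exact norm_add_le _ _

lemma FiniteEnergyCurve.add_smul (hq : 0 < q) (hu : FiniteEnergyCurve q u) (hw : FiniteEnergyCurve q w) (τ : ℝ) :
    FiniteEnergyCurve q (u + τ • w) := by
  have e : circleDeriv (u + τ • w) = fun x => circleDeriv u x + τ • circleDeriv w x :=
    funext (hu.circleDeriv_add_smul hw τ)
  refine ⟨?_, fun t => ?_, ?_⟩
  · rw [e]; exact hu.continuous_deriv.add (hw.continuous_deriv.const_smul τ)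
  · rw [e]; exact hu.hasDerivAt_add_smul hw τ t
  · rw [e]
    exact ne_top_of_le_ne_top (ENNReal.mul_ne_top ENNReal.ofReal_ne_top (ENNReal.add_ne_top.2
      ⟨hu.energy_ne_top, ENNReal.mul_ne_top ENNReal.ofReal_ne_top hw.energy_ne_top⟩))
      (circleEnergy_add_smul_le hq hu.continuous_deriv τ)

lemma FiniteEnergyCurve.add (hq : 0 < q) (hu : FiniteEnergyCurve q u) (hw : FiniteEnergyCurve q w) :
    FiniteEnergyCurve q (u + w) := by
  simpa using hu.add_smul hq hw 1

/-- The tangent, the chord quotient and the Taylor quotient of a curve. -/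
def curveTriple (w : UnitAddCircle → EuclideanSpace ℝ (Fin n)) (p : UnitAddCircle × UnitAddCircle) : CurveTriple n :=
  (tangentAt w p, chordQuotient w p, taylorQuotient w p)

lemma FiniteEnergyCurve.curveTriple_add_smul (hu : FiniteEnergyCurve q u) (hw : FiniteEnergyCurve q w) (τ : ℝ)
    (p : UnitAddCircle × UnitAddCircle) : curveTriple (u + τ • w) p = curveTriple u p + τ • curveTriple w p := by
  have h1 : tangentAt (u + τ • w) p = tangentAt u p + τ • tangentAt w p := hu.circleDeriv_add_smul hw τ _
  have h2 : chordQuotient (u + τ • w) p = chordQuotient u p + τ • chordQuotient w p := by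
    simp only [chordQuotient, Pi.add_apply, Pi.smul_apply]
    module
  have h3 : taylorQuotient (u + τ • w) p = taylorQuotient u p + τ • taylorQuotient w p := by
    simp only [taylorQuotient, h1, h2]
    module
  simp only [curveTriple, h1, h2, h3, Prod.smul_mk, Prod.mk_add_mk]

lemma FiniteEnergyCurve.curveTriple_add (hu : FiniteEnergyCurve q u) (hw : FiniteEnergyCurve q w)
    (p : UnitAddCircle × UnitAddCircle) : curveTriple (u + w) p = curveTriple u p + curveTriple w p := by
  simpa using hu.curveTriple_add_smul hw 1 p

lemma ofReal_norm_rpow {F : Type*} [NormedAddCommGroup F] (hq : 0 ≤ q) (a : F) :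
    ENNReal.ofReal (‖a‖ ^ q) = ‖a‖ₑ ^ q := by
  rw [← ofReal_norm, ENNReal.ofReal_rpow_of_nonneg (norm_nonneg _) hq]

lemma FiniteEnergyCurve.lqTriple (hq : 1 ≤ q) (hw : FiniteEnergyCurve q w) (hS : ∀ x, ‖circleDeriv w x‖ ≤ S) :
    LqTriple volume q S (curveTriple w) := by
  refine ⟨hw.measurable_tangentAt.prodMk (hw.measurable_chordQuotient.prodMk hw.measurable_taylorQuotient),
    fun p => hS _, norm_chordQuotient_le hS hw.hasDerivAt,
    (hw.measurable_taylorQuotient.norm.pow_const q).aestronglyMeasurable, ?_⟩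
  rw [hasFiniteIntegral_iff_ofReal (Eventually.of_forall fun p => by positivity)]
  refine lt_of_le_of_lt ?_ hw.energy_ne_top.lt_top
  refine le_trans (le_of_eq ?_) (hw.lintegral_taylorQuotient_le hq)
  exact lintegral_congr fun p => ofReal_norm_rpow (by linarith) _

lemma FiniteEnergyCurve.integral_taylorQuotient_le (hq : 1 ≤ q) (hw : FiniteEnergyCurve q w) :
    ∫ p, ‖(curveTriple w p).2.2‖ ^ q ≤ slobodeckijNorm (1 - 1 / q) q (circleDeriv w) ^ q := by
  have hq0 : 0 < q := by linarith
  have hm : Measurable fun p => ‖(curveTriple w p).2.2‖ ^ q := hw.measurable_taylorQuotient.norm.pow_const q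
  rw [integral_eq_lintegral_of_nonneg_ae (Eventually.of_forall fun p => by positivity) hm.aestronglyMeasurable]
  calc (∫⁻ p, ENNReal.ofReal (‖(curveTriple w p).2.2‖ ^ q)).toReal
      ≤ (circleEnergy q (circleDeriv w)).toReal := by
        refine ENNReal.toReal_mono hw.energy_ne_top (le_trans (le_of_eq ?_) (hw.lintegral_taylorQuotient_le hq))
        exact lintegral_congr fun p => ofReal_norm_rpow hq0.le _
    _ = ((circleEnergy q (circleDeriv w)).toReal ^ (1 / q)) ^ q := by
        rw [← Real.rpow_mul ENNReal.toReal_nonneg, one_div_mul_cancel hq0.ne', Real.rpow_one]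
    _ ≤ _ := by
        gcongr
        exact toReal_circleEnergy_le hq0 hw.continuous_deriv hw.energy_ne_top

lemma tpDensity_eq_tripleDensity (w : UnitAddCircle → EuclideanSpace ℝ (Fin n)) {p : UnitAddCircle × UnitAddCircle}
    (hp : p.1 ≠ p.2) : tpDensity q w p = tripleDensity q (curveTriple w p) := by
  rw [tpDensity_eq_quotient q w hp, Real.div_rpow (wedgeNorm_nonneg _ _) (by positivity)]
  simp only [tripleDensity, tripleWedge, curveTriple, norm_wedgeMap]
  rw [Real.rpow_neg (by positivity), div_eq_mul_inv]

lemma tripleDensity_nonneg (Y : CurveTriple n) : 0 ≤ tripleDensity q Y := by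
  unfold tripleDensity; positivity

lemma FiniteEnergyCurve.norm_circleDeriv_le (hq : 2 < q) (hw : FiniteEnergyCurve q w) (x : UnitAddCircle) :
    ‖circleDeriv w x‖ ≤ supConst q * slobodeckijNorm (1 - 1 / q) q (circleDeriv w) :=
  norm_le_slobodeckijNorm hq hw.continuous_deriv hw.energy_ne_top x

lemma FiniteEnergyCurve.exists_lqTriple (hq : 2 < q) (hw : FiniteEnergyCurve q w) :
    ∃ S, 1 ≤ S ∧ LqTriple volume q S (curveTriple w) :=
  ⟨max 1 _, le_max_left _ _, hw.lqTriple (by linarith) fun x => (hw.norm_circleDeriv_le hq x).trans (le_max_right _ _)⟩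

/-- The tangent-point functional of a bi-Lipschitz curve is a finite integral. -/
lemma FiniteEnergyCurve.tangentPoint_eq_ofReal (hq : 2 < q) (hβ : 0 < β) (hw : FiniteEnergyCurve q w)
    (hB : ∀ᵐ p, β ≤ ‖(curveTriple w p).2.1‖) :
    tangentPoint q w = ENNReal.ofReal (1 / q * ∫ p, tripleDensity q (curveTriple w p)) := by
  obtain ⟨S, -, hL⟩ := hw.exists_lqTriple hq
  rw [ENNReal.ofReal_mul (by positivity), ofReal_integral_eq_lintegral_ofReal (hL.integrable_tripleDensity hq hβ hB)
    (Eventually.of_forall fun p => tripleDensity_nonneg _)]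
  unfold tangentPoint
  congr 1
  refine lintegral_congr_ae ?_
  filter_upwards [ae_ne_diagonal] with p hp
  rw [← tpDensity_eq_tripleDensity w hp, tpDensity]

/-- A lower bound on chords persists along short segments. -/
lemma FiniteEnergyCurve.eventually_le_chord (hq : 2 < q) (hβ : 0 < β) (hu : FiniteEnergyCurve q u)
    (hw : FiniteEnergyCurve q w) (hB : ∀ᵐ p, β ≤ ‖(curveTriple u p).2.1‖) :
    ∀ᶠ τ : ℝ in 𝓝 0, ∀ᵐ p, β / 2 ≤ ‖(curveTriple (u + τ • w) p).2.1‖ := by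
  obtain ⟨S, -, hL⟩ := hu.exists_lqTriple hq
  obtain ⟨s, hs, hl⟩ := hw.exists_lqTriple hq
  filter_upwards [step_mem_nhds (by linarith : 0 ≤ s) hβ] with τ hτ
  filter_upwards [hB] with p hp
  rw [hu.curveTriple_add_smul hw]
  exact (triple_segment_bounds (by linarith) hτ (hL.norm_fst_le p) hp (hl.norm_fst_le p) (hl.norm_mid_le p)).2.1

lemma FiniteEnergyCurve.hasFirstVariation (hq : 2 < q) (hβ : 0 < β) (hu : FiniteEnergyCurve q u)
    (hw : FiniteEnergyCurve q w) (hB : ∀ᵐ p, β ≤ ‖(curveTriple u p).2.1‖) :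
    HasFirstVariation q u w (1 / q * ∫ p, tripleDensity₁ q (curveTriple u p) (curveTriple w p)) := by
  obtain ⟨S, hS, hL⟩ := hu.exists_lqTriple hq
  obtain ⟨s, -, hl⟩ := hw.exists_lqTriple hq
  have hev : ∀ᶠ τ : ℝ in 𝓝 0, tangentPoint q (u + τ • w) =
      ENNReal.ofReal (1 / q * ∫ p, tripleDensity q (curveTriple u p + τ • curveTriple w p)) := by
    filter_upwards [hu.eventually_le_chord hq hβ hw hB] with τ hτ
    rw [(hu.add_smul (by linarith) hw τ).tangentPoint_eq_ofReal hq (half_pos hβ) hτ]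
    simp_rw [hu.curveTriple_add_smul hw]
  refine ⟨hev.mono fun τ hτ => hτ ▸ ENNReal.ofReal_ne_top, ?_⟩
  refine ((hasDerivAt_integral_tripleDensity hq hβ hS hL hl hB).2.const_mul (1 / q)).congr_of_eventuallyEq ?_
  filter_upwards [hev] with τ hτ
  rw [hτ, ENNReal.toReal_ofReal]
  exact mul_nonneg (by positivity) (integral_nonneg fun p => tripleDensity_nonneg _)

/-- The first variation has to exist at every nearby curve `u + σw`. There the chord bound persists
with `β / 2`, so the formula for `δTP` is available before it is differentiated in `σ`. -/
lemma FiniteEnergyCurve.hasSecondVariation (hq : 2 < q) (hβ : 0 < β) (hu : FiniteEnergyCurve q u)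
    (hv : FiniteEnergyCurve q v) (hw : FiniteEnergyCurve q w) (hB : ∀ᵐ p, β ≤ ‖(curveTriple u p).2.1‖) :
    HasSecondVariation q u v w
      (1 / q * ∫ p, tripleDensity₂ q (curveTriple u p) (curveTriple v p) (curveTriple w p)) := by
  obtain ⟨S, hS, hL⟩ := hu.exists_lqTriple hq
  obtain ⟨s, -, hl⟩ := hv.exists_lqTriple hq
  obtain ⟨r, -, hl'⟩ := hw.exists_lqTriple hq
  refine ⟨fun σ => 1 / q * ∫ p, tripleDensity₁ q (curveTriple u p + σ • curveTriple w p) (curveTriple v p), ?_,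
    (hasDerivAt_integral_tripleDensity₁ hq hβ hS hL hl hl' hB).2.const_mul (1 / q)⟩
  filter_upwards [hu.eventually_le_chord hq hβ hw hB] with σ hσ
  have := (hu.add_smul (by linarith) hw σ).hasFirstVariation hq (half_pos hβ) hv hσ
  simpa only [hu.curveTriple_add_smul hw] using this

end Variations

/-! ### Norm bounds for the variations -/

section Bounds

variable {n : ℕ} {q β S Γ : ℝ} {u v w z : UnitAddCircle → EuclideanSpace ℝ (Fin n)}

/-- The rescaled Young estimate divides by the norm of the direction. Using larger numbers and
passing to the limit also covers directions whose derivative has norm 0. -/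
lemma le_mul_of_forall_gt_le_mul {a K N : ℝ} (h : ∀ N' > N, a ≤ K * N') : a ≤ K * N := by
  have hc : Tendsto (fun x : ℝ => K * x) (𝓝[>] N) (𝓝 (K * N)) :=
    ((continuous_const_mul K).tendsto N).mono_left nhdsWithin_le_nhds
  exact ge_of_tendsto hc (eventually_mem_nhdsWithin.mono h)

lemma FiniteEnergyCurve.abs_firstVariation_le (hq : 2 < q) (hβ : 0 < β) (hS : 1 ≤ S) (hu : FiniteEnergyCurve q u)
    (hw : FiniteEnergyCurve q w) (huS : ∀ x, ‖circleDeriv u x‖ ≤ S) (hB : ∀ᵐ p, β ≤ ‖(curveTriple u p).2.1‖)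
    (hΓ : ∫ p, ‖(curveTriple u p).2.2‖ ^ q ≤ Γ) :
    |∫ p, tripleDensity₁ q (curveTriple u p) (curveTriple w p)| ≤
      tripleConst q S β * (q + 2 * q / β) * (2 * Γ + 2 ^ q * (supConst q ^ q * Γ + 1)) *
        slobodeckijNorm (1 - 1 / q) q (circleDeriv w) := by
  have hC := supConst_pos hq
  have hN := slobodeckijNorm_nonneg (1 - 1 / q) q (circleDeriv w)
  refine le_mul_of_forall_gt_le_mul fun N' hN' => ?_
  exact abs_integral_tripleDensity₁_le hq hβ hS (hu.lqTriple (by linarith) huS)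
    (hw.lqTriple (by linarith) (hw.norm_circleDeriv_le hq)) hB hC.le (hN.trans_lt hN') (by gcongr)
    ((hw.integral_taylorQuotient_le (by linarith)).trans (by gcongr)) hΓ

lemma FiniteEnergyCurve.abs_secondVariation_le (hq : 2 < q) (hβ : 0 < β) (hS : 1 ≤ S) (hu : FiniteEnergyCurve q u)
    (hv : FiniteEnergyCurve q v) (hw : FiniteEnergyCurve q w) (huS : ∀ x, ‖circleDeriv u x‖ ≤ S)
    (hB : ∀ᵐ p, β ≤ ‖(curveTriple u p).2.1‖) (hΓ : ∫ p, ‖(curveTriple u p).2.2‖ ^ q ≤ Γ) :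
    |∫ p, tripleDensity₂ q (curveTriple u p) (curveTriple v p) (curveTriple w p)| ≤
      tripleConst q S β * tripleConst₂ q β * (Γ + 2 * (2 ^ q * (supConst q ^ q * Γ + 1))) *
        slobodeckijNorm (1 - 1 / q) q (circleDeriv v) * slobodeckijNorm (1 - 1 / q) q (circleDeriv w) := by
  have hC := supConst_pos hq
  have hN := slobodeckijNorm_nonneg (1 - 1 / q) q (circleDeriv v)
  have hM := slobodeckijNorm_nonneg (1 - 1 / q) q (circleDeriv w)
  refine le_mul_of_forall_gt_le_mul fun M' hM' => ?_
  rw [mul_right_comm]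
  refine le_mul_of_forall_gt_le_mul fun N' hN' => ?_
  rw [mul_right_comm]
  exact abs_integral_tripleDensity₂_le hq hβ hS (hu.lqTriple (by linarith) huS)
    (hv.lqTriple (by linarith) (hv.norm_circleDeriv_le hq)) (hw.lqTriple (by linarith) (hw.norm_circleDeriv_le hq))
    hB hC.le (hN.trans_lt hN') (hM.trans_lt hM') (by gcongr) (by gcongr)
    ((hv.integral_taylorQuotient_le (by linarith)).trans (by gcongr))
    ((hw.integral_taylorQuotient_le (by linarith)).trans (by gcongr)) hΓ

lemma FiniteEnergyCurve.integral_taylorQuotient_add_le (hq : 1 ≤ q) (hu : FiniteEnergyCurve q u)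
    (hz : FiniteEnergyCurve q z) (huS : ∀ x, ‖circleDeriv u x‖ ≤ S) (hzS : ∀ x, ‖circleDeriv z x‖ ≤ S) :
    ∫ p, ‖(curveTriple (u + z) p).2.2‖ ^ q ≤ 2 ^ q * (slobodeckijNorm (1 - 1 / q) q (circleDeriv u) ^ q +
      slobodeckijNorm (1 - 1 / q) q (circleDeriv z) ^ q) := by
  have hq0 : 0 < q := by linarith
  have hi := (hu.lqTriple hq huS).integrable
  have hi' := (hz.lqTriple hq hzS).integrable
  calc ∫ p, ‖(curveTriple (u + z) p).2.2‖ ^ q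
      ≤ ∫ p, 2 ^ q * (‖(curveTriple u p).2.2‖ ^ q + ‖(curveTriple z p).2.2‖ ^ q) := by
        refine integral_mono_of_nonneg (Eventually.of_forall fun p => by positivity) ((hi.add hi').const_mul _)
          (Eventually.of_forall fun p => ?_)
        refine le_trans (Real.rpow_le_rpow (norm_nonneg _) ?_ hq0.le)
          (add_rpow_le_two_rpow_mul hq0.le (norm_nonneg _) (norm_nonneg _))
        rw [hu.curveTriple_add hz]
        exact norm_add_le _ _
    _ = 2 ^ q * ((∫ p, ‖(curveTriple u p).2.2‖ ^ q) + ∫ p, ‖(curveTriple z p).2.2‖ ^ q) := by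
        rw [integral_const_mul, integral_add hi hi']
    _ ≤ _ := by
        gcongr
        · exact hu.integral_taylorQuotient_le hq
        · exact hz.integral_taylorQuotient_le hq

lemma FiniteEnergyCurve.le_slobodeckijNorm (hq : 2 < q) (hu : FiniteEnergyCurve q u) {lam : ℝ}
    (hl : ∀ x, lam ≤ ‖circleDeriv u x‖) : lam ≤ slobodeckijNorm (1 - 1 / q) q (circleDeriv u) := by
  refine le_trans ?_ (integral_norm_le_slobodeckijNorm (by linarith) hu.continuous_deriv hu.energy_ne_top)
  have h := integral_mono (μ := (volume : Measure UnitAddCircle)) (integrable_const lam)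
    (hu.continuous_deriv.norm.integrable_of_hasCompactSupport (HasCompactSupport.of_compactSpace _)) hl
  simpa using h

/-- The constant term 1 left by Young's inequality is at most `(lam^q)⁻¹ N^q`, because `lam ≤ N`;
this makes the bound a pure multiple of `N^q`. -/
lemma first_bound_le {κ K C lam N Nw : ℝ} (hq : 0 < q) (hκ : 0 ≤ κ) (hK : 0 ≤ K) (hlam : 0 < lam)
    (hlN : lam ≤ N) (hNw : 0 ≤ Nw) :
    κ * (K * (2 * N ^ q + 2 ^ q * (C ^ q * N ^ q + 1)) * Nw) ≤
      (κ * (K * (2 + 2 ^ q * (C ^ q + (lam ^ q)⁻¹))) + 1) * N ^ q * Nw := by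
  have hN : 0 ≤ N := hlam.le.trans hlN
  have h1 : 1 ≤ (lam ^ q)⁻¹ * N ^ q := by
    rw [inv_mul_eq_div, one_le_div (by positivity)]
    gcongr
  calc κ * (K * (2 * N ^ q + 2 ^ q * (C ^ q * N ^ q + 1)) * Nw)
      ≤ κ * (K * (2 * N ^ q + 2 ^ q * (C ^ q * N ^ q + (lam ^ q)⁻¹ * N ^ q)) * Nw) := by gcongr
    _ = κ * (K * (2 + 2 ^ q * (C ^ q + (lam ^ q)⁻¹))) * N ^ q * Nw := by ring
    _ ≤ _ := by
      gcongr
      exact (lt_add_one _).le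

lemma second_bound_le {κ K C g X Nv Nw : ℝ} (hκ : 0 ≤ κ) (hK : 0 ≤ K) (hX : 1 ≤ X) (hNv : 0 ≤ Nv)
    (hNw : 0 ≤ Nw) :
    κ * (K * (g * X + 2 * (2 ^ q * (C ^ q * (g * X) + 1))) * Nv * Nw) ≤
      (κ * (K * (g + 2 * (2 ^ q * (C ^ q * g + 1)))) + 1) * X * Nv * Nw := by
  have hX0 : 0 ≤ X := zero_le_one.trans hX
  calc κ * (K * (g * X + 2 * (2 ^ q * (C ^ q * (g * X) + 1))) * Nv * Nw)
      ≤ κ * (K * (g * X + 2 * (2 ^ q * (C ^ q * (g * X) + X))) * Nv * Nw) := by gcongr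
    _ = κ * (K * (g + 2 * (2 ^ q * (C ^ q * g + 1)))) * X * Nv * Nw := by ring
    _ ≤ _ := by
      gcongr
      exact (lt_add_one _).le

end Bounds

end

/-! ### Choice of the constants and conclusion -/

theorem lemma2p1 (n : ℕ) (q : ℝ) (hq : 2 < q) (lam Lam M : ℝ) (hlam : 0 < lam)
    (hLam : lam ≤ Lam) (hM : 0 < M) :
    ∃ c₁ c₂ R : ℝ, 0 < c₁ ∧ 0 < c₂ ∧ 0 < R ∧
      ∀ u : UnitAddCircle → EuclideanSpace ℝ (Fin n),
        IsSobolevCurve q u → Function.Injective u → (∀ x, circleDeriv u x ≠ 0) →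
        (∀ x, lam ≤ ‖circleDeriv u x‖ ∧ ‖circleDeriv u x‖ ≤ Lam) →
        tangentPoint q u ≤ ENNReal.ofReal M →
        (∀ w : UnitAddCircle → EuclideanSpace ℝ (Fin n), IsSobolevCurve q w →
          ∃ d : ℝ, HasFirstVariation q u w d ∧
            |d| ≤ c₁ * slobodeckijNorm (1 - 1 / q) q (circleDeriv u) ^ q *
              slobodeckijNorm (1 - 1 / q) q (circleDeriv w)) ∧
        (∀ z : UnitAddCircle → EuclideanSpace ℝ (Fin n), IsSobolevCurve q z →
          slobodeckijNorm (1 - 1 / q) q (circleDeriv z) ≤ R →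
          ∀ v w : UnitAddCircle → EuclideanSpace ℝ (Fin n),
            IsSobolevCurve q v → IsSobolevCurve q w →
            ∃ d : ℝ, HasSecondVariation q (u + z) v w d ∧
              |d| ≤ c₂ * (slobodeckijNorm (1 - 1 / q) q (circleDeriv u) ^ (2 * q + 2) + 1) *
                slobodeckijNorm (1 - 1 / q) q (circleDeriv v) *
                slobodeckijNorm (1 - 1 / q) q (circleDeriv w)) := by
  obtain ⟨β, hβ, hbi⟩ := exists_biLipschitz_const q lam Lam M hq hlam hLam hM
  have hq0 : 0 < q := by linarith
  have hC := supConst_pos hq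
  set C := supConst q with hCdef
  -- By the supremum bound, `‖z'‖ ≤ R` in norm gives `|z'| ≤ β / 2` pointwise. The chord quotients
  -- of `z` are then at most `β / 2`, so those of `u + z` stay at least `β / 2`.
  set R := β / (2 * C) with hR
  have hR0 : 0 < R := by positivity
  have hCR : C * R = β / 2 := by rw [hR]; field_simp
  set S := Lam + β / 2 + 1 with hS
  have hS1 : 1 ≤ S := by linarith
  set K₁ := tripleConst q S β * (q + 2 * q / β) with hK₁
  have hK₁0 : 0 ≤ K₁ := mul_nonneg (tripleConst_nonneg (by linarith)) (by positivity)
  set K₂ := tripleConst q S (β / 2) * tripleConst₂ q (β / 2) with hK₂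
  have hK₂0 : 0 ≤ K₂ := mul_nonneg (tripleConst_nonneg (by linarith)) (by unfold tripleConst₂; positivity)
  -- The Taylor quotient of `u + z` has `q`-th power integral at most `2^q (N^q + R^q)`, hence at
  -- most `g X` with `X = N^(2q+2) + 1`.
  set g := 2 ^ q * (1 + R ^ q) with hg
  have hg0 : 0 ≤ g := by positivity
  refine ⟨1 / q * (K₁ * (2 + 2 ^ q * (C ^ q + (lam ^ q)⁻¹))) + 1,
    1 / q * (K₂ * (g + 2 * (2 ^ q * (C ^ q * g + 1)))) + 1, R, by positivity, by positivity, hR0, ?_⟩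
  intro u hu hinj _ hlL hTP
  have hu := hu.finiteEnergyCurve hq
  have hchord := hbi n u (fun x => (hlL x).1) (fun x => (hlL x).2) hu.continuous hu.continuous_deriv hu.hasDerivAt
    hinj hTP
  have hB : ∀ᵐ p, β ≤ ‖(curveTriple u p).2.1‖ := ae_ne_diagonal.mono fun p hp => le_norm_chordQuotient hchord hp
  set N := slobodeckijNorm (1 - 1 / q) q (circleDeriv u) with hN
  have hlN : lam ≤ N := hu.le_slobodeckijNorm hq fun x => (hlL x).1
  have hN0 : 0 ≤ N := hlam.le.trans hlN
  constructor
  · intro w hw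
    have hw := hw.finiteEnergyCurve hq
    refine ⟨_, hu.hasFirstVariation hq hβ hw hB, ?_⟩
    have hb := hu.abs_firstVariation_le hq hβ hS1 hw (fun x => (hlL x).2.trans (by linarith)) hB
      (hu.integral_taylorQuotient_le (by linarith))
    rw [← hN, ← hCdef, ← hK₁] at hb
    have hNw := slobodeckijNorm_nonneg (1 - 1 / q) q (circleDeriv w)
    set Nw := slobodeckijNorm (1 - 1 / q) q (circleDeriv w)
    rw [abs_mul, abs_of_nonneg (by positivity : 0 ≤ 1 / q)]
    exact (mul_le_mul_of_nonneg_left hb (by positivity)).trans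
      (first_bound_le hq0 (by positivity) hK₁0 hlam hlN hNw)
  · intro z hz hzR v w hv hw
    have hz := hz.finiteEnergyCurve hq
    have hv := hv.finiteEnergyCurve hq
    have hw := hw.finiteEnergyCurve hq
    have huz := hu.add hq0 hz
    have hz2 : ∀ x, ‖circleDeriv z x‖ ≤ β / 2 := fun x => by
      rw [← hCR]
      exact (hz.norm_circleDeriv_le hq x).trans (by gcongr)
    have hB' : ∀ᵐ p, β / 2 ≤ ‖(curveTriple (u + z) p).2.1‖ := by
      filter_upwards [hB] with p hp
      rw [hu.curveTriple_add hz]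
      have h1 : ‖(curveTriple z p).2.1‖ ≤ β / 2 := norm_chordQuotient_le hz2 hz.hasDerivAt p
      have h2 := norm_sub_norm_le (curveTriple u p).2.1 (-(curveTriple z p).2.1)
      rw [norm_neg, sub_neg_eq_add] at h2
      change β / 2 ≤ ‖(curveTriple u p).2.1 + (curveTriple z p).2.1‖
      linarith
    have hS' : ∀ x, ‖circleDeriv (u + z) x‖ ≤ S := fun x => by
      have h1 := hu.circleDeriv_add_smul hz 1 x
      rw [one_smul, one_smul] at h1
      rw [h1]
      refine (norm_add_le _ _).trans ?_
      linarith [(hlL x).2, hz2 x]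
    refine ⟨_, huz.hasSecondVariation hq (half_pos hβ) hv hw hB', ?_⟩
    set X := N ^ (2 * q + 2) + 1 with hX
    have hX1 : 1 ≤ X := by have : 0 ≤ N ^ (2 * q + 2) := by positivity
                           linarith
    -- The argument needs only the power `N^q`; the stated exponent `2q + 2` is reached by comparing
    -- powers, separately for `N ≤ 1` and `N ≥ 1`.
    have hNX : N ^ q ≤ X := by
      rcases le_total N 1 with h | h
      · exact (Real.rpow_le_one hN0 h hq0.le).trans hX1
      · have := Real.rpow_le_rpow_of_exponent_le h (by linarith : q ≤ 2 * q + 2)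
        linarith
    have hΓ : ∫ p, ‖(curveTriple (u + z) p).2.2‖ ^ q ≤ g * X := by
      refine (hu.integral_taylorQuotient_add_le (by linarith) hz (S := S) (fun x => (hlL x).2.trans (by linarith))
        fun x => (hz2 x).trans (by linarith)).trans ?_
      rw [hg, mul_assoc, add_mul, one_mul]
      have h0 := slobodeckijNorm_nonneg (1 - 1 / q) q (circleDeriv z)
      gcongr
      calc _ ≤ R ^ q := Real.rpow_le_rpow h0 hzR hq0.le
        _ ≤ R ^ q * X := le_mul_of_one_le_right (by positivity) hX1
    have hb := huz.abs_secondVariation_le hq (half_pos hβ) hS1 hv hw hS' hB' hΓ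
    rw [← hCdef, ← hK₂] at hb
    have hNv := slobodeckijNorm_nonneg (1 - 1 / q) q (circleDeriv v)
    have hNw := slobodeckijNorm_nonneg (1 - 1 / q) q (circleDeriv w)
    set Nv := slobodeckijNorm (1 - 1 / q) q (circleDeriv v)
    set Nw := slobodeckijNorm (1 - 1 / q) q (circleDeriv w)
    rw [abs_mul, abs_of_nonneg (by positivity : 0 ≤ 1 / q)]
    exact (mul_le_mul_of_nonneg_left hb (by positivity)).trans
      (second_bound_le (by positivity) hK₂0 hX1 hNv hNw)
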